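/- **Setting.** Let $\mathbb M=\mathbb R\times\Sigma$, with $\Sigma$ a Hausdorff, second countable smooth $(d-1)$-manifold, carry a smooth metric $g$ of signature $(1,-1,\dots,-1)$, globally hyperbolic, with the coordinate $t\in\mathbb R$ as time function; $dx$ is the canonical volume and $\Box$ the d'Alembertian of $g$. The space-time is *stationary*: $g$ does not depend on $t$. Let $\mathcal D$ denote $C_0^\infty(\mathbb M,\mathbb C)$. Fix $m>0$, $b>0$ and real constants $b_n$ ($n\ge 3$). Let $G_{\rm r}$, $G_{\rm a}$ be the retarded and advanced fundamental solutions of $\Box+m^2$ (the support of $y\mapsto G_{\rm r/a}(f,y)$ lies in the causal past/future of ${\rm supp}\,f$), and $D=G_{\rm r}-G_{\rm a}$. Let $D^+$ be a complex distribution on $\mathbb M\times\mathbb M$ such that $D^+((\Box+m^2)f,h)=D^+(f,(\Box+m^2)h)=0$, $\ D^-(f,h):=D^+(h,f)=\overline{D^+(\bar f,\bar h)}$, ${\rm Im}\,D^+=D$ (that is, $D^+-D^-=2iD$), $D^+(\bar f,f)\ge 0$, $D^+$ is invariant under time translations, and $D^+(f,\cdot)$ is a measurable, locally integrable function for every $f\in\mathcal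 D$. Assume the dispersion condition $\int_{\mathbb M}|D^+(f,x)|^n\,dx<\infty$ for all $f\in\mathcal D$ and all $n\ge3$ with $b_n\ne0$. For $a_l\in\{{\rm in},{\rm loc},{\rm out}\}$ define truncated vacuum expectation values as follows: the one-point functions vanish, $\langle\Psi_0,\phi^{a_1}(f_1)\phi^{a_2}(f_2)\Psi_0\rangle^T=\frac{b^2}{m^2}D^+(f_1,f_2)$, and for $n\ge3$ $$\langle\Psi_0,\phi^{a_1}(f_1)\cdots\phi^{a_n}(f_n)\Psi_0\rangle^T=b_n\sum_{k:\,a_k\neq{\rm in}}\int_{\mathbb M}\prod_{l<k}D^+(f_l,y)\;C_{a_k}(f_k,y)\prod_{l>k}D^-(f_l,y)\,dy,\qquad C_{\rm loc}=G_{\rm r},\; C_{\rm out}=D .$$ The vacuum expectation values are the sums over all partitions of $\{1,\dots,n\}$ of products of truncated ones (in each block the order of the fields is kept; the value for $n=0$ is $1$). **Spectral gap.** Let $\hat f(E)=(2\pi)^{-1/2}\int e^{-itE}f(t)\,dt$. Assume that, for some $\epsilon>0$, $D^+$ satisfies the one-particle spectral condition with gap $\epsilon$: for all $h_1,h_2\in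 C_0^\infty(\Sigma,\mathbb C)$, the distribution $D^+(x^0-y^0,h_1,h_2)$ is tempered in the time difference and its Fourier transform, $\hat D^+(f,h_1,h_2)=D^+(\hat f,h_1,h_2)$, vanishes on $(-\infty,\epsilon)$. **Theorem.** The mixed vacuum expectation values define a linear functional $\underline F$ on the tensor algebra over $C_0^\infty(\mathbb M,\mathbb C^3)$ (the three components being labelled in, loc, out), which is Hermitean and invariant under time translations. Let $\mathcal V$ be the quotient of this algebra by the left ideal $\{\underline f:\underline F(\underline g\otimes\underline f)=0\ \forall\underline g\}$, with inner product $\langle[\underline f],[\underline g]\rangle=\underline F(\underline f^*\otimes\underline g)$, vacuum $\Psi_0=[1]$, fields $\phi^{a}(f)$ acting by left multiplication, and time translations ${\sf U}(t)[\underline f]=[\underline f_t]$, where $f_t(s,x)=f(s-t,x)$. Then: 1. The whole theory satisfies the spectral condition: for all $\Psi,\Phi\in\mathcal V$ and every Schwartz function $f$ on $\mathbb R$ whose Fourier transform $\hat f$ vanishes on $(-\infty,0)$, the integral below converges absolutely and $$\int_{\mathbb R}\langle\Psi,{\sf U}(t)\Phi\rangle f(-t)\,dt=0 .$$ 2. For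 $a={\rm in}$ and $a={\rm out}$, the field $\phi^a$ satisfies on $\mathcal V$ the Klein–Gordon equation $\phi^a((\Box+m^2)f)=0$ and the CCR $[\phi^a(f),\phi^a(h)]=2i\frac{b^2}{m^2}D(f,h)$. For $n\ge3$ the truncated $n$-point functions of the out-field alone coincide with those of the in-field alone, both being $0$. The CCR representations generated by the in- and out-fields are unitarily equivalent: with $\mathcal V^{a}\subseteq\mathcal V$ the linear span of the vectors obtained by repeated application of $\phi^{a}$ to $\Psi_0$, there is a linear bijection $W:\mathcal V^{\rm in}\to\mathcal V^{\rm out}$ that preserves $\langle\cdot,\cdot\rangle$, with $W\Psi_0=\Psi_0$ and $W\phi^{\rm in}(f)W^{-1}=\phi^{\rm out}(f)$ for all $f\in\mathcal D$. -/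

import Mathlib

open Set Filter Topology MeasureTheory
open scoped Manifold ContDiff ComplexConjugate SchwartzMap

noncomputable section

namespace QFT

/-! ### Space-time `ℝ × S` and test functions -/

/-- The model vector space of `ℝ × S`, where `S` is an `n`-dimensional manifold
(so the space-time dimension is `n + 1`). -/
abbrev Model (n : ℕ) : Type := ℝ × EuclideanSpace ℝ (Fin n)

/-- The model with corners of `ℝ × S`. -/
abbrev stModel (n : ℕ) : ModelWithCorners ℝ (Model n) (ModelProd ℝ (EuclideanSpace ℝ (Fin n))) :=
  𝓘(ℝ, ℝ).prod 𝓘(ℝ, EuclideanSpace ℝ (Fin n))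

/-- The space `𝓓(X, ℂ)` of smooth compactly supported complex functions on a manifold. -/
def testFunctions {E H : Type*} [NormedAddCommGroup E] [NormedSpace ℝ E] [TopologicalSpace H]
    (I : ModelWithCorners ℝ E H) (X : Type*) [TopologicalSpace X] [ChartedSpace H X] :
    Submodule ℂ (X → ℂ) where
  carrier := {f | ContMDiff I 𝓘(ℝ, ℂ) ∞ f ∧ HasCompactSupport f}
  zero_mem' := ⟨contMDiff_const, HasCompactSupport.zero⟩
  add_mem' := fun hf hg => ⟨hf.1.add hg.1, hf.2.add hg.2⟩
  smul_mem' := by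
    intro c f hf
    refine ⟨?_, hf.2.smul_left⟩
    have hc : ContMDiff I 𝓘(ℝ, ℂ) ∞ (fun _ : X => c) := contMDiff_const
    exact (contDiff_mul (𝕜 := ℝ) (𝔸 := ℂ) (n := ∞)).contMDiff.comp (hc.prodMk_space hf.1)

/-- `𝓓(ℝ, ℂ)`. -/
abbrev TimeTest : Type := testFunctions 𝓘(ℝ, ℝ) ℝ

/-- `𝓓(S, ℂ)`. -/
abbrev SpaceTest (n : ℕ) (S : Type*) [TopologicalSpace S]
    [ChartedSpace (EuclideanSpace ℝ (Fin n)) S] : Type _ :=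
  testFunctions 𝓘(ℝ, EuclideanSpace ℝ (Fin n)) S

/-- `𝓓(ℝ × S, ℂ)`. -/
abbrev Test (n : ℕ) (S : Type*) [TopologicalSpace S]
    [ChartedSpace (EuclideanSpace ℝ (Fin n)) S] : Type _ :=
  testFunctions (stModel n) (ℝ × S)

section Geometry

variable {n : ℕ} {S : Type*} [TopologicalSpace S] [ChartedSpace (EuclideanSpace ℝ (Fin n)) S]

/-- Complex conjugation of test functions. -/
def Test.conj (f : Test n S) : Test n S :=
  ⟨fun p => starRingEnd ℂ (f.1 p), by
    refine ⟨?_, ?_⟩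
    · exact (Complex.conjCLE.contDiff (n := ∞)).contMDiff.comp f.2.1
    · exact f.2.2.comp_left (g := starRingEnd ℂ) (map_zero _)⟩

/-- The time translate `(t, x) ↦ (t + s, x)` of a point. -/
def shift (s : ℝ) (p : ℝ × S) : ℝ × S := (p.1 + s, p.2)

/-- The time translate `f_s(t, x) = f(t - s, x)` of a test function. -/
def Test.translate (s : ℝ) : Test n S →ₗ[ℂ] Test n S where
  toFun f := ⟨fun p => f.1 (shift (-s) p), by
    refine ⟨?_, ?_⟩
    · refine f.2.1.comp ?_
      refine ContMDiff.prodMk ?_ contMDiff_snd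
      have h : ContMDiff 𝓘(ℝ, ℝ) 𝓘(ℝ, ℝ) ∞ (fun t : ℝ => t + -s) :=
        (contDiff_id.add contDiff_const).contMDiff
      exact h.comp contMDiff_fst
    · exact f.2.2.comp_homeomorph ((Homeomorph.addRight (-s)).prodCongr (Homeomorph.refl S))⟩
  map_add' _ _ := rfl
  map_smul' _ _ := rfl

/-- The product test function `(t, x) ↦ a(t) h(x)`. -/
def tensor [T2Space S] (a : TimeTest) (h : SpaceTest n S) : Test n S :=
  ⟨fun p => a.1 p.1 * h.1 p.2, by
    refine ⟨(contDiff_mul (𝕜 := ℝ) (𝔸 := ℂ) (n := ∞)).contMDiff.comp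
      ((a.2.1.comp contMDiff_fst).prodMk_space (h.2.1.comp contMDiff_snd)), ?_⟩
    refine HasCompactSupport.intro (a.2.2.isCompact.prod h.2.2.isCompact) ?_
    intro p hp
    by_cases h1 : p.1 ∈ tsupport a.1
    · have h2 : p.2 ∉ tsupport h.1 := fun h2 => hp ⟨h1, h2⟩
      simp [image_eq_zero_of_notMem_tsupport h2]
    · simp [image_eq_zero_of_notMem_tsupport h1]⟩

/-- Convergence to zero in `𝓓(ℝ × S, ℂ)`: the supports stay in a fixed compact set and, in every
chart, all derivatives converge to zero uniformly on compact sets. -/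
def TendsToZero (f : ℕ → Test n S) : Prop :=
  (∃ K : Set (ℝ × S), IsCompact K ∧ ∀ j, tsupport (f j).1 ⊆ K) ∧
  ∀ (p : ℝ × S) (N : ℕ) (C : Set (Model n)), IsCompact C → C ⊆ (extChartAt (stModel n) p).target →
    TendstoUniformlyOn
      (fun j z => iteratedFDeriv ℝ N ((f j).1 ∘ (extChartAt (stModel n) p).symm) z) 0 atTop C

/-! ### Lorentzian metrics -/

variable (n S) in
/-- A smooth metric of signature `(1, -1, …, -1)` on `ℝ × S`. -/
structure LorentzMetric [IsManifold 𝓘(ℝ, EuclideanSpace ℝ (Fin n)) ∞ S] where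
  /-- the bilinear form on each tangent space -/
  val (p : ℝ × S) : TangentSpace (stModel n) p →L[ℝ] TangentSpace (stModel n) p →L[ℝ] ℝ
  symm (p : ℝ × S) (v w : TangentSpace (stModel n) p) : val p v w = val p w v
  contMDiff : ContMDiff (stModel n) ((stModel n).prod 𝓘(ℝ, Model n →L[ℝ] Model n →L[ℝ] ℝ)) ∞
    (fun p => Bundle.TotalSpace.mk' (Model n →L[ℝ] Model n →L[ℝ] ℝ)
      (E := fun p : ℝ × S =>
        TangentSpace (stModel n) p →L[ℝ] TangentSpace (stModel n) p →L[ℝ] ℝ) p (val p))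
  /-- there is a time-like vector, and the form is negative definite on its orthogonal
  complement -/
  signature (p : ℝ × S) : ∃ v : TangentSpace (stModel n) p, 0 < val p v v ∧
    ∀ w : TangentSpace (stModel n) p, val p v w = 0 → w ≠ 0 → val p w w < 0

namespace LorentzMetric

variable [IsManifold 𝓘(ℝ, EuclideanSpace ℝ (Fin n)) ∞ S] (g : LorentzMetric n S)

/-- The standard basis of `ℝ × ℝⁿ`. -/
def stdBasis (n : ℕ) : Option (Fin n) → Model n
  | none => (1, 0)
  | some i => (0, EuclideanSpace.single i 1)

/-- The matrix `(g_{ij})` of the metric in the chart at `p`, at the chart point `z`. -/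
def gram (p : ℝ × S) (z : Model n) : Matrix (Option (Fin n)) (Option (Fin n)) ℝ :=
  fun i j => g.val ((extChartAt (stModel n) p).symm z)
    (mfderiv 𝓘(ℝ, Model n) (stModel n) (extChartAt (stModel n) p).symm z (stdBasis n i))
    (mfderiv 𝓘(ℝ, Model n) (stModel n) (extChartAt (stModel n) p).symm z (stdBasis n j))

/-- The volume density `|det (g_{ij})|^{1/2}` in the chart at `p`. -/
def density (p : ℝ × S) (z : Model n) : ℝ := Real.sqrt |(g.gram p z).det|

/-- `μ` is the canonical volume measure of `g`: in each chart it is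
`|det (g_{ij})|^{1/2}` times Lebesgue measure. -/
def IsVolume [MeasurableSpace S] (μ : Measure (ℝ × S)) : Prop :=
  ∀ (p : ℝ × S) (A : Set (ℝ × S)), MeasurableSet A → A ⊆ (extChartAt (stModel n) p).source →
    μ A = ∫⁻ z in (extChartAt (stModel n) p) '' A, ENNReal.ofReal (g.density p z)

/-- The d'Alembertian `□ f = |det g|^{-1/2} ∂_i (|det g|^{1/2} g^{ij} ∂_j f)`, computed at `p` in
the chart at `p`. -/
def box (f : ℝ × S → ℂ) (p : ℝ × S) : ℂ :=
  ((g.density p (extChartAt (stModel n) p p))⁻¹ : ℝ) •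
    ∑ i, ∑ j, fderiv ℝ
      (fun z => (g.density p z * (g.gram p z)⁻¹ i j) •
        fderiv ℝ (f ∘ (extChartAt (stModel n) p).symm) z (stdBasis n j))
      (extChartAt (stModel n) p p) (stdBasis n i)

/-- The Klein-Gordon operator `□ + m²`. -/
def kleinGordon (m : ℝ) (f : ℝ × S → ℂ) (p : ℝ × S) : ℂ := g.box f p + (m : ℂ) ^ 2 * f p

/-- The differential of the time coordinate. -/
def dt (p : ℝ × S) (v : TangentSpace (stModel n) p) : ℝ :=
  mfderiv (stModel n) 𝓘(ℝ, ℝ) (Prod.fst : ℝ × S → ℝ) p v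

/-- `q` lies in the causal future of `p`: it is `p` or it is reached from `p` along a smooth
causal curve on which the time coordinate increases. -/
def CausalLE (p q : ℝ × S) : Prop :=
  p = q ∨ ∃ c : ℝ → ℝ × S, ContMDiff 𝓘(ℝ, ℝ) (stModel n) ∞ c ∧ c 0 = p ∧ c 1 = q ∧
    ∀ s ∈ Icc (0 : ℝ) 1,
      0 ≤ g.val (c s) (mfderiv 𝓘(ℝ, ℝ) (stModel n) c s (1 : ℝ))
        (mfderiv 𝓘(ℝ, ℝ) (stModel n) c s (1 : ℝ)) ∧
      0 < dt (c s) (mfderiv 𝓘(ℝ, ℝ) (stModel n) c s (1 : ℝ))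

/-- The causal future `J⁺(K)`. -/
def future (K : Set (ℝ × S)) : Set (ℝ × S) := {q | ∃ p ∈ K, g.CausalLE p q}

/-- The causal past `J⁻(K)`. -/
def past (K : Set (ℝ × S)) : Set (ℝ × S) := {q | ∃ p ∈ K, g.CausalLE q p}

/-- Global hyperbolicity of `ℝ × S` with time direction given by the coordinate `t ∈ ℝ`:
`t` is a time function (`dt` does not vanish on nonzero causal vectors, so that `ℝ × S` is causal)
and the causal diamonds spanned by compact sets are compact. -/
structure GloballyHyperbolic : Prop where
  temporal : ∀ (p : ℝ × S) (v : TangentSpace (stModel n) p), v ≠ 0 → 0 ≤ g.val p v v → dt p v ≠ 0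
  compact_diamonds : ∀ K L : Set (ℝ × S), IsCompact K → IsCompact L →
    IsCompact (g.future K ∩ g.past L)

/-- The metric does not depend on `t`, i.e. the time translations are isometries. -/
def Stationary : Prop :=
  ∀ (s : ℝ) (p : ℝ × S) (v w : TangentSpace (stModel n) p),
    g.val (shift s p) (mfderiv (stModel n) (stModel n) (shift s) p v)
      (mfderiv (stModel n) (stModel n) (shift s) p w) = g.val p v w

/-- `G` is the Green operator (fundamental solution) of `□ + m²`, written as
`f ↦ G(f, ·)`, with `supp G(f, ·) ⊆ J(supp f)`. For `J = J⁻` this is the retarded and for `J = J⁺`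
the advanced fundamental solution. -/
structure IsGreen (m : ℝ) (J : Set (ℝ × S) → Set (ℝ × S))
    (G : Test n S →ₗ[ℂ] (ℝ × S → ℂ)) : Prop where
  smooth : ∀ f, ContMDiff (stModel n) 𝓘(ℝ, ℂ) ∞ (G f)
  kleinGordon_apply : ∀ f p, g.kleinGordon m (G f) p = f.1 p
  apply_kleinGordon : ∀ f f' : Test n S, (∀ p, f'.1 p = g.kleinGordon m f.1 p) → G f' = f.1
  support : ∀ f, tsupport (G f) ⊆ J (tsupport f.1)
  real : ∀ f p, G (Test.conj f) p = conj (G f p)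

end LorentzMetric

end Geometry

/-! ### The model -/

/-- The data from which the model is built. -/
structure FieldData (n : ℕ) (S : Type*) [TopologicalSpace S]
    [ChartedSpace (EuclideanSpace ℝ (Fin n)) S] [IsManifold 𝓘(ℝ, EuclideanSpace ℝ (Fin n)) ∞ S]
    [MeasurableSpace S] where
  /-- the metric -/
  g : LorentzMetric n S
  /-- the canonical volume measure -/
  vol : Measure (ℝ × S)
  /-- the mass -/
  m : ℝ
  /-- the strength of the two-point function -/
  b : ℝ
  /-- the coupling constants `b_N`, `N ≥ 3` -/
  coupling : ℕ → ℝ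
  /-- the retarded fundamental solution `f ↦ G_r(f, ·)` -/
  Gr : Test n S →ₗ[ℂ] (ℝ × S → ℂ)
  /-- the advanced fundamental solution `f ↦ G_a(f, ·)` -/
  Ga : Test n S →ₗ[ℂ] (ℝ × S → ℂ)
  /-- the bidistribution `D⁺(f, h)` -/
  Dplus : Test n S →ₗ[ℂ] Test n S →ₗ[ℂ] ℂ
  /-- the function `y ↦ D⁺(f, y)` representing `h ↦ D⁺(f, h)` -/
  dplus : Test n S → ℝ × S → ℂ

/-- The three kinds of fields. -/
inductive Label
  | inn
  | loc
  | out
  deriving DecidableEq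

namespace FieldData

variable {n : ℕ} {S : Type*} [TopologicalSpace S] [ChartedSpace (EuclideanSpace ℝ (Fin n)) S]
  [IsManifold 𝓘(ℝ, EuclideanSpace ℝ (Fin n)) ∞ S] [MeasurableSpace S] (A : FieldData n S)

/-- The function `y ↦ D⁻(f, y)`, where `D⁻(f, h) = D⁺(h, f)` is the complex conjugate of
`D⁺(f̄, h̄)`. -/
def dminus (f : Test n S) (y : ℝ × S) : ℂ := conj (A.dplus (Test.conj f) y)

/-- The function `y ↦ D(f, y) = G_r(f, y) - G_a(f, y)`. -/
def commutator (f : Test n S) (y : ℝ × S) : ℂ := A.Gr f y - A.Ga f y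

/-- The commutator function `D(f, h) = G_r(f, h) - G_a(f, h)`. -/
def D (f h : Test n S) : ℂ := ∫ y, A.commutator f y * h.1 y ∂A.vol

/-- The requirements on the geometry and on the fundamental functions. -/
structure Admissible : Prop where
  globallyHyperbolic : A.g.GloballyHyperbolic
  isVolume : A.g.IsVolume A.vol
  mass_pos : 0 < A.m
  b_pos : 0 < A.b
  retarded : A.g.IsGreen A.m A.g.past A.Gr
  advanced : A.g.IsGreen A.m A.g.future A.Ga
  /-- `D⁺` is a distribution. -/
  distribution : ∀ f h : ℕ → Test n S, TendsToZero f → TendsToZero h →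
    Tendsto (fun j => A.Dplus (f j) (h j)) atTop (𝓝 0)
  measurable : ∀ f, Measurable (A.dplus f)
  locallyIntegrable : ∀ f, LocallyIntegrable (A.dplus f) A.vol
  represents : ∀ f h, A.Dplus f h = ∫ y, A.dplus f y * h.1 y ∂A.vol
  kleinGordon_left : ∀ f f' h : Test n S, (∀ p, f'.1 p = A.g.kleinGordon A.m f.1 p) →
    A.Dplus f' h = 0
  kleinGordon_right : ∀ f f' h : Test n S, (∀ p, f'.1 p = A.g.kleinGordon A.m f.1 p) →
    A.Dplus h f' = 0
  /-- `D⁻(f, h) = D⁺(h, f)` is the conjugate of `D⁺(f̄, h̄)`. -/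
  hermitian : ∀ f h, A.Dplus h f = conj (A.Dplus (Test.conj f) (Test.conj h))
  /-- `Im D⁺ = D`, where `Im T = (T - T̄) / 2i` for a distribution `T`. -/
  im_eq : ∀ f h, A.Dplus f h - conj (A.Dplus (Test.conj f) (Test.conj h)) =
    2 * Complex.I * A.D f h
  /-- `D⁺(f̄, f) ≥ 0` (it is real because `D⁺` is hermitian). -/
  positive : ∀ f, 0 ≤ (A.Dplus (Test.conj f) f).re

/-- `D⁺` is invariant under time translations. -/
def TimeInvariant : Prop :=
  ∀ (s : ℝ) (f h : Test n S),
    A.Dplus (Test.translate s f) (Test.translate s h) = A.Dplus f h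

/-- The dispersion condition: `∫ |D⁺(f, x)|^N dx < ∞` for all `N ≥ 3` with `b_N ≠ 0`. -/
def Dispersion : Prop :=
  ∀ N : ℕ, 3 ≤ N → A.coupling N ≠ 0 → ∀ f, Integrable (fun y => ‖A.dplus f y‖ ^ N) A.vol

/-- The function that the entry of the current contributes to a truncated vacuum
expectation value: nothing for "in", `G_r` for "loc", and `D` for "out". -/
def current : Label → Test n S → ℝ × S → ℂ
  | .inn, _, _ => 0
  | .loc, f, y => A.Gr f y
  | .out, f, y => A.commutator f y

/-- The truncated vacuum expectation values `⟨Ψ₀, φ^{a 0}(f 0) ⋯ φ^{a (N-1)}(f (N-1)) Ψ₀⟩ᵀ`. -/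
def truncated : (N : ℕ) → (Fin N → Label) → (Fin N → Test n S) → ℂ
  | 0, _, _ => 0
  | 1, _, _ => 0
  | 2, _, f => ((A.b ^ 2 / A.m ^ 2 : ℝ) : ℂ) * A.Dplus (f 0) (f 1)
  | N + 3, a, f => (A.coupling (N + 3) : ℂ) * ∑ k : Fin (N + 3), ∫ y, ∏ l : Fin (N + 3),
      (if l < k then A.dplus (f l) y
        else if l = k then A.current (a l) (f l) y
        else A.dminus (f l) y) ∂A.vol

/-- The vacuum expectation values, as sums over all partitions of products of truncated ones;
in each block the order of the fields is kept. -/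
def vev {N : ℕ} (a : Fin N → Label) (f : Fin N → Test n S) : ℂ :=
  ∑ P : Finpartition (Finset.univ : Finset (Fin N)), ∏ B ∈ P.parts,
    A.truncated B.card (a ∘ B.orderEmbOfFin rfl) (f ∘ B.orderEmbOfFin rfl)

end FieldData

/-! ### Fourier transform and the one-particle spectral condition -/

/-- `f̂(E) = (2π)^{-1/2} ∫ e^{-itE} f(t) dt`. -/
def fourier (f : ℝ → ℂ) (E : ℝ) : ℂ :=
  ((Real.sqrt (2 * Real.pi))⁻¹ : ℝ) * ∫ t : ℝ, Complex.exp (-(Complex.I * t * E)) * f t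

/-- The spectral condition with gap `ε` for `D⁺`: for all `h₁, h₂ ∈ 𝓓(S, ℂ)` the distribution
`D⁺(t - t', h₁, h₂)` in the time variables is given by a tempered distribution `T` in the
difference variable, and the Fourier transform `T̂(f) = T(f̂)` vanishes on `(-∞, ε)`. -/
def FieldData.SpectralGap {n : ℕ} {S : Type*} [TopologicalSpace S]
    [ChartedSpace (EuclideanSpace ℝ (Fin n)) S] [IsManifold 𝓘(ℝ, EuclideanSpace ℝ (Fin n)) ∞ S]
    [MeasurableSpace S] [T2Space S] (A : FieldData n S) (ε : ℝ) : Prop :=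
  ∀ h₁ h₂ : SpaceTest n S, ∃ T : 𝓢(ℝ, ℂ) →L[ℂ] ℂ,
    (∀ (a b : TimeTest) (u : 𝓢(ℝ, ℂ)), (∀ r, u r = ∫ t : ℝ, a.1 (r + t) * b.1 t) →
      A.Dplus (tensor a h₁) (tensor b h₂) = T u) ∧
    (∀ f u : 𝓢(ℝ, ℂ), (∀ E, u E = fourier f E) → tsupport f ⊆ Iio ε → T u = 0)

/-! ### The extended Borchers algebra and the GNS construction -/

section GNS

variable (n : ℕ) (S : Type*) [TopologicalSpace S] [ChartedSpace (EuclideanSpace ℝ (Fin n)) S]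

/-- The test function space `𝓓(ℝ × S, ℂ³)` with components labelled "in", "loc", "out". -/
abbrev ExtTest : Type _ := Label → Test n S

/-- The extended Borchers algebra, i.e. the free tensor algebra over `ExtTest`. -/
abbrev Borchers : Type _ := TensorAlgebra ℂ (ExtTest n S)

/-- The opposite algebra with complex conjugate scalar multiplication (auxiliary). -/
def ConjOp : Type _ := (Borchers n S)ᵐᵒᵖ

instance : Ring (ConjOp n S) := inferInstanceAs (Ring (Borchers n S)ᵐᵒᵖ)

instance : Algebra ℂ (ConjOp n S) :=
  RingHom.toAlgebra' (S := ConjOp n S)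
    ((algebraMap ℂ (Borchers n S)ᵐᵒᵖ).comp (starRingEnd ℂ))
    (fun c x => Algebra.commutes (A := (Borchers n S)ᵐᵒᵖ) (starRingEnd ℂ c) x)

variable {n S}

theorem ConjOp.smul_def (c : ℂ) (x : (Borchers n S)ᵐᵒᵖ) :
    (c • (show ConjOp n S from x) : ConjOp n S) =
      (show ConjOp n S from (starRingEnd ℂ c • x : (Borchers n S)ᵐᵒᵖ)) := by
  rw [Algebra.smul_def, Algebra.smul_def]
  rfl

/-- Componentwise complex conjugation. -/
def ExtTest.conj (f : ExtTest n S) : ExtTest n S := fun a => Test.conj (f a)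

/-- `f ↦ ι f̄` as a linear map into the conjugate opposite algebra. -/
def conjGen : ExtTest n S →ₗ[ℂ] ConjOp n S where
  toFun f := MulOpposite.op (TensorAlgebra.ι ℂ (ExtTest.conj f))
  map_add' f h := by
    have : ExtTest.conj (f + h) = ExtTest.conj f + ExtTest.conj h := by
      funext a; apply Subtype.ext; funext p; simp [ExtTest.conj, Test.conj]
    rw [this, map_add]; rfl
  map_smul' c f := by
    have : ExtTest.conj (c • f) = (starRingEnd ℂ c) • ExtTest.conj f := by
      funext a; apply Subtype.ext; funext p; simp [ExtTest.conj, Test.conj]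
    rw [this, map_smul]
    exact (ConjOp.smul_def c (MulOpposite.op (TensorAlgebra.ι ℂ (ExtTest.conj f)))).symm

/-- The involution `(f₁ ⊗ ⋯ ⊗ f_N)* = f̄_N ⊗ ⋯ ⊗ f̄₁`, extended antilinearly. -/
def involution : Borchers n S →ₛₗ[starRingEnd ℂ] Borchers n S where
  toFun x := MulOpposite.unop (show (Borchers n S)ᵐᵒᵖ from TensorAlgebra.lift ℂ conjGen x)
  map_add' x y := by rw [map_add]; rfl
  map_smul' c x := by
    rw [map_smul]
    exact congrArg MulOpposite.unop (ConjOp.smul_def c (TensorAlgebra.lift ℂ conjGen x))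

theorem involution_one : involution (1 : Borchers n S) = 1 := by
  change MulOpposite.unop (show (Borchers n S)ᵐᵒᵖ from TensorAlgebra.lift ℂ conjGen 1) = 1
  rw [map_one]; rfl

theorem involution_ι (f : ExtTest n S) :
    involution (TensorAlgebra.ι ℂ f) = TensorAlgebra.ι ℂ (ExtTest.conj f) := by
  change MulOpposite.unop (show (Borchers n S)ᵐᵒᵖ from TensorAlgebra.lift ℂ conjGen _) = _
  rw [TensorAlgebra.lift_ι_apply]; rfl

theorem involution_mul (x y : Borchers n S) :
    involution (x * y) = involution y * involution x := by
  change MulOpposite.unop (show (Borchers n S)ᵐᵒᵖ from TensorAlgebra.lift ℂ conjGen _) = _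
  rw [map_mul]; rfl

/-- Time translation as an automorphism of the Borchers algebra. -/
def translation (s : ℝ) : Borchers n S →ₐ[ℂ] Borchers n S :=
  TensorAlgebra.lift ℂ
    ((TensorAlgebra.ι ℂ).comp ((Test.translate (n := n) (S := S) s).compLeft Label))

/-- The algebra element representing the field `φ^a(f)`. -/
def gen (a : Label) (f : Test n S) : Borchers n S := TensorAlgebra.ι ℂ (Pi.single a f)

/-- `F` is Hermitean. -/
def Hermitean (F : Borchers n S →ₗ[ℂ] ℂ) : Prop := ∀ x, F (involution x) = conj (F x)

/-- `F` is invariant under time translations. -/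
def Invariant (F : Borchers n S →ₗ[ℂ] ℂ) : Prop := ∀ s x, F (translation s x) = F x

/-- The left ideal `𝓛 = {x | ∀ y, F(y ⊗ x) = 0}`. -/
def kernelIdeal (F : Borchers n S →ₗ[ℂ] ℂ) : Submodule ℂ (Borchers n S) where
  carrier := {x | ∀ y, F (y * x) = 0}
  zero_mem' := fun y => by simp
  add_mem' := fun hx hx' y => by rw [mul_add, map_add, hx y, hx' y, add_zero]
  smul_mem' := fun c x hx y => by rw [mul_smul_comm, map_smul, hx y, smul_zero]

/-- The state space `𝓥`. -/
abbrev StateSpace (F : Borchers n S →ₗ[ℂ] ℂ) : Type _ := Borchers n S ⧸ kernelIdeal F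

/-- The GNS vacuum `Ψ₀`. -/
def vacuum (F : Borchers n S →ₗ[ℂ] ℂ) : StateSpace F := (kernelIdeal F).mkQ 1

/-- The left action of the Borchers algebra on `𝓥`. -/
def leftAction (F : Borchers n S →ₗ[ℂ] ℂ) (x : Borchers n S) : StateSpace F →ₗ[ℂ] StateSpace F :=
  (kernelIdeal F).mapQ (kernelIdeal F) (LinearMap.mulLeft ℂ x) (by
    intro z hz y
    have h := hz (y * x)
    rwa [mul_assoc] at h)

/-- The field operators `φ^a(f)` on `𝓥`. -/
def field (F : Borchers n S →ₗ[ℂ] ℂ) (a : Label) (f : Test n S) :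
    StateSpace F →ₗ[ℂ] StateSpace F := leftAction F (gen a f)

/-- The form `(x, y) ↦ F(x* ⊗ y)` on the Borchers algebra. -/
def preForm (F : Borchers n S →ₗ[ℂ] ℂ) :
    Borchers n S →ₛₗ[starRingEnd ℂ] Borchers n S →ₗ[ℂ] ℂ where
  toFun x := F ∘ₗ LinearMap.mulLeft ℂ (involution x)
  map_add' x y := by ext z; simp [add_mul]
  map_smul' c x := by ext z; simp

theorem involution_involution (x : Borchers n S) : involution (involution x) = x := by
  induction x using TensorAlgebra.induction with
  | algebraMap r =>
    rw [Algebra.algebraMap_eq_smul_one, LinearMap.map_smulₛₗ, LinearMap.map_smulₛₗ,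
      involution_one, involution_one]
    simp
  | ι f =>
    rw [involution_ι, involution_ι]
    congr 1
    funext a; apply Subtype.ext; funext p; simp [ExtTest.conj, Test.conj]
  | mul x y hx hy => rw [involution_mul, involution_mul, hx, hy]
  | add x y hx hy => rw [map_add, map_add, hx, hy]

/-- The (indefinite) inner product `⟨[x], [y]⟩ = F(x* ⊗ y)` on `𝓥`. -/
def form (F : Borchers n S →ₗ[ℂ] ℂ) (hF : Hermitean F) :
    StateSpace F →ₛₗ[starRingEnd ℂ] StateSpace F →ₗ[ℂ] ℂ :=
  LinearMap.liftQ₂ (kernelIdeal F) (kernelIdeal F) (preForm F)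
    (by
      intro x hx
      rw [LinearMap.mem_ker]
      ext y
      change F (involution x * y) = 0
      have h := hF (involution y * x)
      rw [involution_mul, involution_involution, hx (involution y), map_zero] at h
      exact h)
    (by
      intro y hy
      rw [LinearMap.mem_ker]
      ext x
      exact hy (involution x))

theorem form_mk (F : Borchers n S →ₗ[ℂ] ℂ) (hF : Hermitean F) (x y : Borchers n S) :
    form F hF ((kernelIdeal F).mkQ x) ((kernelIdeal F).mkQ y) = F (involution x * y) := rfl

theorem translation_translation_neg (s : ℝ) (x : Borchers n S) :
    translation s (translation (-s) x) = x := by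
  have h : (translation s).comp (translation (-s)) = AlgHom.id ℂ (Borchers n S) := by
    apply TensorAlgebra.hom_ext
    ext f
    simp only [LinearMap.comp_apply, AlgHom.toLinearMap_apply, AlgHom.comp_apply, translation,
      TensorAlgebra.lift_ι_apply, AlgHom.id_apply]
    congr 1
    funext a; apply Subtype.ext; funext p
    simp [Test.translate, shift]
  exact DFunLike.congr_fun h x

/-- The representation `𝖴(s)` of the time translations on `𝓥`, `𝖴(s)[x] = [x_s]`. -/
def timeEvolution (F : Borchers n S →ₗ[ℂ] ℂ) (hF : Invariant F) (s : ℝ) :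
    StateSpace F →ₗ[ℂ] StateSpace F :=
  (kernelIdeal F).mapQ (kernelIdeal F) (translation s).toLinearMap (by
    intro x hx y
    have h : y * translation s x = translation s (translation (-s) y * x) := by
      rw [map_mul, translation_translation_neg]
    change F (y * translation s x) = 0
    rw [h, hF, hx])

/-- The spectral condition for the whole theory. -/
def SpectralCondition (F : Borchers n S →ₗ[ℂ] ℂ) (hH : Hermitean F) (hI : Invariant F) : Prop :=
  ∀ (Ψ Φ : StateSpace F) (f : 𝓢(ℝ, ℂ)), (∀ E < 0, fourier f E = 0) →
    Integrable (fun t : ℝ => form F hH Ψ (timeEvolution F hI t Φ) * f (-t)) ∧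
    ∫ t : ℝ, form F hH Ψ (timeEvolution F hI t Φ) * f (-t) = 0

/-- The subspace `𝓥^a ⊆ 𝓥` generated by repeated application of the fields `φ^a` to `Ψ₀`. -/
def fieldSpace (F : Borchers n S →ₗ[ℂ] ℂ) (a : Label) : Submodule ℂ (StateSpace F) :=
  Submodule.span ℂ (Set.range fun l : List (Test n S) =>
    l.foldr (fun f Ψ => field F a f Ψ) (vacuum F))

theorem vacuum_mem (F : Borchers n S →ₗ[ℂ] ℂ) (a : Label) : vacuum F ∈ fieldSpace F a :=
  Submodule.subset_span ⟨[], rfl⟩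

theorem field_mem (F : Borchers n S →ₗ[ℂ] ℂ) (a : Label) (f : Test n S) :
    ∀ Ψ ∈ fieldSpace F a, field F a f Ψ ∈ fieldSpace F a := by
  intro Ψ hΨ
  refine Submodule.span_induction ?_ ?_ ?_ ?_ hΨ
  · rintro _ ⟨l, rfl⟩
    exact Submodule.subset_span ⟨f :: l, rfl⟩
  · simp
  · intro x y _ _ hx hy
    rw [map_add]; exact add_mem hx hy
  · intro c x _ hx
    rw [map_smul]; exact Submodule.smul_mem _ c hx

/-- The representations generated from `Ψ₀` by the fields `φ^a` and `φ^{a'}` are unitarily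
equivalent: there is a linear isometry `W` from `𝓥^a` onto `𝓥^{a'}` with `W Ψ₀ = Ψ₀` and
`W φ^a W⁻¹ = φ^{a'}`. -/
def UnitarilyEquivalent (F : Borchers n S →ₗ[ℂ] ℂ) (hH : Hermitean F) (a a' : Label) : Prop :=
  ∃ W : fieldSpace F a ≃ₗ[ℂ] fieldSpace F a',
    (∀ Ψ Φ : fieldSpace F a, form F hH (W Ψ) (W Φ) = form F hH Ψ Φ) ∧
    W ⟨vacuum F, vacuum_mem F a⟩ = ⟨vacuum F, vacuum_mem F a'⟩ ∧
    ∀ (f : Test n S) (Ψ : fieldSpace F a'),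
      W ⟨field F a f (W.symm Ψ), field_mem F a f _ (W.symm Ψ).2⟩ =
        ⟨field F a' f Ψ, field_mem F a' f _ Ψ.2⟩

end GNS

namespace FieldData

variable {n : ℕ} {S : Type*} [TopologicalSpace S] [ChartedSpace (EuclideanSpace ℝ (Fin n)) S]
  [IsManifold 𝓘(ℝ, EuclideanSpace ℝ (Fin n)) ∞ S] [MeasurableSpace S] (A : FieldData n S)

/-- `F` is the form factor functional of the model, i.e. the linear functional on the extended
Borchers algebra given by the mixed vacuum expectation values (which determine it, since the
products of generators span the algebra; the empty product has the value
`⟨Ψ₀, Ψ₀⟩ = 1`). -/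
def IsFormFactor (F : Borchers n S →ₗ[ℂ] ℂ) : Prop :=
  ∀ (N : ℕ) (a : Fin N → Label) (f : Fin N → Test n S),
    F (List.ofFn fun i => gen (a i) (f i)).prod = A.vev a f

/-- The field `φ^a` satisfies the Klein-Gordon equation and the canonical commutation relations
on `𝓥`. (The commutator of fields with two-point function `(b²/m²) D⁺` is
`(b²/m²) (D⁺ - D⁻) = 2i (b²/m²) D`.) -/
def IsCCRField (F : Borchers n S →ₗ[ℂ] ℂ) (a : Label) : Prop :=
  (∀ f f' : Test n S, (∀ p, f'.1 p = A.g.kleinGordon A.m f.1 p) → field F a f' = 0) ∧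
  ∀ (f h : Test n S),
    field F a f ∘ₗ field F a h - field F a h ∘ₗ field F a f =
      (2 * Complex.I * ((A.b ^ 2 / A.m ^ 2 : ℝ) : ℂ) * A.D f h) • LinearMap.id

end FieldData

end QFT

end

/-! Everything is read off from the vertex integrals `∫ ∏ D⁺ · C · ∏ D⁻`. Each of the `N` factors
lies in `L^N`: this is the dispersion condition for `D⁺`, `D⁻` and hence for `D`. It holds for `G_r`
because outside the compact set `J⁺ ∩ J⁻` of the support of `f` either `G_r` or `G_a` vanishes, so
that `|G_r| ≤ |D|` there. Hölder's inequality gives convergence, and translation invariance of `G_r`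
follows from uniqueness of compactly supported solutions of the Klein-Gordon equation.

Spectral condition. Translate a right end segment of the fields by `t`. If the current belongs to
the segment, moving the integration point along leaves only some factors `D⁺` to the left of the
current depending on `t`; otherwise only some factors `D⁻` to its right do. These translates have
non-negative spectrum as curves in `L^N` (`nonnegSpectrum_twist_Dplus`), and spectra add in
multilinear expressions (`nonnegSpectrum_diag`, `nonnegSpectrum_multilinear`). Hence truncated
functions, and with them sums of products of truncated functions, have non-negative spectrum
(`tame_truncated`).

Asymptotic fields. Since `2iD = D⁺ - D⁻`, the sum over the position of the current in a word of
out-fields telescopes to `(∏ D⁺ - ∏ D⁻) / 2i`. The integral of `∏ D⁺` is invariant under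
translations, but the gap forces its spectrum to be strictly positive; therefore it is zero
(`integral_prod_dplus`), and so is that of `∏ D⁻`. Thus the truncated functions of the out-field
with at least three arguments vanish. The telescoped form also shows that a vertex is symmetric in
two neighbouring fields of the same asymptotic kind, so exchanging them changes only the two-point
truncated function, which gives the CCR (`clustered_swap`).

Unitary equivalence. The vacuum expectation values of in- and out-fields alone agree, but the inner
product of `𝓥` is indefinite, so a combination of words that is null for the free theory might still
be a nonzero vector of `𝓥`, as mixed words could detect it. It has to be shown that they do not
(`annihilates_clustered`). In a truncated function with other fields on the left, asymptotic fields
`h` on the right enter only through `∏ D⁻(h, y)`, because the remaining term is an integral of `∏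
D⁺`. For finitely many `h` and almost every `y` the values `D⁻(h, y)` coincide with `D⁺(g, h)` for
one test function `g` (`exists_Dplus_eq_dminus`), and contraction with `D⁺(g, ·)` preserves the
functionals that annihilate the free null vectors, since in the free theory it is a multiple of
multiplication by `g` from the left (`Annihilates.conv_letterWeight`). So both `𝓥^in` and `𝓥^out`
are the quotient of the space of words by the same null space (`ker_wordVector`). -/

noncomputable section

namespace QFT

/-! ### Sums over partitions -/

section Partitions

variable {ι : Type*} [DecidableEq ι]

/-- The sum over all partitions of `s` of the products of the weights of the blocks. -/
def partitionSum (τ : Finset ι → ℂ) (s : Finset ι) : ℂ :=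
  ∑ P : Finpartition s, ∏ B ∈ P.parts, τ B

theorem partitionSum_congr {τ τ' : Finset ι → ℂ} {s : Finset ι} (h : ∀ B ⊆ s, τ B = τ' B) :
    partitionSum τ s = partitionSum τ' s :=
  Finset.sum_congr rfl fun P _ => Finset.prod_congr rfl fun B hB => h B (P.le hB)

theorem partitionSum_empty (τ : Finset ι → ℂ) : partitionSum τ ∅ = 1 := by
  have : ∀ P : Finpartition (∅ : Finset ι), P.parts = ∅ := fun P =>
    Finpartition.parts_eq_empty_iff.2 rfl
  have h1 : (Finset.univ : Finset (Finpartition (∅ : Finset ι))) = {Finpartition.empty _} :=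
    Finset.eq_singleton_iff_unique_mem.2 ⟨Finset.mem_univ _, fun P _ => Finpartition.ext
      ((this P).trans (this _).symm)⟩
  rw [partitionSum, h1, Finset.sum_singleton, this, Finset.prod_empty]

/-- Summation over the block that contains a given element. -/
theorem partitionSum_eq_sum_block (τ : Finset ι → ℂ) {s : Finset ι} {i : ι} (hi : i ∈ s) :
    partitionSum τ s = ∑ B ∈ s.powerset with i ∈ B, τ B * partitionSum τ (s \ B) := by
  simp only [partitionSum, Finset.mul_sum]
  rw [Finset.sum_sigma']
  symm
  have key : ∀ x : (B : Finset ι) × Finpartition (s \ B), i ∈ x.1 → x.1 ∉ x.2.parts := by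
    intro x hx hx'
    have := x.2.le hx' hx
    simp [hx] at this
  refine Finset.sum_bij (fun x hx => x.2.extend (b := x.1) (c := s) ?_ Finset.sdiff_disjoint ?_)
    ?_ ?_ ?_ ?_
  · simp only [Finset.mem_sigma, Finset.mem_filter] at hx
    exact Finset.ne_empty_of_mem hx.1.2
  · simp only [Finset.mem_sigma, Finset.mem_filter, Finset.mem_powerset] at hx
    exact Finset.sdiff_union_of_subset hx.1.1
  · simp
  · rintro ⟨B, Q⟩ hx ⟨B', Q'⟩ hx' h
    simp only [Finset.mem_sigma, Finset.mem_filter, Finset.mem_powerset] at hx hx'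
    have hp : insert B Q.parts = insert B' Q'.parts := congrArg Finpartition.parts h
    have hB : B = B' := by
      rcases Finset.mem_insert.1 (hp ▸ Finset.mem_insert_self B Q.parts) with h1 | h1
      · exact h1
      · have := Q'.le h1 hx.1.2
        simp [hx'.1.2] at this
    subst hB
    congr 1
    apply Finpartition.ext
    rw [← Finset.erase_insert (key ⟨B, Q⟩ hx.1.2), hp, Finset.erase_insert (key ⟨B, Q'⟩ hx.1.2)]
  · intro P _
    have hP : P.part i ∈ P.parts := P.part_mem.2 hi
    -- The preimage of `P` is the block of `i` together with the other blocks, which `avoid` leaves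
    -- unchanged because they are disjoint from it.
    refine ⟨⟨P.part i, P.avoid (P.part i)⟩, ?_, ?_⟩
    · simp [P.part_subset i, P.mem_part_self, hi]
    · apply Finpartition.ext
      ext C
      simp only [Finpartition.extend_parts, Finset.mem_insert, Finpartition.mem_avoid]
      constructor
      · rintro (rfl | ⟨d, hd, hd', rfl⟩)
        · exact hP
        · have : Disjoint d (P.part i) := P.disjoint hd hP (by rintro rfl; exact hd' le_rfl)
          rwa [Finset.sdiff_eq_self_iff_disjoint.2 this]
      · intro hC
        by_cases h : C = P.part i
        · exact Or.inl h
        · have hd : Disjoint C (P.part i) := P.disjoint hC hP h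
          exact Or.inr ⟨C, hC, fun hle => P.ne_bot hC (disjoint_self.1 (hd.mono_right hle)),
            Finset.sdiff_eq_self_iff_disjoint.2 hd⟩
  · rintro ⟨B, Q⟩ hx
    simp only [Finset.mem_sigma, Finset.mem_filter, Finset.mem_powerset] at hx
    simp only [Finpartition.extend_parts]
    rw [Finset.prod_insert (key ⟨B, Q⟩ hx.1.2)]

/-- Induction along the block recursion avoids transporting `Finpartition`s through `e`. -/
theorem partitionSum_map {κ : Type*} [DecidableEq κ] (e : ι ↪ κ) (τ : Finset κ → ℂ)
    (s : Finset ι) :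
    partitionSum τ (s.map e) = partitionSum (fun B => τ (B.map e)) s := by
  induction s using Finset.strongInduction with
  | H s ih =>
    rcases s.eq_empty_or_nonempty with rfl | ⟨i, hi⟩
    · simp [partitionSum_empty]
    · rw [partitionSum_eq_sum_block τ (Finset.mem_map_of_mem e hi),
        partitionSum_eq_sum_block _ hi]
      symm
      refine Finset.sum_bij (fun B _ => B.map e) ?_ ?_ ?_ ?_
      · intro B hB
        simp only [Finset.mem_filter, Finset.mem_powerset] at hB ⊢
        exact ⟨Finset.map_subset_map.2 hB.1, Finset.mem_map_of_mem e hB.2⟩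
      · intro B _ B' _ h
        exact Finset.map_injective e h
      · intro C hC
        simp only [Finset.mem_filter, Finset.mem_powerset] at hC
        obtain ⟨B, hB, rfl⟩ := Finset.subset_map_iff.1 hC.1
        exact ⟨B, by simpa [hB] using hC.2, rfl⟩
      · intro B hB
        simp only [Finset.mem_filter, Finset.mem_powerset] at hB
        rw [← Finset.map_sdiff, ih]
        exact Finset.sdiff_ssubset hB.1 ⟨i, hB.2⟩

end Partitions

/-! ### Convolution of functions on words -/

section Words

variable {α : Type*}

/-- The convolution product of functions on words, `∑ φ(u) ψ(v)` over all ways to split a word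
into two complementary subwords `u` and `v`. -/
def conv : (List α → ℂ) → (List α → ℂ) → List α → ℂ
  | φ, ψ, [] => φ [] * ψ []
  | φ, ψ, h :: w => conv (fun u => φ (h :: u)) ψ w + conv φ (fun u => ψ (h :: u)) w

/-- Prefixing a letter acts as a derivation for `conv`. Hence the identities of this commutative and
associative product are proved by induction on the word, with the functions generalized. -/
theorem conv_comm (φ ψ : List α → ℂ) (w : List α) : conv φ ψ w = conv ψ φ w := by
  induction w generalizing φ ψ with
  | nil => simp [conv, mul_comm]
  | cons h w ih => simp only [conv]; rw [ih, ih φ, add_comm]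

theorem conv_add_left (φ φ' ψ : List α → ℂ) (w : List α) :
    conv (fun u => φ u + φ' u) ψ w = conv φ ψ w + conv φ' ψ w := by
  induction w generalizing φ φ' ψ with
  | nil => simp [conv, add_mul]
  | cons h w ih => simp only [conv]; rw [ih, ih]; ring

theorem conv_smul_left (c : ℂ) (φ ψ : List α → ℂ) (w : List α) :
    conv (fun u => c * φ u) ψ w = c * conv φ ψ w := by
  induction w generalizing φ ψ with
  | nil => simp [conv, mul_assoc]
  | cons h w ih => simp only [conv]; rw [ih, ih]; ring

theorem conv_add_right (φ ψ ψ' : List α → ℂ) (w : List α) :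
    conv φ (fun u => ψ u + ψ' u) w = conv φ ψ w + conv φ ψ' w := by
  rw [conv_comm, conv_add_left, conv_comm, conv_comm ψ']

theorem conv_congr {φ φ' ψ ψ' : List α → ℂ} {w : List α}
    (hφ : ∀ u, u.length ≤ w.length → φ u = φ' u) (hψ : ∀ u, u.length ≤ w.length → ψ u = ψ' u) :
    conv φ ψ w = conv φ' ψ' w := by
  induction w generalizing φ φ' ψ ψ' with
  | nil => simp [conv, hφ [] le_rfl, hψ [] le_rfl]
  | cons h w ih =>
    simp only [conv]
    congr 1
    · exact ih (fun u hu => hφ _ (by simpa using hu)) (fun u hu => hψ _ (by simp; omega))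
    · exact ih (fun u hu => hφ _ (by simp; omega)) (fun u hu => hψ _ (by simpa using hu))

theorem conv_assoc (φ ψ χ : List α → ℂ) (w : List α) :
    conv φ (conv ψ χ) w = conv (conv φ ψ) χ w := by
  induction w generalizing φ ψ χ with
  | nil => simp [conv, mul_assoc]
  | cons h w ih =>
    have e : conv φ (conv ψ χ) (h :: w) = conv (fun u => φ (h :: u)) (conv ψ χ) w +
        conv φ (fun u => conv (fun u => ψ (h :: u)) χ u + conv ψ (fun u => χ (h :: u)) u) w := rfl
    have e' : conv (conv φ ψ) χ (h :: w) =
        conv (fun u => conv (fun u => φ (h :: u)) ψ u + conv φ (fun u => ψ (h :: u)) u) χ w +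
        conv (conv φ ψ) (fun u => χ (h :: u)) w := rfl
    rw [e, e', conv_add_right, conv_add_left, ih, ih, ih]
    ring

/-- Convolution with the unit, the indicator function of the empty word, times a constant. -/
theorem conv_unit (c : ℂ) (ψ : List α → ℂ) (w : List α) :
    conv (fun u => if u = [] then c else 0) ψ w = c * ψ w := by
  induction w generalizing c ψ with
  | nil => simp [conv]
  | cons h w ih =>
    have h0 : conv (fun _ => (0 : ℂ)) ψ w = 0 := by
      simpa using conv_smul_left 0 (fun _ => (0 : ℂ)) ψ w
    simp only [conv, ih]
    simp [h0]

theorem conv_map {β : Type*} (g : β → α) (φ ψ : List α → ℂ) (w : List β) :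
    conv φ ψ (w.map g) = conv (fun u => φ (u.map g)) (fun u => ψ (u.map g)) w := by
  induction w generalizing φ ψ with
  | nil => simp [conv]
  | cons h w ih => simp only [List.map_cons, conv]; rw [ih, ih]

variable {ι : Type*} [LinearOrder ι]

/-- The word of the letters `x i`, `i ∈ s`, in increasing order. -/
def wordOf (x : ι → α) (s : Finset ι) : List α := s.sort.map x

theorem wordOf_insert (x : ι → α) {i : ι} {s : Finset ι} (h : ∀ j ∈ s, i < j) :
    wordOf x (insert i s) = x i :: wordOf x s := by
  rw [wordOf, Finset.sort_insert _ (fun j hj => (h j hj).le) (fun hi => lt_irrefl i (h i hi))]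
  rfl

theorem wordOf_map {κ : Type*} [LinearOrder κ] (x : κ → α) (e : ι ↪o κ) (s : Finset ι) :
    wordOf x (s.map e.toEmbedding) = wordOf (x ∘ e) s := by
  have := (e.strictMono.strictMonoOn (s : Set ι)).map_finsetSort (f := e.toEmbedding) (s := s)
  rw [wordOf, wordOf, ← this, List.map_map]
  rfl

/-- Inserting elements from the top down makes each new index the smallest, hence the head of the
word; the subsets then split according to whether they contain it, as in the recursion for `conv`.
-/
theorem sum_powerset_wordOf (x : ι → α) (φ ψ : List α → ℂ) (s : Finset ι) :
    ∑ B ∈ s.powerset, φ (wordOf x B) * ψ (wordOf x (s \ B)) = conv φ ψ (wordOf x s) := by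
  induction s using Finset.induction_on_min generalizing φ ψ with
  | empty => simp [wordOf, conv]
  | insert i s hi ih =>
    have his : i ∉ s := fun h => lt_irrefl i (hi i h)
    rw [Finset.sum_powerset_insert his, wordOf_insert x hi]
    simp only [conv]
    rw [← ih, ← ih, add_comm]
    congr 1
    · refine Finset.sum_congr rfl fun B hB => ?_
      have hB := Finset.mem_powerset.1 hB
      rw [wordOf_insert x fun j hj => hi j (hB hj), Finset.insert_sdiff_insert,
        Finset.sdiff_insert_of_notMem his]
    · refine Finset.sum_congr rfl fun B hB => ?_
      have hB := Finset.mem_powerset.1 hB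
      rw [Finset.insert_sdiff_of_notMem _ fun h => his (hB h),
        wordOf_insert x fun j hj => hi j (Finset.sdiff_subset hj)]

/-- The sum over all partitions of the letters of a word, for a weight function on words. -/
def clustered (T : List α → ℂ) (l : List α) : ℂ :=
  partitionSum (fun B : Finset (Fin l.length) => T (wordOf l.get B)) Finset.univ

/-- Only the word read along `s` matters, since the increasing enumeration of `s` carries partitions
of `Fin s.card` to partitions of `s`. -/
theorem partitionSum_wordOf (T : List α → ℂ) (x : ι → α) (s : Finset ι) :
    partitionSum (fun B => T (wordOf x B)) s = clustered T (wordOf x s) := by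
  have hc : s.card = (wordOf x s).length := by simp [wordOf]
  have hs := s.map_orderEmbOfFin_univ hc
  conv_lhs => rw [← hs]
  rw [partitionSum_map]
  refine partitionSum_congr fun B _ => ?_
  rw [wordOf_map]
  have hx : x ∘ s.orderEmbOfFin hc = (wordOf x s).get := by
    funext i
    rw [Function.comp_apply, Finset.orderEmbOfFin_apply]
    exact (List.getElem_map x).symm
  rw [hx]

theorem wordOf_univ (l : List α) : wordOf l.get Finset.univ = l := by
  rw [wordOf]
  have h := Finset.listMap_orderEmbOfFin_finRange (Finset.univ : Finset (Fin l.length))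
    (Finset.card_fin _)
  have h2 : (Finset.univ : Finset (Fin l.length)).orderEmbOfFin (Finset.card_fin _) =
      RelEmbedding.refl _ := by
    apply DFunLike.coe_injective
    symm
    exact Finset.orderEmbOfFin_unique _ (fun _ => Finset.mem_univ _) strictMono_id
  rw [← h, h2, List.map_map]
  simp

/-- The moment-cumulant recursion: choose the block of the first letter. From here on most of the
combinatorics of vacuum expectation values runs through this identity rather than through
partitions. -/
theorem clustered_cons (T : List α → ℂ) (f : α) (w : List α) :
    clustered T (f :: w) = conv (fun u => T (f :: u)) (clustered T) w := by
  set l := f :: w with hl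
  let z : Fin l.length := ⟨0, by simp [hl]⟩
  have hu : (Finset.univ : Finset (Fin l.length)) = insert z (Finset.univ.erase z) := by
    simp
  have hz : ∀ j ∈ Finset.univ.erase z, z < j := by
    intro j hj
    have hj' : j ≠ z := by simpa using hj
    exact lt_of_le_of_ne (Fin.mk_le_of_le_val (Nat.zero_le _)) hj'.symm
  have hw : wordOf l.get (Finset.univ.erase z) = w := by
    have h1 := wordOf_univ l
    rw [hu, wordOf_insert _ hz] at h1
    exact (List.cons_injective.eq_iff.1 (h1.trans hl))
  rw [clustered, partitionSum_eq_sum_block _ (Finset.mem_univ z)]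
  conv_rhs => rw [← hw]
  rw [← sum_powerset_wordOf]
  symm
  refine Finset.sum_bij (fun B _ => insert z B) ?_ ?_ ?_ ?_
  · intro B _; simp
  · intro B hB B' hB' h
    have n : ∀ C ∈ (Finset.univ.erase z).powerset, z ∉ C := fun C hC hzC => by
      simpa using Finset.mem_powerset.1 hC hzC
    rw [← Finset.erase_insert (n B hB), h, Finset.erase_insert (n B' hB')]
  · intro C hC
    refine ⟨C.erase z, Finset.mem_powerset.2 (Finset.erase_subset_erase z (Finset.subset_univ C)),
      Finset.insert_erase (Finset.mem_filter.1 hC).2⟩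
  · intro B hB
    have hB := Finset.mem_powerset.1 hB
    rw [partitionSum_wordOf, wordOf_insert _ fun j hj => hz j (hB hj)]
    have : (Finset.univ : Finset (Fin l.length)) \ insert z B = Finset.univ.erase z \ B := by
      ext j; simp [not_or, and_comm]
    rw [this]
    rfl

/-- Words that differ by a transposition of two adjacent letters whose transposition changes the
weights only by a constant on the two letter word. -/
theorem clustered_swap (T : List α → ℂ) (f h : α) (c : ℂ)
    (h2 : T [f, h] - T [h, f] = c)
    (h3 : ∀ u v : List α, u ++ v ≠ [] → T (u ++ f :: h :: v) = T (u ++ h :: f :: v))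
    (u v : List α) :
    clustered T (u ++ f :: h :: v) - clustered T (u ++ h :: f :: v) = c * clustered T (u ++ v) := by
  have main : ∀ (n : ℕ) (u v : List α), u.length + v.length = n →
      clustered T (u ++ f :: h :: v) - clustered T (u ++ h :: f :: v) =
        c * clustered T (u ++ v) := by
    intro n
    induction n using Nat.strong_induction_on with
    | _ n ih =>
    intro u v hn
    -- Leibniz rule for the two leading letters. The two terms in which they go to different factors
    -- are exchanged; both letters in `φ` give equal terms, and both in `ψ` give the contribution
    -- `c`.
    have swapped : ∀ (v : List α) (φ ψ : List α → ℂ),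
        (∀ v', v'.length ≤ v.length → φ (f :: h :: v') = φ (h :: f :: v')) →
        (∀ v', v'.length ≤ v.length →
          ψ (f :: h :: v') - ψ (h :: f :: v') = c * ψ v') →
        conv φ ψ (f :: h :: v) - conv φ ψ (h :: f :: v) = c * conv φ ψ v := by
      intro v φ ψ hφ hψ
      simp only [conv]
      have e1 : conv (fun u => φ (f :: h :: u)) ψ v = conv (fun u => φ (h :: f :: u)) ψ v :=
        conv_congr (fun v' hv' => hφ v' hv') fun _ _ => rfl
      have e2 : conv φ (fun u => ψ (f :: h :: u)) v =
          conv φ (fun u => ψ (h :: f :: u)) v + c * conv φ ψ v := by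
        have : c * conv φ ψ v = conv φ (fun u => c * ψ u) v := by
          rw [conv_comm φ, conv_comm φ, conv_smul_left]
        rw [this, ← conv_add_right]
        exact conv_congr (fun _ _ => rfl) fun v' hv' => by rw [← hψ v' hv']; ring
      rw [e1, e2]; ring
    have swapped' : ∀ (u v : List α) (φ ψ : List α → ℂ),
        (∀ u' v', u'.length + v'.length ≤ u.length + v.length →
          φ (u' ++ f :: h :: v') = φ (u' ++ h :: f :: v')) →
        (∀ u' v', u'.length + v'.length ≤ u.length + v.length →
          ψ (u' ++ f :: h :: v') - ψ (u' ++ h :: f :: v') = c * ψ (u' ++ v')) →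
        conv φ ψ (u ++ f :: h :: v) - conv φ ψ (u ++ h :: f :: v) = c * conv φ ψ (u ++ v) := by
      intro u
      induction u with
      | nil =>
        intro v φ ψ hφ hψ
        exact swapped v φ ψ (fun v' hv' => hφ [] v' (by simpa using hv'))
          (fun v' hv' => hψ [] v' (by simpa using hv'))
      | cons k u ihu =>
        intro v φ ψ hφ hψ
        have a1 := ihu v (fun w => φ (k :: w)) ψ
          (fun u' v' hh => hφ (k :: u') v' (by simp; omega))
          (fun u' v' hh => hψ u' v' (by simp; omega))
        have a2 := ihu v φ (fun w => ψ (k :: w))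
          (fun u' v' hh => hφ u' v' (by simp; omega))
          (fun u' v' hh => hψ (k :: u') v' (by simp; omega))
        simp only [List.cons_append, conv]
        linear_combination a1 + a2
    cases u with
    | nil =>
      -- If `f` and `h` lie in different blocks, commutativity of `conv` makes the terms agree. In a
      -- common block the weight changes only on the two-letter word, that is, by `c` times the unit
      -- of `conv`.
      simp only [List.nil_append, clustered_cons, conv]
      change conv _ _ v + conv _ (conv (fun u => T (h :: u)) (clustered T)) v -
        (conv _ _ v + conv _ (conv (fun u => T (f :: u)) (clustered T)) v) = _
      rw [conv_assoc, conv_assoc]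
      have e1 : conv (conv (fun u => T (f :: u)) (fun u => T (h :: u))) (clustered T) v =
          conv (conv (fun u => T (h :: u)) (fun u => T (f :: u))) (clustered T) v :=
        conv_congr (fun u _ => conv_comm _ _ u) fun _ _ => rfl
      have e2 : conv (fun u => T (f :: h :: u)) (clustered T) v =
          conv (fun u => T (h :: f :: u)) (clustered T) v + c * clustered T v := by
        rw [← conv_unit c (clustered T) v, ← conv_add_left]
        refine conv_congr (fun u _ => ?_) fun _ _ => rfl
        by_cases hu : u = []
        · subst hu; simp [← h2]
        · simpa [hu] using h3 [] u (by simpa using hu)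
      rw [e1, e2]; ring
    | cons k u =>
      simp only [List.cons_append, clustered_cons]
      refine swapped' u v _ _ (fun u' v' _ => ?_) fun u' v' hh => ?_
      · exact h3 (k :: u') v' (by simp)
      · exact ih (u'.length + v'.length) (by simp at hn; omega) u' v' rfl
  exact main _ u v rfl

end Words

/-! ### Functions with non-negative spectrum -/

section Spectrum

open FourierTransform

theorem fourier_eq_fourierTransform (f : 𝓢(ℝ, ℂ)) (E : ℝ) :
    fourier f E = ((Real.sqrt (2 * Real.pi))⁻¹ : ℝ) * 𝓕 f (E / (2 * Real.pi)) := by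
  rw [fourier, SchwartzMap.fourier_coe, Real.fourier_real_eq_integral_exp_smul]
  congr 1
  refine integral_congr_ae (ae_of_all _ fun t => ?_)
  simp only [smul_eq_mul]
  congr 2
  have : (Real.pi : ℂ) ≠ 0 := by exact_mod_cast Real.pi_ne_zero
  push_cast
  field_simp

theorem fourier_eq_zero_iff (f : 𝓢(ℝ, ℂ)) (E : ℝ) :
    fourier f E = 0 ↔ 𝓕 f (E / (2 * Real.pi)) = 0 := by
  rw [fourier_eq_fourierTransform]
  have h : (((Real.sqrt (2 * Real.pi))⁻¹ : ℝ) : ℂ) ≠ 0 := by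
    exact_mod_cast (by positivity : (Real.sqrt (2 * Real.pi))⁻¹ ≠ 0)
  exact mul_eq_zero_iff_left h

/-- The pairing of `G` with the reflections of all Schwartz functions with Fourier transform
supported in `[0, ∞)` vanishes. -/
def NonnegSpectrum (G : ℝ → ℂ) : Prop :=
  ∀ f : 𝓢(ℝ, ℂ), (∀ ξ < 0, 𝓕 f ξ = 0) → ∫ t, G t * f (-t) = 0

/-- The reflection `t ↦ f (-t)` of a Schwartz function. -/
def reflect (f : 𝓢(ℝ, ℂ)) : 𝓢(ℝ, ℂ) :=
  SchwartzMap.compCLMOfContinuousLinearEquiv ℂ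
    ((LinearIsometryEquiv.neg ℝ (E := ℝ)) : ℝ ≃L[ℝ] ℝ) f

theorem reflect_apply (f : 𝓢(ℝ, ℂ)) (t : ℝ) : reflect f t = f (-t) := rfl

theorem fourier_reflect (f : 𝓢(ℝ, ℂ)) (ξ : ℝ) : 𝓕 (reflect f) ξ = 𝓕 f (-ξ) := by
  rw [SchwartzMap.fourier_coe, SchwartzMap.fourier_coe]
  exact Real.fourier_comp_linearIsometry (LinearIsometryEquiv.neg ℝ) f ξ

theorem fourier_fourier (f : 𝓢(ℝ, ℂ)) (ξ : ℝ) : 𝓕 (𝓕 f) ξ = f (-ξ) := by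
  have h : 𝓕⁻ (𝓕 f) = f := FourierTransform.fourierInv_fourier_eq f
  conv_rhs => rw [← h]
  rw [SchwartzMap.fourierInv_coe, Real.fourierInv_eq_fourier_neg, neg_neg]
  rfl

theorem fourier_compSub (f : 𝓢(ℝ, ℂ)) (a ξ : ℝ) :
    𝓕 (f.compSubConstCLM ℂ a) ξ = Complex.exp (-(2 * Real.pi * a * ξ * Complex.I)) * 𝓕 f ξ := by
  rw [SchwartzMap.fourier_coe, SchwartzMap.fourier_coe, Real.fourier_real_eq_integral_exp_smul,
    Real.fourier_real_eq_integral_exp_smul, ← integral_const_mul]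
  rw [← integral_sub_right_eq_self (fun v => Complex.exp (-(2 * Real.pi * a * ξ * Complex.I)) *
    Complex.exp (↑(-2 * Real.pi * v * ξ) * Complex.I) • f v) a]
  refine integral_congr_ae (ae_of_all _ fun t => ?_)
  simp only [smul_eq_mul, SchwartzMap.compSubConstCLM_apply]
  rw [← mul_assoc, ← Complex.exp_add]
  congr 2
  push_cast
  ring

/-- Multiplication of a Schwartz function by the character `t ↦ exp(2πiηt)`. -/
def modulate (η : ℝ) (f : 𝓢(ℝ, ℂ)) : 𝓢(ℝ, ℂ) := 𝓕⁻ ((𝓕 f).compSubConstCLM ℂ η)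

theorem fourier_modulate (η : ℝ) (f : 𝓢(ℝ, ℂ)) (ξ : ℝ) : 𝓕 (modulate η f) ξ = 𝓕 f (ξ - η) := by
  rw [modulate, FourierTransform.fourier_fourierInv_eq]
  rfl

theorem modulate_apply (η : ℝ) (f : 𝓢(ℝ, ℂ)) (t : ℝ) :
    modulate η f t = Complex.exp (2 * Real.pi * η * t * Complex.I) * f t := by
  rw [modulate, SchwartzMap.fourierInv_coe, Real.fourierInv_eq_fourier_neg,
    ← SchwartzMap.fourier_coe, fourier_compSub, fourier_fourier, neg_neg]
  congr 2
  push_cast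
  ring

/-- The pointwise product of Schwartz functions. -/
def schwartzMul (f g : 𝓢(ℝ, ℂ)) : 𝓢(ℝ, ℂ) := SchwartzMap.pairing (ContinuousLinearMap.mul ℂ ℂ) f g

theorem schwartzMul_apply (f g : 𝓢(ℝ, ℂ)) (t : ℝ) : schwartzMul f g t = f t * g t := rfl

/-- The Fourier transform of a product is a convolution, and lower bounds of supports add under
convolution: for each `s` one of the two factors of the integrand is zero. -/
theorem fourier_schwartzMul_eq_zero {f g : 𝓢(ℝ, ℂ)} {a b ξ : ℝ} (hf : ∀ ξ < a, 𝓕 f ξ = 0)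
    (hg : ∀ ξ < b, 𝓕 g ξ = 0) (hξ : ξ < a + b) : 𝓕 (schwartzMul f g) ξ = 0 := by
  have h : schwartzMul f g =
      𝓕 (SchwartzMap.convolution (ContinuousLinearMap.mul ℂ ℂ) (𝓕⁻ f) (𝓕⁻ g)) := by
    rw [SchwartzMap.fourier_convolution, FourierTransform.fourier_fourierInv_eq,
      FourierTransform.fourier_fourierInv_eq]
    rfl
  rw [h, fourier_fourier, SchwartzMap.convolution_apply]
  have h0 : ∀ s : ℝ, 𝓕⁻ f s * 𝓕⁻ g (-ξ - s) = 0 := by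
    intro s
    rw [SchwartzMap.fourierInv_coe, SchwartzMap.fourierInv_coe, Real.fourierInv_eq_fourier_neg,
      Real.fourierInv_eq_fourier_neg, ← SchwartzMap.fourier_coe, ← SchwartzMap.fourier_coe]
    by_cases hs : -s < a
    · rw [hf _ hs, zero_mul]
    · rw [hg _ (by linarith), mul_zero]
  rw [convolution]
  simp only [ContinuousLinearMap.mul_apply', h0, integral_zero]

/-- The integral is the value of `𝓕 f` at `0`, a boundary point of the half line on which `𝓕 f`
vanishes. -/
theorem integral_eq_zero_of_fourier {f : 𝓢(ℝ, ℂ)} (hf : ∀ ξ < 0, 𝓕 f ξ = 0) :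
    ∫ t, f t = 0 := by
  have h : 𝓕 f 0 = 0 := by
    have hc : IsClosed {ξ : ℝ | 𝓕 f ξ = 0} := isClosed_eq (𝓕 f).continuous continuous_const
    have : closure (Iio (0 : ℝ)) ⊆ {ξ : ℝ | 𝓕 f ξ = 0} := hc.closure_subset_iff.2 hf
    exact this (by simp)
  rw [SchwartzMap.fourier_coe, Real.fourier_real_eq_integral_exp_smul] at h
  simpa using h

theorem nonnegSpectrum_const (c : ℂ) : NonnegSpectrum fun _ => c := by
  intro f hf
  rw [integral_const_mul, integral_neg_eq_self (fun t => f t), integral_eq_zero_of_fourier hf,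
    mul_zero]

theorem integrable_mul_schwartz {G : ℝ → ℂ} {C : ℝ} (hm : AEStronglyMeasurable G)
    (hb : ∀ t, ‖G t‖ ≤ C) (f : 𝓢(ℝ, ℂ)) : Integrable fun t => G t * f (-t) :=
  (f.integrable.comp_neg).bdd_mul hm (ae_of_all _ hb)

theorem NonnegSpectrum.add {G H : ℝ → ℂ} {C D : ℝ} (hG : NonnegSpectrum G) (hH : NonnegSpectrum H)
    (hGm : AEStronglyMeasurable G) (hGb : ∀ t, ‖G t‖ ≤ C) (hHm : AEStronglyMeasurable H)
    (hHb : ∀ t, ‖H t‖ ≤ D) : NonnegSpectrum fun t => G t + H t := by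
  intro f hf
  simp only [add_mul]
  rw [integral_add (integrable_mul_schwartz hGm hGb f) (integrable_mul_schwartz hHm hHb f),
    hG f hf, hH f hf, add_zero]

theorem NonnegSpectrum.const_mul {G : ℝ → ℂ} (hG : NonnegSpectrum G) (c : ℂ) :
    NonnegSpectrum fun t => c * G t := by
  intro f hf
  simp only [mul_assoc]
  rw [integral_const_mul, hG f hf, mul_zero]

/-- Positivity of the spectrum can be tested with a gap. -/
theorem nonnegSpectrum_of_gap {G : ℝ → ℂ} {C : ℝ} (hm : AEStronglyMeasurable G)
    (hb : ∀ t, ‖G t‖ ≤ C)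
    (h : ∀ η > 0, ∀ f : 𝓢(ℝ, ℂ), (∀ ξ < η, 𝓕 f ξ = 0) → ∫ t, G t * f (-t) = 0) :
    NonnegSpectrum G := by
  intro f hf
  -- Modulation by `η` pushes the spectrum of `f` into `[η, ∞)` and tends to the identity as `η →
  -- 0`.
  have hlim : Tendsto (fun η : ℝ => ∫ t, G t * modulate η f (-t)) (𝓝[>] 0)
      (𝓝 (∫ t, G t * f (-t))) := by
    refine tendsto_integral_filter_of_dominated_convergence (fun t => C * ‖f (-t)‖) ?_ ?_ ?_ ?_
    · exact Eventually.of_forall fun η => (integrable_mul_schwartz hm hb _).1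
    · refine Eventually.of_forall fun η => ae_of_all _ fun t => ?_
      rw [norm_mul, modulate_apply, norm_mul]
      have : ‖Complex.exp (2 * Real.pi * η * ↑(-t) * Complex.I)‖ = 1 := by
        rw [show (2 * Real.pi * η * ↑(-t) * Complex.I : ℂ) =
          ((2 * Real.pi * η * (-t) : ℝ) : ℂ) * Complex.I by push_cast; ring]
        exact Complex.norm_exp_ofReal_mul_I _
      rw [this, one_mul]
      gcongr
      exact hb t
    · exact (f.integrable.comp_neg.norm).const_mul C
    · refine ae_of_all _ fun t => ?_
      have : Continuous fun η : ℝ => G t * modulate η f (-t) := by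
        simp only [modulate_apply]
        fun_prop
      have h0 := (this.tendsto 0).mono_left (nhdsWithin_le_nhds (s := Ioi 0))
      simpa [modulate_apply] using h0
  refine tendsto_nhds_unique hlim (tendsto_const_nhds.congr' ?_)
  filter_upwards [self_mem_nhdsWithin] with η hη
  symm
  refine h η hη _ fun ξ hξ => ?_
  rw [fourier_modulate]
  exact hf _ (by linarith)

/-- The dilations of a smooth cutoff function. -/
def cutoff (δ : ℝ) (x : ℝ) : ℂ := ((⟨1, 2, by norm_num, by norm_num⟩ : ContDiffBump (0 : ℝ)) (δ * x) : ℝ)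

theorem contDiff_cutoff (δ : ℝ) : ContDiff ℝ ∞ (cutoff δ) := by
  unfold cutoff
  refine Complex.ofRealCLM.contDiff.comp ?_
  exact (ContDiffBump.contDiff _).comp (contDiff_const.mul contDiff_id)

theorem cutoff_eq_zero {δ x : ℝ} (hx : 2 ≤ |δ * x|) : cutoff δ x = 0 := by
  unfold cutoff
  rw [ContDiffBump.zero_of_le_dist]
  · simp
  · simpa using hx

theorem cutoff_eq_one {δ x : ℝ} (hx : |δ * x| ≤ 1) : cutoff δ x = 1 := by
  unfold cutoff
  rw [ContDiffBump.one_of_mem_closedBall]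
  · simp
  · simpa using hx

theorem hasCompactSupport_cutoff {δ : ℝ} (hδ : 0 < δ) : HasCompactSupport (cutoff δ) := by
  refine HasCompactSupport.intro (isCompact_Icc (a := -(2 / δ)) (b := 2 / δ)) fun x hx => ?_
  refine cutoff_eq_zero ?_
  rw [abs_mul, abs_of_pos hδ]
  by_contra h
  push Not at h
  have : |x| < 2 / δ := by rw [lt_div_iff₀ hδ]; linarith
  exact hx ⟨by linarith [(abs_lt.1 this).1], (abs_lt.1 this).2.le⟩

/-- A smooth approximation of the indicator function of the half line. -/
theorem exists_smooth_step {η : ℝ} (hη : 0 < η) : ∃ χ : ℝ → ℂ, ContDiff ℝ ∞ χ ∧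
    (∀ x ≤ -η, χ x = 0) ∧ ∀ x ≥ 0, χ x = 1 := by
  refine ⟨fun x => (Real.smoothTransition ((x + η) / η) : ℝ), ?_, fun x hx => ?_, fun x hx => ?_⟩
  · refine Complex.ofRealCLM.contDiff.comp ?_
    exact Real.smoothTransition.contDiff.comp ((contDiff_id.add contDiff_const).div_const η)
  · beta_reduce
    rw [Real.smoothTransition.zero_of_nonpos (div_nonpos_of_nonpos_of_nonneg (by linarith) hη.le)]
    simp
  · beta_reduce
    rw [Real.smoothTransition.one_of_one_le ((one_le_div hη).2 (by linarith))]
    simp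

theorem integrable_kernel {H : ℝ → ℝ → ℂ} {C : ℝ} (hc : Continuous (Function.uncurry H))
    (hb : ∀ s t, ‖H s t‖ ≤ C) (f K : 𝓢(ℝ, ℂ)) :
    Integrable (fun p : ℝ × ℝ => H p.1 p.2 * (K (p.1 - p.2) * f (-p.2)))
      (volume.prod volume) := by
  have h := (f.integrable.comp_neg (μ := volume)).convolution_integrand
    (ContinuousLinearMap.mul ℂ ℂ) (K.integrable (μ := volume))
  have h' : Integrable (fun p : ℝ × ℝ => K (p.1 - p.2) * f (-p.2)) (volume.prod volume) := by
    refine h.congr (ae_of_all _ fun p => ?_)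
    simp [mul_comm]
  exact h'.bdd_mul (hc.aestronglyMeasurable) (ae_of_all _ fun p => hb _ _)

/-- The gap `η` of `f` leaves room to cut the band `β` smoothly between `-η` and `0`. Frequencies
above `-η` multiplied by `f` give, for fixed `s`, a test function in `t` with non-negative spectrum,
so `h2` applies; frequencies below `0` give, after reflection and for fixed `t`, such a test
function in `s`, so `h1` applies. -/
theorem kernel_integral_eq_zero {H : ℝ → ℝ → ℂ} {C : ℝ} (hc : Continuous (Function.uncurry H))
    (hb : ∀ s t, ‖H s t‖ ≤ C) (h1 : ∀ t, NonnegSpectrum fun s => H s t)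
    (h2 : ∀ s, NonnegSpectrum (H s)) {η : ℝ} (hη : 0 < η) {f : 𝓢(ℝ, ℂ)}
    (hf : ∀ ξ < η, 𝓕 f ξ = 0) {β : ℝ → ℂ} (hβ : ContDiff ℝ ∞ β) (hβc : HasCompactSupport β) :
    ∫ t, ∫ s, H s t * (𝓕⁻ (hβc.toSchwartzMap hβ) (s - t) * f (-t)) = 0 := by
  obtain ⟨χ, hχ, hχ0, hχ1⟩ := exists_smooth_step hη
  let β1 := (hβc.mul_left (f := χ)).toSchwartzMap (hχ.mul hβ)
  let β2 := (hβc.mul_left (f := fun x => 1 - χ x)).toSchwartzMap ((contDiff_const.sub hχ).mul hβ)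
  have hsum : hβc.toSchwartzMap hβ = β1 + β2 := by
    ext x
    change β x = χ x * β x + (1 - χ x) * β x
    ring
  have hpt : ∀ s t, H s t * (𝓕⁻ (hβc.toSchwartzMap hβ) (s - t) * f (-t)) =
      H s t * (𝓕⁻ β1 (s - t) * f (-t)) + H s t * (𝓕⁻ β2 (s - t) * f (-t)) := by
    intro s t
    have h : 𝓕⁻ (hβc.toSchwartzMap hβ) (s - t) = 𝓕⁻ β1 (s - t) + 𝓕⁻ β2 (s - t) := by
      rw [hsum, FourierTransform.fourierInv_add]
      rfl
    rw [h]
    ring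
  have e1 : ∫ t, ∫ s, H s t * (𝓕⁻ β1 (s - t) * f (-t)) = 0 := by
    rw [integral_integral_swap (f := fun t s => H s t * (𝓕⁻ β1 (s - t) * f (-t)))
      ((integrable_kernel hc hb f (𝓕⁻ β1)).swap)]
    refine integral_eq_zero_of_ae (ae_of_all _ fun s => ?_)
    let k := schwartzMul ((𝓕⁻ β1).compSubConstCLM ℂ (-s)) f
    have := h2 s k fun ξ hξ => by
      refine fourier_schwartzMul_eq_zero (a := -η) (b := η) (fun ξ hξ => ?_) hf (by linarith)
      rw [fourier_compSub, FourierTransform.fourier_fourierInv_eq]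
      change _ * (χ ξ * β ξ) = 0
      rw [hχ0 ξ hξ.le, zero_mul, mul_zero]
    simpa [k, schwartzMul_apply, sub_eq_neg_add, add_comm] using this
  have e2 : ∫ t, ∫ s, H s t * (𝓕⁻ β2 (s - t) * f (-t)) = 0 := by
    refine integral_eq_zero_of_ae (ae_of_all _ fun t => ?_)
    let k := (reflect (𝓕⁻ β2)).compSubConstCLM ℂ (-t)
    have := h1 t k fun ξ hξ => by
      rw [fourier_compSub, fourier_reflect, FourierTransform.fourier_fourierInv_eq]
      change _ * ((1 - χ (-ξ)) * β (-ξ)) = 0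
      rw [hχ1 (-ξ) (by linarith), sub_self, zero_mul, mul_zero]
    have hk : ∀ s, k (-s) = 𝓕⁻ β2 (s - t) := by
      intro s
      change 𝓕⁻ β2 (-(-s - -t)) = _
      congr 1; ring
    simp only [hk] at this
    simp only [← mul_assoc, Pi.zero_apply]
    rw [integral_mul_const, this, zero_mul]
  simp only [hpt]
  have i1 := (integrable_kernel hc hb f (𝓕⁻ β1)).swap
  have i2 := (integrable_kernel hc hb f (𝓕⁻ β2)).swap
  have hae : ∀ᵐ t : ℝ, ∫ s, (H s t * (𝓕⁻ β1 (s - t) * f (-t)) +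
      H s t * (𝓕⁻ β2 (s - t) * f (-t))) = (∫ s, H s t * (𝓕⁻ β1 (s - t) * f (-t))) +
      ∫ s, H s t * (𝓕⁻ β2 (s - t) * f (-t)) := by
    filter_upwards [i1.prod_right_ae, i2.prod_right_ae] with t ht1 ht2
    exact integral_add ht1 ht2
  rw [integral_congr_ae hae]
  refine (integral_add i1.integral_prod_left i2.integral_prod_left).trans ?_
  simp only [Function.comp_apply, Prod.fst_swap, Prod.snd_swap]
  rw [e1, e2, add_zero]

/-- The restriction of a function of two variables to the diagonal. -/
theorem nonnegSpectrum_diag {H : ℝ → ℝ → ℂ} {C : ℝ} (hc : Continuous (Function.uncurry H))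
    (hb : ∀ s t, ‖H s t‖ ≤ C) (h1 : ∀ t, NonnegSpectrum fun s => H s t)
    (h2 : ∀ s, NonnegSpectrum (H s)) : NonnegSpectrum fun t => H t t := by
  have hd : Continuous fun t => H t t := hc.comp (continuous_id.prodMk continuous_id)
  refine nonnegSpectrum_of_gap hd.aestronglyMeasurable (fun t => hb t t) fun η hη f hf => ?_
  -- The inverse transform of `cutoff δ` is the rescaled function `δ⁻¹ ψ(· / δ)` with `∫ ψ = 1`: a
  -- band-limited approximate identity, which concentrates the kernel on the diagonal.
  let ψ : 𝓢(ℝ, ℂ) := 𝓕⁻ ((hasCompactSupport_cutoff one_pos).toSchwartzMap (contDiff_cutoff 1))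
  have hψ1 : ∫ x, ψ x = 1 := by
    have h : 𝓕 ψ 0 = cutoff 1 0 := by
      rw [FourierTransform.fourier_fourierInv_eq]; rfl
    rw [cutoff_eq_one (by simp), SchwartzMap.fourier_coe,
      Real.fourier_real_eq_integral_exp_smul] at h
    simpa using h
  have hscale : ∀ (δ : ℝ) (hδ : 0 < δ) (x : ℝ), 𝓕⁻ ((hasCompactSupport_cutoff hδ).toSchwartzMap
      (contDiff_cutoff δ)) (δ * x) = (δ⁻¹ : ℝ) * ψ x := by
    intro δ hδ x
    simp only [ψ]
    rw [SchwartzMap.fourierInv_coe, SchwartzMap.fourierInv_coe, Real.fourierInv_eq_fourier_neg,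
      Real.fourierInv_eq_fourier_neg, Real.fourier_real_eq_integral_exp_smul,
      Real.fourier_real_eq_integral_exp_smul]
    have := Measure.integral_comp_mul_left (fun v : ℝ =>
      Complex.exp (↑(-2 * Real.pi * v * -x) * Complex.I) • cutoff 1 v) δ
    rw [abs_of_pos (inv_pos.2 hδ)] at this
    rw [← Complex.real_smul]
    refine Eq.trans ?_ this
    refine integral_congr_ae (ae_of_all _ fun v => ?_)
    change _ • cutoff δ v = _
    simp only [cutoff, one_mul]
    congr 4
    ring
  -- The substitution `s = t + δ x` in `kernel_integral_eq_zero`.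
  have hzero : ∀ δ > 0, ∫ t, ∫ x, H (t + δ * x) t * (ψ x * f (-t)) = 0 := by
    intro δ hδ
    rw [← kernel_integral_eq_zero hc hb h1 h2 hη hf (contDiff_cutoff δ)
      (hasCompactSupport_cutoff hδ)]
    refine integral_congr_ae (ae_of_all _ fun t => ?_)
    simp only
    set K := 𝓕⁻ ((hasCompactSupport_cutoff hδ).toSchwartzMap (contDiff_cutoff δ)) with hK
    rw [← integral_add_left_eq_self (fun s => H s t * (K (s - t) * f (-t))) t]
    have := Measure.integral_comp_mul_left (fun x : ℝ =>
      H (t + x) t * (K (t + x - t) * f (-t))) δ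
    rw [abs_of_pos (inv_pos.2 hδ)] at this
    have h3 := congrArg (fun z : ℂ => (δ : ℂ) * z) this
    simp only [Complex.real_smul] at h3
    rw [← mul_assoc, ← Complex.ofReal_mul, mul_inv_cancel₀ hδ.ne', Complex.ofReal_one,
      one_mul] at h3
    rw [← h3, ← integral_const_mul]
    refine integral_congr_ae (ae_of_all _ fun x => ?_)
    simp only [add_sub_cancel_left]
    rw [hK, hscale δ hδ x]
    have : (δ : ℂ) ≠ 0 := by exact_mod_cast hδ.ne'
    push_cast
    field_simp
  have hlim : Tendsto (fun δ : ℝ => ∫ p : ℝ × ℝ, H (p.1 + δ * p.2) p.1 * (ψ p.2 * f (-p.1)))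
      (𝓝[>] 0) (𝓝 (∫ p : ℝ × ℝ, H p.1 p.1 * (ψ p.2 * f (-p.1)))) := by
    have hint : Integrable (fun p : ℝ × ℝ => f (-p.1) * ψ p.2) (volume.prod volume) :=
      (f.integrable.comp_neg).mul_prod (ψ.integrable)
    refine tendsto_integral_filter_of_dominated_convergence
      (fun p => C * ‖f (-p.1) * ψ p.2‖) ?_ ?_ ?_ ?_
    · refine Eventually.of_forall fun δ => Continuous.aestronglyMeasurable ?_
      have : Continuous fun p : ℝ × ℝ => H (p.1 + δ * p.2) p.1 :=
        hc.comp ((continuous_fst.add (continuous_const.mul continuous_snd)).prodMk continuous_fst)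
      exact this.mul ((ψ.continuous.comp continuous_snd).mul
        (f.continuous.comp continuous_fst.neg))
    · refine Eventually.of_forall fun δ => ae_of_all _ fun p => ?_
      rw [norm_mul, mul_comm (ψ p.2)]
      gcongr
      exact hb _ _
    · exact hint.norm.const_mul C
    · refine ae_of_all _ fun p => ?_
      have : Continuous fun δ : ℝ => H (p.1 + δ * p.2) p.1 * (ψ p.2 * f (-p.1)) := by
        refine Continuous.mul (hc.comp (Continuous.prodMk ?_ continuous_const)) continuous_const
        fun_prop
      have h0 := (this.tendsto 0).mono_left (nhdsWithin_le_nhds (s := Ioi 0))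
      simpa using h0
  have hval : ∫ p : ℝ × ℝ, H p.1 p.1 * (ψ p.2 * f (-p.1)) = ∫ t, H t t * f (-t) := by
    have : ∀ p : ℝ × ℝ, H p.1 p.1 * (ψ p.2 * f (-p.1)) = (H p.1 p.1 * f (-p.1)) * ψ p.2 :=
      fun p => by ring
    simp only [this]
    rw [Measure.volume_eq_prod, integral_prod_mul (fun t => H t t * f (-t)) ψ, hψ1, mul_one]
  rw [← hval]
  refine tendsto_nhds_unique hlim (tendsto_const_nhds.congr' ?_)
  filter_upwards [self_mem_nhdsWithin] with δ hδ
  rw [← hzero δ hδ, Measure.volume_eq_prod, integral_prod]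
  have hint : Integrable (fun p : ℝ × ℝ => f (-p.1) * ψ p.2) (volume.prod volume) :=
    (f.integrable.comp_neg).mul_prod (ψ.integrable)
  have hcont : Continuous fun p : ℝ × ℝ => H (p.1 + δ * p.2) p.1 :=
    hc.comp ((continuous_fst.add (continuous_const.mul continuous_snd)).prodMk continuous_fst)
  refine (hint.bdd_mul hcont.aestronglyMeasurable (ae_of_all _ fun p => hb _ _)).congr
    (ae_of_all _ fun p => ?_)
  simp only
  ring

/-- The product is the restriction of `G s * H t` to the diagonal. -/
theorem NonnegSpectrum.mul {G H : ℝ → ℂ} {C D : ℝ} (hG : NonnegSpectrum G) (hH : NonnegSpectrum H)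
    (hGc : Continuous G) (hGb : ∀ t, ‖G t‖ ≤ C) (hHc : Continuous H) (hHb : ∀ t, ‖H t‖ ≤ D) :
    NonnegSpectrum fun t => G t * H t := by
  refine nonnegSpectrum_diag (H := fun s t => G s * H t) (C := C * D)
    ((hGc.comp continuous_fst).mul (hHc.comp continuous_snd)) (fun s t => ?_) (fun t => ?_)
    fun s => hH.const_mul _
  · rw [norm_mul]
    exact mul_le_mul (hGb s) (hHb t) (norm_nonneg _) ((norm_nonneg _).trans (hGb s))
  · simpa only [mul_comm] using hG.const_mul (H t)

/-- The restriction to the diagonal of a function that has non-negative spectrum in each of its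
variables. -/
theorem nonnegSpectrum_diag_pi {r : ℕ} {H : (Fin r → ℝ) → ℂ} {C : ℝ} (hc : Continuous H)
    (hb : ∀ x, ‖H x‖ ≤ C)
    (h : ∀ (i : Fin r) (x : Fin r → ℝ), NonnegSpectrum fun t => H (Function.update x i t)) :
    NonnegSpectrum fun t => H fun _ => t := by
  induction r with
  | zero =>
    have : (fun t : ℝ => H fun _ => t) = fun _ => H finZeroElim := by
      funext t; congr 1; exact Subsingleton.elim _ _
    rw [this]
    exact nonnegSpectrum_const _
  | succ r ih =>
    have e : (fun t : ℝ => H fun _ => t) = fun t => H (Fin.cons t fun _ => t) := by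
      funext t; congr 1; funext i
      refine Fin.cases ?_ (fun _ => ?_) i <;> simp
    rw [e]
    refine nonnegSpectrum_diag (H := fun s t => H (Fin.cons s fun _ => t)) (C := C) ?_
      (fun s t => hb _) (fun t => ?_) fun s => ?_
    · refine hc.comp (continuous_pi fun i => ?_)
      refine Fin.cases ?_ (fun _ => ?_) i
      · simpa using continuous_fst
      · simpa using continuous_snd
    · have := h 0 (Fin.cons 0 fun _ => t)
      simpa using this
    · refine ih (H := fun x => H (Fin.cons s x)) ?_ (fun x => hb _) fun i x => ?_
      · refine hc.comp (continuous_pi fun i => ?_)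
        refine Fin.cases ?_ (fun _ => ?_) i
        · simpa using continuous_const
        · simpa using continuous_apply _
      · have := h i.succ (Fin.cons s x)
        simpa [Fin.cons_update] using this

end Spectrum

/-! ### Conjugation and limits in the spectral condition; density of compactly supported functions
-/

section SpectrumLimits

open FourierTransform

/-- The function `t ↦ conj (f (-t))`. -/
def conjReflect (f : 𝓢(ℝ, ℂ)) : 𝓢(ℝ, ℂ) :=
  SchwartzMap.postcompCLM (𝕜 := ℝ) (Complex.conjCLE : ℂ →L[ℝ] ℂ) (reflect f)

theorem conjReflect_apply (f : 𝓢(ℝ, ℂ)) (t : ℝ) : conjReflect f t = conj (f (-t)) := rfl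

theorem fourier_conjReflect (f : 𝓢(ℝ, ℂ)) (ξ : ℝ) : 𝓕 (conjReflect f) ξ = conj (𝓕 f ξ) := by
  rw [SchwartzMap.fourier_coe, SchwartzMap.fourier_coe, Real.fourier_real_eq_integral_exp_smul,
    Real.fourier_real_eq_integral_exp_smul, ← integral_conj,
    ← integral_neg_eq_self (fun t => conj (Complex.exp (↑(-2 * Real.pi * t * ξ) * Complex.I) • f t))]
  refine integral_congr_ae (ae_of_all _ fun t => ?_)
  simp only [smul_eq_mul, map_mul, conjReflect_apply, ← Complex.exp_conj, Complex.conj_I,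
    Complex.conj_ofReal]
  congr 2
  push_cast
  ring

/-- Testing against `conj (f (-t))` conjugates the Fourier transform and so keeps its support. For
two-point functions this operation exchanges the two arguments of `D⁺`. -/
theorem NonnegSpectrum.conj_neg {G : ℝ → ℂ} (hG : NonnegSpectrum G) :
    NonnegSpectrum fun t => conj (G (-t)) := by
  intro f hf
  have h := hG (conjReflect f) fun ξ hξ => by rw [fourier_conjReflect, hf ξ hξ, map_zero]
  rw [← integral_neg_eq_self]
  simp only [neg_neg]
  have h2 : ∀ t, conj (G t) * f t = conj (G t * conjReflect f (-t)) := fun t => by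
    simp [conjReflect_apply]
  simp only [h2]
  rw [integral_conj, h, map_zero]

/-- Rescaled cutoffs form an approximate identity up to the nonzero constant `∫ cutoff 1`, and the
bound on `G` allows dominated convergence. -/
theorem nonnegSpectrum_of_mollified {G : ℝ → ℂ} {C : ℝ} (hc : Continuous G)
    (hb : ∀ t, ‖G t‖ ≤ C)
    (h : ∀ φ : ℝ → ℂ, ContDiff ℝ ∞ φ → HasCompactSupport φ →
      NonnegSpectrum fun t => ∫ s, φ s * G (t + s)) : NonnegSpectrum G := by
  intro f hf
  have hφc : Integrable (cutoff 1) :=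
    (contDiff_cutoff 1).continuous.integrable_of_hasCompactSupport (hasCompactSupport_cutoff one_pos)
  have hφ0 : ∫ x, cutoff 1 x ≠ 0 := by
    have : ∫ x, cutoff 1 x = ((∫ x, (⟨1, 2, by norm_num, by norm_num⟩ :
        ContDiffBump (0 : ℝ)) x : ℝ) : ℂ) := by
      rw [← integral_complex_ofReal]
      simp [cutoff]
    rw [this]
    exact_mod_cast (ContDiffBump.integral_pos _).ne'
  have hint : Integrable (fun p : ℝ × ℝ => f (-p.1) * cutoff 1 p.2) (volume.prod volume) :=
    (f.integrable.comp_neg).mul_prod hφc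
  have hcont : ∀ δ : ℝ, Continuous fun p : ℝ × ℝ => G (p.1 + δ * p.2) := fun δ =>
    hc.comp (continuous_fst.add (continuous_const.mul continuous_snd))
  have hzero : ∀ δ > 0, ∫ t, ∫ x, G (t + δ * x) * (f (-t) * cutoff 1 x) = 0 := by
    intro δ hδ
    have h1 := h (cutoff δ⁻¹) (contDiff_cutoff _) (hasCompactSupport_cutoff (inv_pos.2 hδ)) f hf
    have h2 : ∀ t, ∫ x, G (t + δ * x) * (f (-t) * cutoff 1 x) =
        ((δ⁻¹ : ℝ) : ℂ) * ((∫ s, cutoff δ⁻¹ s * G (t + s)) * f (-t)) := by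
      intro t
      have := Measure.integral_comp_mul_left (fun s : ℝ => cutoff δ⁻¹ s * G (t + s)) δ
      rw [abs_of_pos (inv_pos.2 hδ), Complex.real_smul] at this
      rw [← mul_assoc, ← this, ← integral_mul_const]
      refine integral_congr_ae (ae_of_all _ fun x => ?_)
      simp only [cutoff, one_mul]
      rw [← mul_assoc δ⁻¹, inv_mul_cancel₀ hδ.ne', one_mul]
      ring
    simp only [h2]
    rw [integral_const_mul, h1, mul_zero]
  have hlim : Tendsto (fun δ : ℝ => ∫ p : ℝ × ℝ, G (p.1 + δ * p.2) * (f (-p.1) * cutoff 1 p.2))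
      (𝓝[>] 0) (𝓝 (∫ p : ℝ × ℝ, G p.1 * (f (-p.1) * cutoff 1 p.2))) := by
    refine tendsto_integral_filter_of_dominated_convergence
      (fun p => C * ‖f (-p.1) * cutoff 1 p.2‖) ?_ ?_ ?_ ?_
    · exact Eventually.of_forall fun δ => (hint.bdd_mul (hcont δ).aestronglyMeasurable
        (ae_of_all _ fun p => hb _)).1
    · refine Eventually.of_forall fun δ => ae_of_all _ fun p => ?_
      rw [norm_mul]
      gcongr
      exact hb _
    · exact hint.norm.const_mul C
    · refine ae_of_all _ fun p => ?_
      have : Continuous fun δ : ℝ => G (p.1 + δ * p.2) * (f (-p.1) * cutoff 1 p.2) := by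
        fun_prop
      have h0 := (this.tendsto 0).mono_left (nhdsWithin_le_nhds (s := Ioi 0))
      simpa using h0
  have hval : ∫ p : ℝ × ℝ, G p.1 * (f (-p.1) * cutoff 1 p.2) =
      (∫ t, G t * f (-t)) * ∫ x, cutoff 1 x := by
    simp only [← mul_assoc]
    rw [Measure.volume_eq_prod, integral_prod_mul (fun t => G t * f (-t)) (cutoff 1)]
  have h0 : (∫ t, G t * f (-t)) * ∫ x, cutoff 1 x = 0 := by
    rw [← hval]
    refine tendsto_nhds_unique hlim (tendsto_const_nhds.congr' ?_)
    filter_upwards [self_mem_nhdsWithin] with δ hδ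
    rw [← hzero δ hδ, Measure.volume_eq_prod, integral_prod]
    exact hint.bdd_mul (hcont δ).aestronglyMeasurable (ae_of_all _ fun p => hb _)
  exact (mul_eq_zero.1 h0).resolve_right hφ0

/-- Uniformity in `δ ≤ 1` comes from the chain rule, which produces the factor `δ ^ i ≤ 1`. -/
theorem exists_bound_iteratedFDeriv_cutoff (i : ℕ) : ∃ M, ∀ (δ : ℝ), 0 < δ → δ ≤ 1 → ∀ x,
    ‖iteratedFDeriv ℝ i (fun y => cutoff δ y - 1) x‖ ≤ M := by
  have hs : ContDiff ℝ ∞ fun y => cutoff 1 y - 1 := (contDiff_cutoff 1).sub contDiff_const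
  have hbd : ∃ M, ∀ x, ‖iteratedDeriv i (fun y => cutoff 1 y - 1) x‖ ≤ M := by
    rcases Nat.eq_zero_or_pos i with rfl | hi
    · obtain ⟨M, hM⟩ := (hasCompactSupport_cutoff one_pos).exists_bound_of_continuous
        (contDiff_cutoff 1).continuous
      refine ⟨M + 1, fun x => ?_⟩
      simp only [iteratedDeriv_zero]
      exact (norm_sub_le _ _).trans (by simpa using hM x)
    · have e : iteratedDeriv i (fun y => cutoff 1 y - 1) = iteratedDeriv i (cutoff 1) := by
        obtain ⟨j, rfl⟩ := Nat.exists_eq_succ_of_ne_zero hi.ne'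
        rw [iteratedDeriv_succ', iteratedDeriv_succ']
        congr 1
        funext x
        simp
      rw [e]
      have hc := (hasCompactSupport_cutoff one_pos).iteratedFDeriv (𝕜 := ℝ) i
      obtain ⟨M, hM⟩ := hc.exists_bound_of_continuous
        ((contDiff_cutoff 1).continuous_iteratedFDeriv (m := i) (by exact_mod_cast le_top))
      exact ⟨M, fun x => by rw [← norm_iteratedFDeriv_eq_norm_iteratedDeriv]; exact hM x⟩
  obtain ⟨M, hM⟩ := hbd
  refine ⟨M, fun δ hδ hδ1 x => ?_⟩
  have e : (fun y => cutoff δ y - 1) = fun y => (fun z => cutoff 1 z - 1) (δ * y) := by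
    funext y; simp [cutoff]
  rw [norm_iteratedFDeriv_eq_norm_iteratedDeriv, e,
    iteratedDeriv_comp_const_smul (hs.of_le (by exact_mod_cast le_top)) δ]
  rw [norm_smul, norm_pow, Real.norm_of_nonneg hδ.le]
  calc δ ^ i * ‖iteratedDeriv i (fun z => cutoff 1 z - 1) (δ * x)‖ ≤ 1 * M :=
        mul_le_mul (pow_le_one₀ hδ.le hδ1) (hM _) (norm_nonneg _) zero_le_one
    _ = M := one_mul M

/-- Compactly supported functions are dense in the Schwartz space. -/
theorem schwartz_eq_zero_of_hasCompactSupport (Λ : 𝓢(ℝ, ℂ) →L[ℂ] ℂ)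
    (h : ∀ f : 𝓢(ℝ, ℂ), HasCompactSupport f → Λ f = 0) (f : 𝓢(ℝ, ℂ)) : Λ f = 0 := by
  have hsupp : ∀ {δ : ℝ}, 0 < δ → HasCompactSupport (fun x => cutoff δ x * f x) :=
    fun hδ => (hasCompactSupport_cutoff hδ).mul_right
  have hpos : ∀ j : ℕ, (0 : ℝ) < ((j : ℝ) + 1)⁻¹ := fun j => by positivity
  let F : ℕ → 𝓢(ℝ, ℂ) := fun j =>
    (hsupp (hpos j)).toSchwartzMap ((contDiff_cutoff _).mul (f.smooth ⊤))
  have hF : Tendsto F atTop (𝓝 f) := by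
    rw [(schwartz_withSeminorms ℂ ℝ ℂ).tendsto_nhds]
    rintro ⟨k, n⟩ ε hε
    choose M hM using exists_bound_iteratedFDeriv_cutoff
    -- The seminorms of weight `k + 1` are used because `cutoff δ - 1` vanishes for `|δ x| < 1`,
    -- while `‖x‖ ^ k ≤ δ ‖x‖ ^ (k + 1)` elsewhere; this yields the small factor `δ`.
    set C : ℝ := ∑ i ∈ Finset.range (n + 1),
      (n.choose i : ℝ) * M i * SchwartzMap.seminorm ℂ (k + 1) (n - i) f with hC
    have hMn : ∀ i, 0 ≤ M i := fun i => (norm_nonneg _).trans (hM i 1 one_pos le_rfl 0)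
    have hC0 : 0 ≤ C := Finset.sum_nonneg fun i _ =>
      mul_nonneg (mul_nonneg (Nat.cast_nonneg _) (hMn i)) (apply_nonneg _ _)
    have hbound : ∀ j, SchwartzMap.seminorm ℂ k n (F j - f) ≤ ((j : ℝ) + 1)⁻¹ * C := by
      intro j
      set δ : ℝ := ((j : ℝ) + 1)⁻¹ with hδ
      have hδ1 : δ ≤ 1 := inv_le_one_of_one_le₀ (by linarith [(Nat.cast_nonneg j : (0 : ℝ) ≤ j)])
      refine SchwartzMap.seminorm_le_bound ℂ k n _ (mul_nonneg (hpos j).le hC0) fun x => ?_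
      have e : ((F j - f : 𝓢(ℝ, ℂ)) : ℝ → ℂ) = fun y => (cutoff δ y - 1) * f y := by
        funext y
        change cutoff δ y * f y - f y = _
        ring
      rw [e]
      by_cases hx : |δ * x| < 1
      · have hz : (fun y => (cutoff δ y - 1) * f y) =ᶠ[𝓝 x] fun _ => 0 := by
          have ho : IsOpen {y : ℝ | |δ * y| < 1} := isOpen_lt (by fun_prop) continuous_const
          filter_upwards [ho.mem_nhds hx] with y hy
          rw [cutoff_eq_one (le_of_lt hy), sub_self, zero_mul]
        rw [(hz.iteratedFDeriv ℝ n).eq_of_nhds]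
        rw [iteratedFDeriv_fun_zero, Pi.zero_apply, norm_zero, mul_zero]
        exact mul_nonneg (hpos j).le hC0
      · push Not at hx
        have hx' : ‖x‖ ^ k ≤ δ * ‖x‖ ^ (k + 1) := by
          rw [abs_mul, abs_of_pos (hpos j)] at hx
          rw [pow_succ, Real.norm_eq_abs]
          nlinarith [pow_nonneg (abs_nonneg x) k]
        have h1 := norm_iteratedFDeriv_mul_le (𝕜 := ℝ) (N := ∞)
          ((contDiff_cutoff δ).sub (contDiff_const (c := (1 : ℂ)))) (f.smooth ⊤) x (n := n)
          (by exact_mod_cast le_top)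
        calc ‖x‖ ^ k * ‖iteratedFDeriv ℝ n (fun y => (cutoff δ y - 1) * f y) x‖
            ≤ (δ * ‖x‖ ^ (k + 1)) * ∑ i ∈ Finset.range (n + 1), (n.choose i : ℝ) *
              ‖iteratedFDeriv ℝ i (fun y => cutoff δ y - 1) x‖ *
              ‖iteratedFDeriv ℝ (n - i) f x‖ :=
              mul_le_mul hx' h1 (norm_nonneg _) (mul_nonneg (hpos j).le (by positivity))
          _ = δ * ∑ i ∈ Finset.range (n + 1), (n.choose i : ℝ) *
              ‖iteratedFDeriv ℝ i (fun y => cutoff δ y - 1) x‖ *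
              (‖x‖ ^ (k + 1) * ‖iteratedFDeriv ℝ (n - i) f x‖) := by
              rw [mul_assoc, Finset.mul_sum]
              congr 1
              exact Finset.sum_congr rfl fun i _ => by ring
          _ ≤ δ * C := by
              refine mul_le_mul_of_nonneg_left (Finset.sum_le_sum fun i _ => ?_) (hpos j).le
              refine mul_le_mul ?_ (SchwartzMap.le_seminorm ℂ _ _ f x) (by positivity)
                (mul_nonneg (Nat.cast_nonneg _) (hMn i))
              exact mul_le_mul_of_nonneg_left (hM i δ (hpos j) hδ1 x) (Nat.cast_nonneg _)
    have hlim : Tendsto (fun j : ℕ => ((j : ℝ) + 1)⁻¹ * C) atTop (𝓝 0) := by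
      have := (tendsto_one_div_add_atTop_nhds_zero_nat (𝕜 := ℝ)).mul_const C
      simpa using this
    filter_upwards [hlim.eventually_lt_const hε] with j hj
    exact (hbound j).trans_lt hj
  have hlim := (Λ.continuous.tendsto f).comp hF
  refine tendsto_nhds_unique hlim (tendsto_const_nhds.congr fun j => ?_)
  exact (h (F j) (hsupp (hpos j))).symm

end SpectrumLimits

/-! ### The metric in charts -/

section Gram

variable {n : ℕ} {S : Type*} [TopologicalSpace S] [ChartedSpace (EuclideanSpace ℝ (Fin n)) S]
  [IsManifold 𝓘(ℝ, EuclideanSpace ℝ (Fin n)) ∞ S]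

/-- Smoothness of the coordinate vector fields: they are the tangent map of the inverse chart
applied to a constant section. -/
theorem contMDiffAt_mfderiv_chart_symm (p : ℝ × S) (e : Model n) {z : Model n}
    (hz : z ∈ (extChartAt (stModel n) p).target) :
    ContMDiffAt 𝓘(ℝ, Model n) (stModel n).tangent ∞
      (fun z => (Bundle.TotalSpace.mk' (Model n) ((extChartAt (stModel n) p).symm z)
        (mfderiv 𝓘(ℝ, Model n) (stModel n) (extChartAt (stModel n) p).symm z e) :
          TangentBundle (stModel n) (ℝ × S))) z := by
  have ho : IsOpen (extChartAt (stModel n) p).target := isOpen_extChartAt_target p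
  have h1 : ContMDiffOn 𝓘(ℝ, Model n) (stModel n) ∞ (extChartAt (stModel n) p).symm
      (extChartAt (stModel n) p).target := contMDiffOn_extChartAt_symm p
  have h2 := h1.contMDiffOn_tangentMapWithin (m := ∞) (by simp) ho.uniqueMDiffOn
  have h3 : ContMDiffAt 𝓘(ℝ, Model n) (𝓘(ℝ, Model n)).tangent ∞
      (fun z : Model n => (Bundle.TotalSpace.mk' (Model n) z e :
        TangentBundle 𝓘(ℝ, Model n) (Model n))) z := by
    have := contMDiffWithinAt_vectorSpace_iff_contDiffWithinAt (𝕜 := ℝ) (E := Model n) (n := ∞)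
      (V := fun _ => e) (s := univ) (x := z)
    rw [← contMDiffWithinAt_univ]
    exact this.2 contDiffWithinAt_const
  have h4 := (h2 (⟨z, e⟩ : TangentBundle 𝓘(ℝ, Model n) (Model n)) hz).contMDiffAt
    ((ho.preimage (FiberBundle.continuous_proj (Model n) (TangentSpace 𝓘(ℝ, Model n)))).mem_nhds hz)
  refine (h4.comp z h3).congr_of_eventuallyEq ?_
  filter_upwards [ho.mem_nhds hz] with w hw
  simp only [Function.comp_apply, tangentMapWithin]
  rw [mfderivWithin_of_isOpen ho hw]

namespace LorentzMetric

theorem eq_sum_stdBasis (v : Model n) :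
    v = ∑ i : Option (Fin n), (i.elim v.1 fun k => v.2 k : ℝ) • stdBasis n i := by
  rw [Fintype.sum_option]
  refine Prod.ext ?_ ?_
  · simp [stdBasis, Prod.fst_sum]
  · simp only [stdBasis, Option.elim, Prod.snd_add, Prod.smul_snd, smul_zero, zero_add,
      Prod.snd_sum]
    ext k
    simp [Finset.sum_apply, Pi.single_apply]

theorem sum_smul_stdBasis_eq_zero {x : Option (Fin n) → ℝ} (h : ∑ j, x j • stdBasis n j = 0) :
    x = 0 := by
  funext i
  rw [Fintype.sum_option] at h
  cases i with
  | none => simpa [stdBasis, Prod.fst_sum] using congrArg Prod.fst h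
  | some k =>
    have := congrArg (fun v : Model n => v.2 k) h
    simpa [stdBasis, Prod.snd_sum, Finset.sum_apply, Pi.single_apply] using this

/-- A kernel vector of the Gram matrix gives a nonzero `v` in the radical of `B`. It is orthogonal
to the time-like vector, so `B v v < 0`, contradicting `B v v = 0`. -/
theorem det_ne_zero_of_signature (B : Model n →L[ℝ] Model n →L[ℝ] ℝ) (L : Model n →L[ℝ] Model n)
    (hinv : L.IsInvertible)
    (hB : ∃ v, 0 < B v v ∧ ∀ w, B v w = 0 → w ≠ 0 → B w w < 0) :
    (Matrix.of fun i j => B (L (stdBasis n i)) (L (stdBasis n j))).det ≠ 0 := by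
  intro h0
  obtain ⟨x, hx, hx0⟩ := Matrix.exists_mulVec_eq_zero_iff.2 h0
  obtain ⟨e, rfl⟩ := hinv
  have hspan : ∀ w : Model n, ∃ c : Option (Fin n) → ℝ, w = ∑ i, c i • e (stdBasis n i) := by
    intro w
    refine ⟨fun i => i.elim (e.symm w).1 fun k => (e.symm w).2 k, ?_⟩
    have h2 := congrArg e (eq_sum_stdBasis (e.symm w))
    simp only [map_sum, map_smul] at h2
    rw [← h2, e.apply_symm_apply]
  set v := ∑ j, x j • e (stdBasis n j) with hv
  have hrad : ∀ w : Model n, B w v = 0 := by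
    intro w
    obtain ⟨c, rfl⟩ := hspan w
    have hi : ∀ i, B (e (stdBasis n i)) v = 0 := by
      intro i
      have := congrFun hx0 i
      rw [Matrix.mulVec, dotProduct, Pi.zero_apply] at this
      rw [hv, map_sum, ← this]
      refine Finset.sum_congr rfl fun j _ => ?_
      rw [map_smul, smul_eq_mul, mul_comm]
      rfl
    rw [map_sum B, sum_apply]
    refine Finset.sum_eq_zero fun i _ => ?_
    rw [map_smul, smul_apply, hi, smul_zero]
  have hv0 : v ≠ 0 := by
    intro h
    apply hx
    apply sum_smul_stdBasis_eq_zero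
    apply e.injective
    rw [map_zero, map_sum]; simp only [map_smul]; exact h
  obtain ⟨u, hu, hneg⟩ := hB
  have := hneg v (hrad u) hv0
  rw [hrad v] at this
  exact lt_irrefl _ this

variable (g : LorentzMetric n S)

theorem contDiffAt_gram (p : ℝ × S) (i j : Option (Fin n)) {z : Model n}
    (hz : z ∈ (extChartAt (stModel n) p).target) :
    ContDiffAt ℝ ∞ (fun z => g.gram p z i j) z := by
  have hb : ContMDiffAt 𝓘(ℝ, Model n) (stModel n) ∞ (extChartAt (stModel n) p).symm z :=
    (contMDiffOn_extChartAt_symm p).contMDiffAt ((isOpen_extChartAt_target p).mem_nhds hz)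
  have : ContMDiffAt 𝓘(ℝ, Model n) ((stModel n).prod 𝓘(ℝ)) ∞
      (fun z => Bundle.TotalSpace.mk' ℝ (E := Bundle.Trivial (ℝ × S) ℝ)
        ((extChartAt (stModel n) p).symm z) (g.gram p z i j)) z := by
    apply ContMDiffAt.clm_bundle_apply₂ (F₁ := Model n) (F₂ := Model n)
    · exact ContMDiffAt.comp z g.contMDiff.contMDiffAt hb
    · exact contMDiffAt_mfderiv_chart_symm p _ hz
    · exact contMDiffAt_mfderiv_chart_symm p _ hz
  simp only [Bundle.contMDiffAt_totalSpace] at this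
  exact contMDiffAt_iff_contDiffAt.1 this.2

theorem det_gram_ne_zero (p : ℝ × S) {z : Model n} (hz : z ∈ (extChartAt (stModel n) p).target) :
    (g.gram p z).det ≠ 0 := by
  have hinv := isInvertible_mfderivWithin_extChartAt_symm (I := stModel n) hz
  rw [ModelWithCorners.range_eq_univ, mfderivWithin_univ] at hinv
  exact det_ne_zero_of_signature (g.val ((extChartAt (stModel n) p).symm z))
    (mfderiv 𝓘(ℝ, Model n) (stModel n) (extChartAt (stModel n) p).symm z) hinv
    (g.signature _)

theorem contDiffAt_det_gram (p : ℝ × S) {z : Model n}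
    (hz : z ∈ (extChartAt (stModel n) p).target) :
    ContDiffAt ℝ ∞ (fun z => (g.gram p z).det) z := by
  simp only [Matrix.det_apply']
  refine ContDiffAt.sum fun σ _ => ?_
  refine contDiffAt_const.mul ?_
  exact contDiffAt_prod fun i _ => g.contDiffAt_gram p _ _ hz

theorem density_pos (p : ℝ × S) {z : Model n} (hz : z ∈ (extChartAt (stModel n) p).target) :
    0 < g.density p z :=
  Real.sqrt_pos.2 (abs_pos.2 (g.det_gram_ne_zero p hz))

theorem contDiffAt_density (p : ℝ × S) {z : Model n}
    (hz : z ∈ (extChartAt (stModel n) p).target) :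
    ContDiffAt ℝ ∞ (g.density p) z := by
  have h0 := g.det_gram_ne_zero p hz
  have h1 : ContDiffAt ℝ ∞ (fun z => |(g.gram p z).det|) z :=
    (g.contDiffAt_det_gram p hz).abs h0
  exact h1.sqrt (abs_pos.2 h0).ne'

theorem contDiffAt_inv_gram (p : ℝ × S) (i j : Option (Fin n)) {z : Model n}
    (hz : z ∈ (extChartAt (stModel n) p).target) :
    ContDiffAt ℝ ∞ (fun z => (g.gram p z)⁻¹ i j) z := by
  have h : (fun z => (g.gram p z)⁻¹ i j) =
      fun z => ((g.gram p z).det)⁻¹ * (g.gram p z).adjugate i j := by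
    funext z
    rw [Matrix.inv_def, Matrix.smul_apply, Ring.inverse_eq_inv', smul_eq_mul]
  -- By Cramer's rule the entries are polynomials in the entries of the Gram matrix, divided by a
  -- determinant that has no zeros on the target of the chart.
  rw [h]
  refine ((g.contDiffAt_det_gram p hz).inv (g.det_gram_ne_zero p hz)).mul ?_
  simp only [Matrix.adjugate_apply, Matrix.det_apply']
  refine ContDiffAt.sum fun σ _ => contDiffAt_const.mul (contDiffAt_prod fun k _ => ?_)
  by_cases hk : σ k = j
  · simp only [hk, Matrix.updateRow_self]; exact contDiffAt_const
  · simp only [Matrix.updateRow_ne hk]; exact g.contDiffAt_gram p _ _ hz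

end LorentzMetric

end Gram

/-! ### Time translations in charts -/

section Shift

theorem shift_shift {S : Type*} (s t : ℝ) (p : ℝ × S) : shift s (shift t p) = shift (t + s) p := by
  simp [shift, add_assoc]

@[simp] theorem shift_zero {S : Type*} (p : ℝ × S) : shift 0 p = p := by simp [shift]

theorem shift_neg_shift {S : Type*} (s : ℝ) (p : ℝ × S) : shift (-s) (shift s p) = p := by
  simp [shift_shift]

theorem shift_shift_neg {S : Type*} (s : ℝ) (p : ℝ × S) : shift s (shift (-s) p) = p := by
  simp [shift_shift]

variable {n : ℕ} {S : Type*} [TopologicalSpace S] [ChartedSpace (EuclideanSpace ℝ (Fin n)) S]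

variable (S) in
/-- The time translation as a homeomorphism. -/
def shiftHomeo (s : ℝ) : (ℝ × S) ≃ₜ (ℝ × S) :=
  (Homeomorph.addRight s).prodCongr (Homeomorph.refl S)

theorem continuous_shift (s : ℝ) : Continuous (shift s : ℝ × S → ℝ × S) :=
  (shiftHomeo S s).continuous

theorem contMDiff_shift (s : ℝ) :
    ContMDiff (stModel n) (stModel n) ∞ (shift s : ℝ × S → ℝ × S) := by
  refine ContMDiff.prodMk ?_ contMDiff_snd
  have h : ContMDiff 𝓘(ℝ, ℝ) 𝓘(ℝ, ℝ) ∞ (fun t : ℝ => t + s) :=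
    (contDiff_id.add contDiff_const).contMDiff
  exact h.comp contMDiff_fst

theorem mdifferentiableAt_shift (s : ℝ) (p : ℝ × S) :
    MDifferentiableAt (stModel n) (stModel n) (shift s : ℝ × S → ℝ × S) p :=
  (contMDiff_shift s).mdifferentiableAt (by simp)

/-- A chart is the identity in time times a chart of `S`. Hence translated points have the same
chart, and a translation adds `(s, 0)` to the coordinates; the invariance of the metric data, of the
operator and of the volume is deduced from this. -/
theorem extChartAt_eq_prod (p : ℝ × S) : extChartAt (stModel n) p =
    (PartialEquiv.refl ℝ).prod (extChartAt 𝓘(ℝ, EuclideanSpace ℝ (Fin n)) p.2) := by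
  rw [extChartAt_prod, extChartAt_model_space_eq_id]

theorem extChartAt_shift (s : ℝ) (p : ℝ × S) :
    extChartAt (stModel n) (shift s p) = extChartAt (stModel n) p := by
  rw [extChartAt_eq_prod, extChartAt_eq_prod]; rfl

theorem extChartAt_apply_shift (p : ℝ × S) (s : ℝ) (q : ℝ × S) :
    extChartAt (stModel n) p (shift s q) = extChartAt (stModel n) p q + (s, 0) := by
  rw [extChartAt_eq_prod]; simp [shift]

theorem extChartAt_symm_add (p : ℝ × S) (s : ℝ) (z : Model n) :
    (extChartAt (stModel n) p).symm (z + (s, 0)) =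
      shift s ((extChartAt (stModel n) p).symm z) := by
  rw [extChartAt_eq_prod]; simp [shift]

theorem shift_mem_extChartAt_source {p q : ℝ × S} (s : ℝ) :
    shift s q ∈ (extChartAt (stModel n) p).source ↔ q ∈ (extChartAt (stModel n) p).source := by
  rw [extChartAt_eq_prod]; simp [shift]

theorem add_mem_extChartAt_target {p : ℝ × S} {z : Model n} (s : ℝ) :
    z + (s, 0) ∈ (extChartAt (stModel n) p).target ↔ z ∈ (extChartAt (stModel n) p).target := by
  rw [extChartAt_eq_prod]; simp

namespace LorentzMetric

variable [IsManifold 𝓘(ℝ, EuclideanSpace ℝ (Fin n)) ∞ S] {g : LorentzMetric n S}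

theorem mdifferentiableAt_extChartAt_symm (p : ℝ × S) {z : Model n}
    (hz : z ∈ (extChartAt (stModel n) p).target) :
    MDifferentiableAt 𝓘(ℝ, Model n) (stModel n) (extChartAt (stModel n) p).symm z :=
  ((contMDiffOn_extChartAt_symm (n := ∞) p).contMDiffAt
    ((isOpen_extChartAt_target p).mem_nhds hz)).mdifferentiableAt (by simp)

theorem val_congr {q q' : ℝ × S} (h : q = q') (v w : Model n) : g.val q v w = g.val q' v w := by
  subst h; rfl

theorem mfderiv_extChartAt_symm_add (p : ℝ × S) (s : ℝ) {z : Model n}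
    (hz : z ∈ (extChartAt (stModel n) p).target) (e : Model n) :
    (mfderiv 𝓘(ℝ, Model n) (stModel n) (extChartAt (stModel n) p).symm (z + (s, 0)) e : Model n) =
      mfderiv (stModel n) (stModel n) (shift s) ((extChartAt (stModel n) p).symm z)
        (mfderiv 𝓘(ℝ, Model n) (stModel n) (extChartAt (stModel n) p).symm z e) := by
  have hd : HasFDerivAt (fun z : Model n => z + ((s, 0) : Model n))
      (ContinuousLinearMap.id ℝ (Model n)) z := (hasFDerivAt_id z).add_const _
  have hz' := (add_mem_extChartAt_target (n := n) (p := p) s).2 hz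
  have h1 := mfderiv_comp_apply z (mdifferentiableAt_extChartAt_symm p hz')
    hd.hasMFDerivAt.mdifferentiableAt e
  have h2 := mfderiv_comp_apply z (mdifferentiableAt_shift s _)
    (mdifferentiableAt_extChartAt_symm p hz) e
  have h3 : (extChartAt (stModel n) p).symm ∘ (fun z : Model n => z + ((s, 0) : Model n)) =
      shift s ∘ (extChartAt (stModel n) p).symm := by
    funext z; exact extChartAt_symm_add p s z
  rw [h3] at h1
  rw [hd.hasMFDerivAt.mfderiv] at h1
  exact h1.symm.trans h2

theorem Stationary.gram_add (hg : g.Stationary) (p : ℝ × S) (s : ℝ) {z : Model n}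
    (hz : z ∈ (extChartAt (stModel n) p).target) : g.gram p (z + (s, 0)) = g.gram p z := by
  ext i j
  simp only [gram]
  refine Eq.trans ?_ (hg s _ _ _)
  refine (val_congr (extChartAt_symm_add p s z) _ _).trans ?_
  exact congrArg₂ (fun v w : Model n => g.val (shift s ((extChartAt (stModel n) p).symm z)) v w)
    (mfderiv_extChartAt_symm_add p s hz _) (mfderiv_extChartAt_symm_add p s hz _)

theorem Stationary.density_add (hg : g.Stationary) (p : ℝ × S) (s : ℝ) {z : Model n}
    (hz : z ∈ (extChartAt (stModel n) p).target) : g.density p (z + (s, 0)) = g.density p z := by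
  rw [density, density, hg.gram_add p s hz]

theorem gram_shift (p : ℝ × S) (s : ℝ) : g.gram (shift s p) = g.gram p := by
  funext z
  exact congrArg (fun φ : PartialEquiv (ℝ × S) (Model n) =>
    (fun i j : Option (Fin n) => g.val (φ.symm z)
      (mfderiv 𝓘(ℝ, Model n) (stModel n) φ.symm z (stdBasis n i))
      (mfderiv 𝓘(ℝ, Model n) (stModel n) φ.symm z (stdBasis n j)))) (extChartAt_shift s p)

theorem density_shift (p : ℝ × S) (s : ℝ) : g.density (shift s p) = g.density p := by
  funext z; rw [density, density, gram_shift]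

theorem contDiffAt_comp_extChartAt_symm {f : ℝ × S → ℂ} (hf : ContMDiff (stModel n) 𝓘(ℝ, ℂ) ∞ f)
    (p : ℝ × S) {z : Model n} (hz : z ∈ (extChartAt (stModel n) p).target) :
    ContDiffAt ℝ ∞ (f ∘ (extChartAt (stModel n) p).symm) z :=
  contMDiffAt_iff_contDiffAt.1 (hf.contMDiffAt.comp z ((contMDiffOn_extChartAt_symm p).contMDiffAt
    ((isOpen_extChartAt_target p).mem_nhds hz)))

/-- Smoothness is needed because `fderiv` takes a default value at points of non-differentiability.
Additivity serves the uniqueness argument for `G_r`. -/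
theorem kleinGordon_sub (m : ℝ) {f h : ℝ × S → ℂ} (hf : ContMDiff (stModel n) 𝓘(ℝ, ℂ) ∞ f)
    (hh : ContMDiff (stModel n) 𝓘(ℝ, ℂ) ∞ h) (p : ℝ × S) :
    g.kleinGordon m (fun q => f q - h q) p = g.kleinGordon m f p - g.kleinGordon m h p := by
  have hp : extChartAt (stModel n) p p ∈ (extChartAt (stModel n) p).target :=
    mem_extChartAt_target p
  have hd : ∀ {f : ℝ × S → ℂ}, ContMDiff (stModel n) 𝓘(ℝ, ℂ) ∞ f → ∀ i j,
      DifferentiableAt ℝ (fun z => (g.density p z * (g.gram p z)⁻¹ i j) •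
        fderiv ℝ (f ∘ (extChartAt (stModel n) p).symm) z (stdBasis n j))
        (extChartAt (stModel n) p p) := by
    intro f hf i j
    have h1 := (g.contDiffAt_density p hp).mul (g.contDiffAt_inv_gram p i j hp)
    have h2 : ContDiffAt ℝ ∞ (fun z => fderiv ℝ (f ∘ (extChartAt (stModel n) p).symm) z
        (stdBasis n j)) (extChartAt (stModel n) p p) :=
      ((contDiffAt_comp_extChartAt_symm hf p hp).fderiv_right (m := ∞) (by simp)).clm_apply
        contDiffAt_const
    exact (h1.smul h2).differentiableAt (by simp)
  have hb : g.box (fun q => f q - h q) p = g.box f p - g.box h p := by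
    simp only [box]
    rw [← smul_sub, ← Finset.sum_sub_distrib]
    congr 1
    refine Finset.sum_congr rfl fun i _ => ?_
    rw [← Finset.sum_sub_distrib]
    refine Finset.sum_congr rfl fun j _ => ?_
    rw [← sub_apply, ← fderiv_fun_sub (hd hf i j) (hd hh i j)]
    congr 1
    refine Filter.EventuallyEq.fderiv_eq ?_
    filter_upwards [(isOpen_extChartAt_target p).mem_nhds hp] with z hz
    rw [← smul_sub, ← sub_apply, ← fderiv_sub
      ((contDiffAt_comp_extChartAt_symm hf p hz).differentiableAt (by simp))
      ((contDiffAt_comp_extChartAt_symm hh p hz).differentiableAt (by simp))]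
    rfl
  rw [kleinGordon, kleinGordon, kleinGordon, hb]
  ring

theorem Stationary.kleinGordon_comp_shift (hg : g.Stationary) (m s : ℝ) (f : ℝ × S → ℂ)
    (p : ℝ × S) :
    g.kleinGordon m (fun q => f (shift s q)) p = g.kleinGordon m f (shift s p) := by
  have hp : extChartAt (stModel n) p p ∈ (extChartAt (stModel n) p).target :=
    mem_extChartAt_target p
  rw [kleinGordon, kleinGordon]
  congr 1
  simp only [box, gram_shift, density_shift, extChartAt_shift]
  rw [extChartAt_apply_shift, hg.density_add p s hp]
  congr 1
  refine Finset.sum_congr rfl fun i _ => Finset.sum_congr rfl fun j _ => ?_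
  rw [← fderiv_comp_add_right]
  congr 1
  refine Filter.EventuallyEq.fderiv_eq ?_
  filter_upwards [(isOpen_extChartAt_target p).mem_nhds hp] with z hz
  rw [hg.density_add p s hz, hg.gram_add p s hz, ← fderiv_comp_add_right]
  congr 2
  congr 1
  funext w
  simp only [Function.comp_apply, extChartAt_symm_add]

theorem Stationary.causalLE_shift (hg : g.Stationary) (s : ℝ) {p q : ℝ × S}
    (h : g.CausalLE p q) : g.CausalLE (shift s p) (shift s q) := by
  rcases h with rfl | ⟨c, hc, h0, h1, hcaus⟩
  · exact Or.inl rfl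
  refine Or.inr ⟨shift s ∘ c, (contMDiff_shift s).comp hc, by simp [h0], by simp [h1], ?_⟩
  intro u hu
  obtain ⟨h2, h3⟩ := hcaus u hu
  have hd := mfderiv_comp_apply u (mdifferentiableAt_shift s (c u))
    (hc.mdifferentiableAt (x := u) (by simp)) (1 : ℝ)
  rw [hd]
  refine ⟨?_, ?_⟩
  · have := hg s (c u) (mfderiv 𝓘(ℝ, ℝ) (stModel n) c u (1 : ℝ))
      (mfderiv 𝓘(ℝ, ℝ) (stModel n) c u (1 : ℝ))
    exact h2.trans_eq this.symm
  · refine h3.trans_eq ?_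
    -- Translations change the time coordinate by a constant, so they preserve its differential.
    have hdt : ∀ v : TangentSpace (stModel n) (c u),
        dt (shift s (c u)) (mfderiv (stModel n) (stModel n) (shift s) (c u) v) = dt (c u) v := by
      intro v
      have h4 := mfderiv_comp_apply (c u) (g := (Prod.fst : ℝ × S → ℝ)) (I'' := 𝓘(ℝ, ℝ))
        mdifferentiableAt_fst (mdifferentiableAt_shift s (c u)) v
      have h5 : HasFDerivAt (fun t : ℝ => t + s) (ContinuousLinearMap.id ℝ ℝ) (c u).1 :=
        (hasFDerivAt_id _).add_const _
      have h6 := mfderiv_comp_apply (c u) (f := (Prod.fst : ℝ × S → ℝ)) (I := stModel n)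
        h5.hasMFDerivAt.mdifferentiableAt mdifferentiableAt_fst v
      rw [h5.hasMFDerivAt.mfderiv] at h6
      exact h4.symm.trans h6
    exact (hdt _).symm

/-! ### The canonical volume: local finiteness, positivity on open sets, invariance -/

section Volume

variable [SecondCountableTopology S] [MeasurableSpace S] [BorelSpace S]
  {μ : Measure (ℝ × S)}

theorem IsVolume.isLocallyFiniteMeasure (hμ : g.IsVolume μ) : IsLocallyFiniteMeasure μ := by
  refine ⟨fun p => ?_⟩
  have hp : extChartAt (stModel n) p p ∈ (extChartAt (stModel n) p).target :=
    mem_extChartAt_target p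
  have hc : ContinuousAt (g.density p) (extChartAt (stModel n) p p) :=
    (g.contDiffAt_density p hp).continuousAt
  set C := g.density p (extChartAt (stModel n) p p) + 1
  have h1 : ∀ᶠ z in 𝓝 (extChartAt (stModel n) p p),
      g.density p z < C ∧ z ∈ Metric.ball (extChartAt (stModel n) p p) 1 :=
    (hc.eventually_lt continuousAt_const (by simp [C])).and (Metric.ball_mem_nhds _ one_pos)
  obtain ⟨V, hV, hVo, hpV⟩ := eventually_nhds_iff.1 h1
  have hU : IsOpen ((extChartAt (stModel n) p).source ∩ extChartAt (stModel n) p ⁻¹' V) :=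
    (continuousOn_extChartAt p).isOpen_inter_preimage (isOpen_extChartAt_source p) hVo
  refine ⟨_, hU.mem_nhds ⟨mem_extChartAt_source p, hpV⟩, ?_⟩
  rw [hμ p _ hU.measurableSet inter_subset_left]
  have hsub : extChartAt (stModel n) p '' ((extChartAt (stModel n) p).source ∩
      extChartAt (stModel n) p ⁻¹' V) ⊆ V := by
    rintro _ ⟨q, hq, rfl⟩; exact hq.2
  calc ∫⁻ z in extChartAt (stModel n) p '' ((extChartAt (stModel n) p).source ∩
        extChartAt (stModel n) p ⁻¹' V), ENNReal.ofReal (g.density p z)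
      ≤ ∫⁻ z in V, ENNReal.ofReal (g.density p z) := lintegral_mono_set hsub
    _ ≤ ∫⁻ _ in V, ENNReal.ofReal C := setLIntegral_mono measurable_const
        fun z hz => ENNReal.ofReal_le_ofReal (hV z hz).1.le
    _ = ENNReal.ofReal C * volume V := setLIntegral_const _ _
    _ < ⊤ := ENNReal.mul_lt_top ENNReal.ofReal_lt_top
        ((measure_mono fun z hz => (hV z hz).2).trans_lt measure_ball_lt_top)

theorem IsVolume.isOpenPosMeasure (hμ : g.IsVolume μ) : μ.IsOpenPosMeasure := by
  refine ⟨fun U hU ⟨p, hp⟩ h0 => ?_⟩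
  have hUs : IsOpen (U ∩ (extChartAt (stModel n) p).source) :=
    hU.inter (isOpen_extChartAt_source p)
  have h1 : μ (U ∩ (extChartAt (stModel n) p).source) = 0 :=
    measure_mono_null inter_subset_left h0
  rw [hμ p _ hUs.measurableSet inter_subset_right] at h1
  have hnhds : extChartAt (stModel n) p '' (U ∩ (extChartAt (stModel n) p).source) ∈
      𝓝 (extChartAt (stModel n) p p) := by
    have := extChartAt_image_nhds_mem_nhds_of_boundaryless (I := stModel n) (x := p)
      (hUs.mem_nhds ⟨hp, mem_extChartAt_source p⟩)
    exact this
  obtain ⟨V, hVs, hVo, hpV⟩ := mem_nhds_iff.1 hnhds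
  have h2 : ∫⁻ z in V, ENNReal.ofReal (g.density p z) = 0 :=
    le_antisymm ((lintegral_mono_set hVs).trans_eq h1) bot_le
  have hVt : V ⊆ (extChartAt (stModel n) p).target := by
    intro z hz
    obtain ⟨q, hq, rfl⟩ := hVs hz
    exact (extChartAt (stModel n) p).map_source hq.2
  have hm : AEMeasurable (fun z => ENNReal.ofReal (g.density p z)) (volume.restrict V) := by
    refine (ContinuousOn.aemeasurable ?_ hVo.measurableSet).ennreal_ofReal
    exact fun z hz => (g.contDiffAt_density p (hVt hz)).continuousAt.continuousWithinAt
  rw [lintegral_eq_zero_iff' hm] at h2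
  have h3 : ∀ᵐ z ∂(volume.restrict V), False := by
    filter_upwards [h2, ae_restrict_mem hVo.measurableSet] with z hz hzV
    exact (ENNReal.ofReal_pos.2 (g.density_pos p (hVt hzV))).ne' hz
  have h4 : volume V = 0 := by
    rw [ae_iff] at h3
    simpa using h3
  exact hVo.measure_ne_zero volume ⟨_, hpV⟩ h4

omit [IsManifold 𝓘(ℝ, EuclideanSpace ℝ (Fin n)) ∞ S] in
theorem measurableSet_image_extChartAt (p : ℝ × S) {B : Set (ℝ × S)} (hB : MeasurableSet B)
    (hBs : B ⊆ (extChartAt (stModel n) p).source) :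
    MeasurableSet (extChartAt (stModel n) p '' B) := by
  have h1 : extChartAt (stModel n) p '' B =
      (extChartAt (stModel n) p).target ∩ (extChartAt (stModel n) p).symm ⁻¹' B := by
    exact (extChartAt (stModel n) p).image_eq_target_inter_inv_preimage hBs
  rw [h1]
  have h2 : Measurable ((extChartAt (stModel n) p).target.domRestrict
      (extChartAt (stModel n) p).symm) :=
    (continuousOn_iff_continuous_domRestrict.1 (continuousOn_extChartAt_symm p)).measurable
  have h3 := MeasurableSet.subtype_image (isOpen_extChartAt_target p).measurableSet (h2 hB)
  convert h3 using 1
  ext z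
  exact ⟨fun h => ⟨⟨z, h.1⟩, h.2, rfl⟩, by rintro ⟨w, hw, rfl⟩; exact ⟨w.2, hw⟩⟩

/-- Countably many chart domains cover the space, and each of them is invariant under translations.
In a chart the claim is the invariance of Lebesgue measure and of the density. -/
theorem IsVolume.measurePreserving_shift (hμ : g.IsVolume μ) (hg : g.Stationary) (s : ℝ) :
    MeasurePreserving (shift s) μ μ := by
  have hm : Measurable (shift s : ℝ × S → ℝ × S) := (continuous_shift s).measurable
  refine ⟨hm, ?_⟩
  obtain ⟨t, htc, ht⟩ := TopologicalSpace.countable_cover_nhds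
    (f := fun p : ℝ × S => (extChartAt (stModel n) p).source) fun p => extChartAt_source_mem_nhds p
  refine Measure.ext_of_biUnion_eq_univ htc ht fun p _ => ?_
  ext B hB
  have hs := (isOpen_extChartAt_source (I := stModel n) p).measurableSet
  rw [Measure.restrict_apply hB, Measure.restrict_apply hB, Measure.map_apply hm (hB.inter hs)]
  generalize hC : B ∩ (extChartAt (stModel n) p).source = C
  have hCm : MeasurableSet C := hC ▸ hB.inter hs
  have hCs : C ⊆ (extChartAt (stModel n) p).source := hC ▸ inter_subset_right
  have hC' : shift s ⁻¹' C ⊆ (extChartAt (stModel n) p).source := fun q hq =>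
    (shift_mem_extChartAt_source s).1 (hCs hq)
  rw [hμ p _ (hm hCm) hC', hμ p _ hCm hCs]
  have him : extChartAt (stModel n) p '' C =
      (fun z : Model n => z + ((s, 0) : Model n)) ''
        (extChartAt (stModel n) p '' (shift s ⁻¹' C)) := by
    rw [image_image]
    simp only [← extChartAt_apply_shift]
    rw [← image_image (extChartAt (stModel n) p) (shift s),
      image_preimage_eq C (f := shift s) (shiftHomeo S s).surjective]
  have : (volume : Measure (Model n)).IsAddRightInvariant := by
    have : ((volume : Measure ℝ).prod
      (volume : Measure (EuclideanSpace ℝ (Fin n)))).IsAddLeftInvariant := inferInstance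
    have : (volume : Measure (Model n)).IsAddLeftInvariant := this
    infer_instance
  rw [him, ← MeasurePreserving.setLIntegral_comp_emb
    (measurePreserving_add_right (volume : Measure (Model n)) ((s, 0) : Model n))
    (measurableEmbedding_addRight _)]
  refine setLIntegral_congr_fun (measurableSet_image_extChartAt p (hm hCm) hC') ?_
  rintro _ ⟨q, hq, rfl⟩
  simp only
  exact congrArg _ (hg.density_add p s ((extChartAt (stModel n) p).map_source (hC' hq))).symm

end Volume

end LorentzMetric

end Shift

/-! ### The fundamental functions -/

section Fundamental

variable {n : ℕ} {S : Type*} [TopologicalSpace S] [T2Space S] [SecondCountableTopology S]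
  [ChartedSpace (EuclideanSpace ℝ (Fin n)) S]

theorem locallyCompactSpace_spaceTime (n : ℕ) (S : Type*) [TopologicalSpace S]
    [ChartedSpace (EuclideanSpace ℝ (Fin n)) S] : LocallyCompactSpace (ℝ × S) := by
  have : LocallyCompactSpace S := ChartedSpace.locallyCompactSpace (EuclideanSpace ℝ (Fin n)) S
  infer_instance

theorem sigmaCompactSpace_spaceTime (n : ℕ) (S : Type*) [TopologicalSpace S]
    [SecondCountableTopology S] [ChartedSpace (EuclideanSpace ℝ (Fin n)) S] :
    SigmaCompactSpace (ℝ × S) := by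
  have := locallyCompactSpace_spaceTime n S
  infer_instance

theorem metrizableSpace_spaceTime (n : ℕ) (S : Type*) [TopologicalSpace S] [T2Space S]
    [SecondCountableTopology S] [ChartedSpace (EuclideanSpace ℝ (Fin n)) S] :
    TopologicalSpace.MetrizableSpace (ℝ × S) := by
  have := locallyCompactSpace_spaceTime n S
  infer_instance

omit [T2Space S] [SecondCountableTopology S] in
@[simp] theorem Test.conj_conj (f : Test n S) : Test.conj (Test.conj f) = f := by
  apply Subtype.ext; funext p; simp [Test.conj]

omit [T2Space S] [SecondCountableTopology S] in
theorem Test.conj_add (f h : Test n S) : Test.conj (f + h) = Test.conj f + Test.conj h := by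
  apply Subtype.ext; funext p; simp [Test.conj]

omit [T2Space S] [SecondCountableTopology S] in
theorem Test.conj_smul (c : ℂ) (f : Test n S) : Test.conj (c • f) = conj c • Test.conj f := by
  apply Subtype.ext; funext p; simp [Test.conj]

omit [T2Space S] [SecondCountableTopology S] in
theorem Test.conj_translate (s : ℝ) (f : Test n S) :
    Test.conj (Test.translate s f) = Test.translate s (Test.conj f) := rfl

omit [T2Space S] [SecondCountableTopology S] in
theorem Test.translate_translate (s t : ℝ) (f : Test n S) :
    Test.translate s (Test.translate t f) = Test.translate (t + s) f := by
  apply Subtype.ext; funext p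
  change f.1 (shift (-t) (shift (-s) p)) = f.1 (shift (-(t + s)) p)
  rw [shift_shift, neg_add_rev]

omit [T2Space S] [SecondCountableTopology S] in
@[simp] theorem Test.translate_zero (f : Test n S) : Test.translate 0 f = f := by
  apply Subtype.ext; funext p
  simp [Test.translate]

omit [T2Space S] [SecondCountableTopology S] in
theorem Test.translate_apply (s : ℝ) (f : Test n S) (p : ℝ × S) :
    (Test.translate s f).1 p = f.1 (shift (-s) p) := rfl

omit [T2Space S] [SecondCountableTopology S] in
theorem Test.conj_apply (f : Test n S) (p : ℝ × S) : (Test.conj f).1 p = conj (f.1 p) := rfl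

omit [T2Space S] [SecondCountableTopology S] in
theorem Test.continuous (f : Test n S) : Continuous f.1 := f.2.1.continuous

omit [T2Space S] [SecondCountableTopology S] in
theorem Test.tsupport_translate (s : ℝ) (f : Test n S) :
    tsupport (Test.translate s f).1 = shift (-s) ⁻¹' tsupport f.1 :=
  tsupport_comp_eq_preimage f.1 (shiftHomeo S (-s))

variable [IsManifold 𝓘(ℝ, EuclideanSpace ℝ (Fin n)) ∞ S] [MeasurableSpace S] [BorelSpace S]

/-- The bidistribution determines `D⁺(f, ·)` only almost everywhere; this lemma turns identities for
`Dplus` into identities for `dplus`. -/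
theorem ae_eq_zero_of_integral_test {μ : Measure (ℝ × S)} {F : ℝ × S → ℂ}
    (hF : LocallyIntegrable F μ) (h : ∀ h : Test n S, ∫ y, F y * h.1 y ∂μ = 0) : F =ᵐ[μ] 0 := by
  have := sigmaCompactSpace_spaceTime n S
  refine ae_eq_zero_of_integral_contMDiff_smul_eq_zero (stModel n) hF fun g hg hc => ?_
  have hs : ContMDiff (stModel n) 𝓘(ℝ, ℂ) ∞ fun p => (g p : ℂ) :=
    (Complex.ofRealCLM.contDiff (n := ∞)).contMDiff.comp hg
  have := h ⟨fun p => (g p : ℂ), hs, hc.comp_left (g := fun x : ℝ => (x : ℂ)) Complex.ofReal_zero⟩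
  rw [← this]
  refine integral_congr_ae (Eventually.of_forall fun y => ?_)
  simp only [Complex.real_smul, mul_comm]

omit [SecondCountableTopology S] [IsManifold 𝓘(ℝ, EuclideanSpace ℝ (Fin n)) ∞ S] in
theorem integrable_mul_test [SecondCountableTopology S] {μ : Measure (ℝ × S)} {F : ℝ × S → ℂ}
    (hF : LocallyIntegrable F μ) (h : Test n S) : Integrable (fun y => F y * h.1 y) μ := by
  refine (hF.integrable_smul_left_of_hasCompactSupport h.continuous h.2.2).congr
    (Eventually.of_forall fun y => ?_)
  simp only [smul_eq_mul, mul_comm]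

theorem ae_eq_of_integral_test {μ : Measure (ℝ × S)} {F G : ℝ × S → ℂ}
    (hF : LocallyIntegrable F μ) (hG : LocallyIntegrable G μ)
    (h : ∀ h : Test n S, ∫ y, F y * h.1 y ∂μ = ∫ y, G y * h.1 y ∂μ) : F =ᵐ[μ] G := by
  have := ae_eq_zero_of_integral_test (n := n) (hF.sub hG) fun k => by
    simp only [Pi.sub_apply, sub_mul]
    rw [integral_sub (integrable_mul_test hF k) (integrable_mul_test hG k), h k, sub_self]
  filter_upwards [this] with y hy
  exact sub_eq_zero.1 hy

namespace FieldData

omit [T2Space S] [SecondCountableTopology S] [BorelSpace S] in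
theorem dplus_conj (A : FieldData n S) (f : Test n S) (y : ℝ × S) :
    A.dplus (Test.conj f) y = conj (A.dminus f y) := by
  simp [dminus]

omit [T2Space S] [SecondCountableTopology S] [BorelSpace S] in
theorem dminus_conj (A : FieldData n S) (f : Test n S) (y : ℝ × S) :
    A.dminus (Test.conj f) y = conj (A.dplus f y) := by
  simp [dminus]

namespace Admissible

variable {A : FieldData n S} (hA : A.Admissible)
include hA

omit [T2Space S] in
theorem isLocallyFiniteMeasure : IsLocallyFiniteMeasure A.vol :=
  hA.isVolume.isLocallyFiniteMeasure

omit [T2Space S] in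
theorem isOpenPosMeasure : A.vol.IsOpenPosMeasure := hA.isVolume.isOpenPosMeasure

omit [T2Space S] in
theorem measurePreserving_shift (hs : A.g.Stationary) (s : ℝ) :
    MeasurePreserving (shift s) A.vol A.vol := hA.isVolume.measurePreserving_shift hs s

omit [T2Space S] in
theorem locallyIntegrable_comp_shift {F : ℝ × S → ℂ} (hF : LocallyIntegrable F A.vol)
    (hs : A.g.Stationary) (s : ℝ) : LocallyIntegrable (fun y => F (shift s y)) A.vol := by
  intro p
  obtain ⟨U, hU, hUi⟩ := hF (shift s p)
  refine ⟨shift s ⁻¹' U, (continuous_shift s).continuousAt hU, ?_⟩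
  exact ((hA.measurePreserving_shift hs s).integrableOn_comp_preimage
    (shiftHomeo S s).measurableEmbedding).2 hUi

omit [T2Space S] [SecondCountableTopology S] [BorelSpace S] in
theorem measurable_dminus (f : Test n S) : Measurable (A.dminus f) :=
  Complex.continuous_conj.measurable.comp (hA.measurable (Test.conj f))

omit [T2Space S] [SecondCountableTopology S] [BorelSpace S] in
theorem locallyIntegrable_dminus (f : Test n S) : LocallyIntegrable (A.dminus f) A.vol := by
  intro p
  obtain ⟨U, hU, hUi⟩ := hA.locallyIntegrable (Test.conj f) p
  refine ⟨U, hU, ?_⟩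
  exact (Complex.conjCLE.toContinuousLinearMap.integrable_comp hUi)

omit [T2Space S] [SecondCountableTopology S] [BorelSpace S] in
theorem integral_dminus (f h : Test n S) : ∫ y, A.dminus f y * h.1 y ∂A.vol = A.Dplus h f := by
  rw [hA.hermitian f h, hA.represents, ← integral_conj]
  refine integral_congr_ae (Eventually.of_forall fun y => ?_)
  simp [dminus, Test.conj]

theorem dplus_add (f h : Test n S) : A.dplus (f + h) =ᵐ[A.vol] A.dplus f + A.dplus h := by
  refine ae_eq_of_integral_test (n := n) (hA.locallyIntegrable _)
    ((hA.locallyIntegrable f).add (hA.locallyIntegrable h)) fun k => ?_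
  simp only [Pi.add_apply, add_mul]
  rw [integral_add (integrable_mul_test (hA.locallyIntegrable f) k)
    (integrable_mul_test (hA.locallyIntegrable h) k), ← hA.represents, ← hA.represents,
    ← hA.represents, map_add, LinearMap.add_apply]

theorem dplus_smul (c : ℂ) (f : Test n S) : A.dplus (c • f) =ᵐ[A.vol] c • A.dplus f := by
  refine ae_eq_of_integral_test (n := n) (hA.locallyIntegrable _)
    ((hA.locallyIntegrable f).smul c) fun k => ?_
  simp only [Pi.smul_apply, smul_eq_mul, mul_assoc]
  rw [integral_const_mul, ← hA.represents, ← hA.represents, map_smul, LinearMap.smul_apply,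
    smul_eq_mul]

theorem dminus_add (f h : Test n S) : A.dminus (f + h) =ᵐ[A.vol] A.dminus f + A.dminus h := by
  filter_upwards [hA.dplus_add (Test.conj f) (Test.conj h)] with y hy
  simp only [dminus, Pi.add_apply] at hy ⊢
  rw [Test.conj_add, hy, map_add]

theorem dminus_smul (c : ℂ) (f : Test n S) : A.dminus (c • f) =ᵐ[A.vol] c • A.dminus f := by
  filter_upwards [hA.dplus_smul (conj c) (Test.conj f)] with y hy
  simp only [dminus, Pi.smul_apply, smul_eq_mul] at hy ⊢
  rw [Test.conj_smul, hy, map_mul, Complex.conj_conj]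

theorem dplus_translate (hinv : A.TimeInvariant) (hs : A.g.Stationary) (s : ℝ) (f : Test n S) :
    A.dplus (Test.translate s f) =ᵐ[A.vol] fun y => A.dplus f (shift (-s) y) := by
  refine ae_eq_of_integral_test (n := n) (hA.locallyIntegrable _)
    (hA.locallyIntegrable_comp_shift (hA.locallyIntegrable f) hs (-s)) fun k => ?_
  rw [← hA.represents]
  have h1 : k = Test.translate s (Test.translate (-s) k) := by
    rw [Test.translate_translate]; simp
  conv_lhs => rw [h1]
  rw [hinv, hA.represents, ← (hA.measurePreserving_shift hs (-s)).integral_comp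
    (shiftHomeo S (-s)).measurableEmbedding]
  simp only [Test.translate_apply, shift_shift]
  simp

theorem dminus_translate (hinv : A.TimeInvariant) (hs : A.g.Stationary) (s : ℝ) (f : Test n S) :
    A.dminus (Test.translate s f) =ᵐ[A.vol] fun y => A.dminus f (shift (-s) y) := by
  filter_upwards [hA.dplus_translate hinv hs s (Test.conj f)] with y hy
  simp only [dminus, Test.conj_translate, hy]

theorem dplus_kleinGordon {f f' : Test n S} (h : ∀ p, f'.1 p = A.g.kleinGordon A.m f.1 p) :
    A.dplus f' =ᵐ[A.vol] 0 :=
  ae_eq_zero_of_integral_test (n := n) (hA.locallyIntegrable _) fun k => by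
    rw [← hA.represents, hA.kleinGordon_left f f' k h]

theorem dminus_kleinGordon {f f' : Test n S} (h : ∀ p, f'.1 p = A.g.kleinGordon A.m f.1 p) :
    A.dminus f' =ᵐ[A.vol] 0 :=
  ae_eq_zero_of_integral_test (n := n) (hA.locallyIntegrable_dminus _) fun k => by
    rw [hA.integral_dminus, hA.kleinGordon_right f f' k h]

omit [T2Space S] [SecondCountableTopology S] [BorelSpace S] in
theorem commutator_kleinGordon {f f' : Test n S} (h : ∀ p, f'.1 p = A.g.kleinGordon A.m f.1 p)
    (y : ℝ × S) : A.commutator f' y = 0 := by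
  rw [commutator, hA.retarded.apply_kleinGordon f f' h, hA.advanced.apply_kleinGordon f f' h,
    sub_self]

omit [T2Space S] [SecondCountableTopology S] [BorelSpace S] in
theorem continuous_commutator (f : Test n S) : Continuous (A.commutator f) :=
  (hA.retarded.smooth f).continuous.sub (hA.advanced.smooth f).continuous

/-- The condition `Im D⁺ = D` at the level of functions. It makes vertex sums of out-fields
telescope. -/
theorem two_I_mul_commutator (f : Test n S) :
    (fun y => 2 * Complex.I * A.commutator f y) =ᵐ[A.vol]
      fun y => A.dplus f y - A.dminus f y := by
  have := hA.isLocallyFiniteMeasure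
  have := locallyCompactSpace_spaceTime n S
  refine ae_eq_of_integral_test (n := n)
    (continuous_const.mul (hA.continuous_commutator f)).locallyIntegrable
    ((hA.locallyIntegrable f).sub (hA.locallyIntegrable_dminus f)) fun k => ?_
  simp only [sub_mul]
  rw [integral_sub (integrable_mul_test (hA.locallyIntegrable f) k)
    (integrable_mul_test (hA.locallyIntegrable_dminus f) k), ← hA.represents, hA.integral_dminus,
    hA.hermitian f k, hA.im_eq, D, ← integral_const_mul]
  simp only [mul_assoc]

omit [T2Space S] [SecondCountableTopology S] [BorelSpace S] in
theorem two_I_mul_D (f h : Test n S) :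
    2 * Complex.I * A.D f h = A.Dplus f h - A.Dplus h f := by
  rw [hA.hermitian f h, hA.im_eq]

/-- The invariance is inherited from `D⁺` almost everywhere. It extends to every point because both
sides are continuous and the volume charges nonempty open sets. -/
theorem commutator_translate (hinv : A.TimeInvariant) (hs : A.g.Stationary) (s : ℝ)
    (f : Test n S) (y : ℝ × S) :
    A.commutator (Test.translate s f) y = A.commutator f (shift (-s) y) := by
  have := hA.isOpenPosMeasure
  have hq := (hA.measurePreserving_shift hs (-s)).quasiMeasurePreserving
  refine congrFun (Continuous.ae_eq_iff_eq A.vol (hA.continuous_commutator _)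
    (g := fun y => A.commutator f (shift (-s) y))
    ((hA.continuous_commutator f).comp (continuous_shift _)) |>.1 ?_) y
  filter_upwards [hA.two_I_mul_commutator (Test.translate s f),
    hq.ae (hA.two_I_mul_commutator f), hA.dplus_translate hinv hs s f,
    hA.dminus_translate hinv hs s f] with y h1 h2 h3 h4
  rw [h3, h4, ← h2] at h1
  exact mul_left_cancel₀ (mul_ne_zero two_ne_zero Complex.I_ne_zero) h1

/-- The difference `w` of both sides solves the homogeneous equation and is supported in the past.
By invariance of `D` it equals the corresponding difference for `G_a`, so it is also supported in
the future. Its support is therefore compact, and `G_r` recovers `w` from its source, which is zero.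
-/
theorem Gr_translate (hinv : A.TimeInvariant) (hs : A.g.Stationary) (s : ℝ) (f : Test n S)
    (y : ℝ × S) : A.Gr (Test.translate s f) y = A.Gr f (shift (-s) y) := by
  set K := tsupport (Test.translate s f).1
  have hsm : ∀ {F : ℝ × S → ℂ}, ContMDiff (stModel n) 𝓘(ℝ, ℂ) ∞ F →
      ContMDiff (stModel n) 𝓘(ℝ, ℂ) ∞ fun y => F (shift (-s) y) := fun hF =>
    hF.comp (contMDiff_shift (-s))
  set w : ℝ × S → ℂ := fun y => A.Gr (Test.translate s f) y - A.Gr f (shift (-s) y) with hw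
  -- Here the invariance of `D = G_r - G_a` transfers the difference from `G_r` to `G_a`.
  have hw' : w = fun y => A.Ga (Test.translate s f) y - A.Ga f (shift (-s) y) := by
    funext y
    have := hA.commutator_translate hinv hs s f y
    simp only [commutator] at this
    simp only [hw]
    linear_combination this
  have hsub : ∀ (J : Set (ℝ × S) → Set (ℝ × S)) (G : Test n S →ₗ[ℂ] (ℝ × S → ℂ)),
      A.g.IsGreen A.m J G → (∀ q ∈ J (tsupport f.1), shift s q ∈ J K) →
      tsupport (fun y => G (Test.translate s f) y - G f (shift (-s) y)) ⊆ J K := by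
    intro J G hG hJ
    refine (tsupport_sub _ _).trans (union_subset (hG.support _) ?_)
    have h1 : tsupport (fun y => G f (shift (-s) y)) = shift (-s) ⁻¹' tsupport (G f) :=
      tsupport_comp_eq_preimage (G f) (shiftHomeo S (-s))
    rw [h1]
    intro q hq
    have := hJ _ (hG.support f hq)
    rwa [shift_shift_neg] at this
  have hK : ∀ q ∈ tsupport f.1, shift s q ∈ K := by
    intro q hq
    simp only [K, Test.tsupport_translate, mem_preimage, shift_neg_shift, hq]
  have hp : tsupport w ⊆ A.g.past K := hsub _ _ hA.retarded fun q ⟨p, hp, hc⟩ =>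
    ⟨shift s p, hK p hp, hs.causalLE_shift s hc⟩
  have hf : tsupport w ⊆ A.g.future K := hw' ▸ hsub _ _ hA.advanced fun q ⟨p, hp, hc⟩ =>
    ⟨shift s p, hK p hp, hs.causalLE_shift s hc⟩
  have hcK : IsCompact K := (Test.translate s f).2.2
  have hwc : HasCompactSupport w := (hA.globallyHyperbolic.compact_diamonds K K hcK hcK).of_isClosed_subset
    (isClosed_tsupport w) (subset_inter hf hp)
  have hws : ContMDiff (stModel n) 𝓘(ℝ, ℂ) ∞ w :=
    (hA.retarded.smooth _).sub (hsm (hA.retarded.smooth f))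
  have hkg : ∀ p, (0 : Test n S).1 p = A.g.kleinGordon A.m w p := by
    intro p
    rw [hw, LorentzMetric.kleinGordon_sub A.m (hA.retarded.smooth _) (hsm (hA.retarded.smooth f)),
      hs.kleinGordon_comp_shift, hA.retarded.kleinGordon_apply, hA.retarded.kleinGordon_apply]
    simp [Test.translate_apply]
  have := hA.retarded.apply_kleinGordon ⟨w, hws, hwc⟩ 0 hkg
  rw [map_zero] at this
  exact sub_eq_zero.1 (congrFun this y).symm

omit [T2Space S] [SecondCountableTopology S] [BorelSpace S] in
theorem commutator_conj (f : Test n S) (y : ℝ × S) :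
    A.commutator (Test.conj f) y = conj (A.commutator f y) := by
  rw [commutator, commutator, hA.retarded.real, hA.advanced.real, map_sub]

end Admissible

end FieldData

end Fundamental

/-! ### The seminorm of the two-point function and its continuity -/

section Seminorm

theorem continuousAt_integral_mul {X Y : Type*} [TopologicalSpace X] [FirstCountableTopology X]
    [WeaklyLocallyCompactSpace X] [TopologicalSpace Y] [T2Space Y] [SecondCountableTopology Y]
    [MeasurableSpace Y] [BorelSpace Y] {μ : Measure Y} {F : Y → ℂ} (hF : LocallyIntegrable F μ)
    {Φ : X → Y → ℂ} (hΦ : Continuous (Function.uncurry Φ)) {x₀ : X} {K : Set Y} (hK : IsCompact K)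
    (h : ∀ᶠ x in 𝓝 x₀, ∀ y ∉ K, Φ x y = 0) :
    ContinuousAt (fun x => ∫ y, F y * Φ x y ∂μ) x₀ := by
  obtain ⟨U, hU, hUn⟩ := exists_compact_mem_nhds x₀
  obtain ⟨C, hC⟩ := (hU.prod hK).exists_bound_of_continuousOn hΦ.continuousOn
  refine continuousAt_of_dominated (bound := K.indicator fun y => ‖F y‖ * C) ?_ ?_ ?_ ?_
  · refine Eventually.of_forall fun x => ?_
    have : Continuous (Φ x) := hΦ.comp (by fun_prop : Continuous fun y => (x, y))
    exact hF.aestronglyMeasurable.mul this.aestronglyMeasurable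
  · filter_upwards [h, hUn] with x hx hxU
    refine Eventually.of_forall fun y => ?_
    by_cases hy : y ∈ K
    · rw [indicator_of_mem hy, norm_mul]
      exact mul_le_mul_of_nonneg_left (hC (x, y) ⟨hxU, hy⟩) (norm_nonneg _)
    · rw [hx y hy, indicator_of_notMem hy]; simp
  · rw [integrable_indicator_iff hK.measurableSet]
    exact (hF.integrableOn_isCompact hK).norm.mul_const C
  · refine Eventually.of_forall fun y => ?_
    have : Continuous fun x => Φ x y := hΦ.comp (by fun_prop : Continuous fun x => (x, y))
    exact (continuous_const.mul this).continuousAt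

/-- The derivatives of a slice are those of `Φ` restricted along the inclusion of `E`, of norm at
most one. Compactness then bounds them uniformly. -/
theorem exists_bound_iteratedFDeriv_slice {E : Type*} [NormedAddCommGroup E] [NormedSpace ℝ E]
    {U : Set E} (hU : IsOpen U) {Φ : ℝ × E → ℂ} (hΦ : ContDiffOn ℝ ∞ Φ (univ ×ˢ U)) {J : Set ℝ}
    (hJ : IsCompact J) {C : Set E} (hC : IsCompact C) (hCU : C ⊆ U) (N : ℕ) :
    ∃ M : ℝ, ∀ s ∈ J, ∀ z ∈ C, ‖iteratedFDeriv ℝ N (fun z => Φ (s, z)) z‖ ≤ M := by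
  have hO : IsOpen ((univ : Set ℝ) ×ˢ U) := isOpen_univ.prod hU
  have hc : ContinuousOn (iteratedFDeriv ℝ N Φ) (univ ×ˢ U) := by
    refine (hΦ.continuousOn_iteratedFDerivWithin (m := N) (by exact_mod_cast le_top)
      hO.uniqueDiffOn).congr fun w hw => ?_
    rw [iteratedFDerivWithin_of_isOpen N hO hw]
  obtain ⟨M, hM⟩ := (hJ.prod hC).exists_bound_of_continuousOn
    (hc.mono (prod_mono (subset_univ _) hCU))
  refine ⟨M, fun s hs z hz => ?_⟩
  have hsh : ContDiffOn ℝ ∞ (fun w : ℝ × E => Φ (w + (s, 0))) (univ ×ˢ U) :=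
    hΦ.comp (contDiff_id.add contDiff_const).contDiffOn (by
      rintro ⟨t, y⟩ ⟨-, hy⟩; simpa using hy)
  have hpre : (ContinuousLinearMap.inr ℝ ℝ E) ⁻¹' (univ ×ˢ U) = U := by
    ext y; simp
  have h1 := (ContinuousLinearMap.inr ℝ ℝ E).iteratedFDerivWithin_comp_right hsh
    hO.uniqueDiffOn (by rw [hpre]; exact hU.uniqueDiffOn) (x := z) (by simpa using hCU hz)
    (i := N) (by exact_mod_cast le_top)
  rw [hpre, iteratedFDerivWithin_of_isOpen N hU (hCU hz), iteratedFDerivWithin_of_isOpen N hO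
    (by simpa using hCU hz), iteratedFDeriv_comp_add_right] at h1
  have h2 : (fun w : ℝ × E => Φ (w + (s, 0))) ∘ (ContinuousLinearMap.inr ℝ ℝ E) =
      fun z => Φ (s, z) := by
    funext y; simp
  rw [h2] at h1
  rw [h1]
  have h3 : (ContinuousLinearMap.inr ℝ ℝ E) z + (s, 0) = (s, z) := by simp
  rw [h3]
  refine (ContinuousMultilinearMap.norm_compContinuousLinearMap_le _ _).trans ?_
  have hn : ‖ContinuousLinearMap.inr ℝ ℝ E‖ ≤ 1 :=
    ContinuousLinearMap.opNorm_le_bound _ zero_le_one fun y => by simp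
  calc _ ≤ ‖iteratedFDeriv ℝ N Φ (s, z)‖ * 1 := by
        refine mul_le_mul_of_nonneg_left ?_ (norm_nonneg _)
        exact Finset.prod_le_one (fun _ _ => norm_nonneg _) fun _ _ => hn
    _ ≤ M := by rw [mul_one]; exact hM _ ⟨hs, hz⟩

variable {n : ℕ} {S : Type*} [TopologicalSpace S] [ChartedSpace (EuclideanSpace ℝ (Fin n)) S]

/-- A smooth one-parameter family of test functions with supports in a fixed compact set, divided
by a sequence tending to infinity, tends to zero. -/
theorem tendsToZero_of_smooth_family [IsManifold 𝓘(ℝ, EuclideanSpace ℝ (Fin n)) ∞ S]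
    {W : ℝ → Test n S}
    (hW : ContMDiff (𝓘(ℝ, ℝ).prod (stModel n)) 𝓘(ℝ, ℂ) ∞
      fun q : ℝ × (ℝ × S) => (W q.1).1 q.2)
    {J : Set ℝ} (hJ : IsCompact J) {K : Set (ℝ × S)} (hK : IsCompact K)
    (hWK : ∀ s ∈ J, tsupport (W s).1 ⊆ K) {s : ℕ → ℝ} (hs : ∀ j, s j ∈ J) {c : ℕ → ℂ}
    (hc : Tendsto c atTop (𝓝 0)) : TendsToZero fun j => c j • W (s j) := by
  refine ⟨⟨K, hK, fun j => ?_⟩, fun p N C hC hCt => ?_⟩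
  · exact (tsupport_smul_subset_right (fun _ => c j) (W (s j)).1).trans (hWK _ (hs j))
  have hO : IsOpen (extChartAt (stModel n) p).target := isOpen_extChartAt_target p
  have hΦ : ContDiffOn ℝ ∞ (fun w : ℝ × Model n =>
      (W w.1).1 ((extChartAt (stModel n) p).symm w.2))
      (univ ×ˢ (extChartAt (stModel n) p).target) := by
    rw [← contMDiffOn_iff_contDiffOn]
    have h1 : ContMDiffOn 𝓘(ℝ, ℝ × Model n) (𝓘(ℝ, ℝ).prod (stModel n)) ∞
        (fun w : ℝ × Model n => (w.1, (extChartAt (stModel n) p).symm w.2))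
        (univ ×ˢ (extChartAt (stModel n) p).target) := by
      refine ContMDiffOn.prodMk contDiff_fst.contMDiff.contMDiffOn ?_
      exact (contMDiffOn_extChartAt_symm p).comp contDiff_snd.contMDiff.contMDiffOn
        fun w hw => hw.2
    exact hW.comp_contMDiffOn h1
  obtain ⟨M, hM⟩ := exists_bound_iteratedFDeriv_slice hO hΦ hJ hC hCt N
  have hM0 : ∀ j, ∀ z ∈ C, ‖iteratedFDeriv ℝ N
      ((c j • W (s j)).1 ∘ (extChartAt (stModel n) p).symm) z‖ ≤ ‖c j‖ * M := by
    intro j z hz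
    have h1 : (c j • W (s j)).1 ∘ (extChartAt (stModel n) p).symm =
        c j • fun z => (W (s j)).1 ((extChartAt (stModel n) p).symm z) := rfl
    have h2 : ContDiffAt ℝ N (fun z => (W (s j)).1 ((extChartAt (stModel n) p).symm z)) z :=
      (LorentzMetric.contDiffAt_comp_extChartAt_symm (W (s j)).2.1 p (hCt hz)).of_le
        (by exact_mod_cast le_top)
    rw [h1, iteratedFDeriv_const_smul_apply h2, norm_smul]
    exact mul_le_mul_of_nonneg_left (hM _ (hs j) z hz) (norm_nonneg _)
  rw [Metric.tendstoUniformlyOn_iff]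
  intro δ hδ
  have h3 : Tendsto (fun j => ‖c j‖ * M) atTop (𝓝 0) := by
    simpa using hc.norm.mul_const M
  filter_upwards [h3.eventually_lt_const hδ] with j hj z hz
  rw [Pi.zero_apply, dist_zero_left]
  exact (hM0 j z hz).trans_lt hj

namespace FieldData

variable [IsManifold 𝓘(ℝ, EuclideanSpace ℝ (Fin n)) ∞ S] [MeasurableSpace S]

/-- The seminorm `D⁺(f̄, f)^{1/2}`. -/
def seminormPlus (A : FieldData n S) (f : Test n S) : ℝ :=
  Real.sqrt (A.Dplus (Test.conj f) f).re

namespace Admissible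

variable {A : FieldData n S} (hA : A.Admissible)
include hA

/-- Cauchy-Schwarz for the positive semidefinite form `D⁺(f̄, h)`. With time invariance it bounds `t
↦ D⁺(f, h_t)` uniformly, so this function can be paired with Schwartz functions. -/
theorem norm_Dplus_le (f h : Test n S) :
    ‖A.Dplus f h‖ ≤ A.seminormPlus (Test.conj f) * A.seminormPlus h := by
  let core : PreInnerProductSpace.Core ℂ (Test n S) :=
    { inner := fun f h => A.Dplus (Test.conj f) h
      conj_inner_symm := fun f h => by
        have := hA.hermitian h (Test.conj f)
        rw [Test.conj_conj] at this
        exact this.symm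
      re_inner_nonneg := fun f => hA.positive f
      add_left := fun f g h => by
        simp only [Test.conj_add, map_add, LinearMap.add_apply]
      smul_left := fun f h c => by
        simp only [Test.conj_smul, map_smul, LinearMap.smul_apply, smul_eq_mul] }
  have h1 := InnerProductSpace.Core.inner_mul_inner_self_le (c := core) (Test.conj f) h
  have h2 : ‖core.inner h (Test.conj f)‖ = ‖core.inner (Test.conj f) h‖ := by
    rw [← core.conj_inner_symm, RCLike.norm_conj]
  have h3 : core.inner (Test.conj f) h = A.Dplus f h := by
    change A.Dplus _ _ = _
    rw [Test.conj_conj]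
  have h4 : ‖A.Dplus f h‖ * ‖A.Dplus f h‖ ≤
      (A.Dplus (Test.conj (Test.conj f)) (Test.conj f)).re * (A.Dplus (Test.conj h) h).re := by
    rw [← h3]; nth_rewrite 2 [← h2]; exact h1
  rw [seminormPlus, seminormPlus, ← Real.sqrt_mul (hA.positive _)]
  exact Real.le_sqrt_of_sq_le (by rw [sq]; exact h4)

omit hA in
theorem _root_.QFT.FieldData.TimeInvariant.seminormPlus_translate (hinv : A.TimeInvariant) (s : ℝ)
    (f : Test n S) : A.seminormPlus (Test.translate s f) = A.seminormPlus f := by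
  rw [seminormPlus, Test.conj_translate, hinv, seminormPlus]

theorem norm_Dplus_translate_le (hinv : A.TimeInvariant) (f h : Test n S) (t : ℝ) :
    ‖A.Dplus f (Test.translate t h)‖ ≤ A.seminormPlus (Test.conj f) * A.seminormPlus h :=
  (hA.norm_Dplus_le _ _).trans_eq (by rw [hinv.seminormPlus_translate])

/-- If the seminorm were unbounded along the family, dividing by it would give a sequence that tends
to zero in `𝓓` although `D⁺(f̄_j, f_j) = 1`, contradicting the continuity of `D⁺`. -/
theorem exists_bound_seminormPlus {W : ℝ → Test n S}
    (hW : ContMDiff (𝓘(ℝ, ℝ).prod (stModel n)) 𝓘(ℝ, ℂ) ∞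
      fun q : ℝ × (ℝ × S) => (W q.1).1 q.2)
    {J : Set ℝ} (hJ : IsCompact J) {K : Set (ℝ × S)} (hK : IsCompact K)
    (hWK : ∀ s ∈ J, tsupport (W s).1 ⊆ K) : ∃ C, ∀ s ∈ J, A.seminormPlus (W s) ≤ C := by
  by_contra! hcon
  choose s hs hlt using fun j : ℕ => hcon ((j : ℝ) + 1)
  set c : ℕ → ℂ := fun j => ((A.seminormPlus (W (s j)))⁻¹ : ℝ) with hcdef
  have hpos : ∀ j, 0 < A.seminormPlus (W (s j)) := fun j =>
    lt_trans (by positivity) (hlt j)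
  have hc : Tendsto c atTop (𝓝 0) := by
    have h1 : Tendsto (fun j => A.seminormPlus (W (s j))) atTop atTop :=
      tendsto_atTop_mono (fun j => (lt_add_one _).le.trans (hlt j).le) tendsto_natCast_atTop_atTop
    have := (Complex.continuous_ofReal.tendsto 0).comp h1.inv_tendsto_atTop
    rw [Complex.ofReal_zero] at this
    exact this
  have h1 := tendsToZero_of_smooth_family hW hJ hK hWK hs hc
  have hW' : ContMDiff (𝓘(ℝ, ℝ).prod (stModel n)) 𝓘(ℝ, ℂ) ∞
      fun q : ℝ × (ℝ × S) => (Test.conj (W q.1)).1 q.2 :=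
    (Complex.conjCLE.contDiff (n := ∞)).contMDiff.comp hW
  have h2 := tendsToZero_of_smooth_family (W := fun s => Test.conj (W s)) hW' hJ hK (fun s hs' => by
    refine subset_trans ?_ (hWK s hs')
    exact closure_mono fun p hp h0 => hp (by rw [Test.conj_apply, h0, map_zero])) hs hc
  have h3 := hA.distribution _ _ h2 h1
  have h4 : ∀ j, A.Dplus (c j • Test.conj (W (s j))) (c j • W (s j)) = 1 := by
    intro j
    have h5 : A.Dplus (Test.conj (W (s j))) (W (s j)) =
        ((A.seminormPlus (W (s j)) ^ 2 : ℝ) : ℂ) := by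
      rw [seminormPlus, Real.sq_sqrt (hA.positive _)]
      have := hA.hermitian (W (s j)) (Test.conj (W (s j)))
      rw [Test.conj_conj] at this
      exact (Complex.conj_eq_iff_re.1 this.symm).symm
    rw [map_smul, map_smul, LinearMap.smul_apply, h5, hcdef]
    have := (hpos j).ne'
    simp only [smul_eq_mul]
    push_cast
    have : (A.seminormPlus (W (s j)) : ℂ) ≠ 0 := by exact_mod_cast this
    field_simp
  simp only [h4] at h3
  exact one_ne_zero (tendsto_nhds_unique tendsto_const_nhds h3)

theorem continuous_Dplus_translate [T2Space S] [SecondCountableTopology S] [BorelSpace S]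
    (f h : Test n S) : Continuous fun t => A.Dplus f (Test.translate t h) := by
  simp only [hA.represents]
  rw [continuous_iff_continuousAt]
  intro t₀
  have hc : Continuous fun q : ℝ × (ℝ × S) => shift q.1 q.2 := by
    unfold shift; fun_prop
  refine continuousAt_integral_mul (hA.locallyIntegrable f)
    (Φ := fun t y => (Test.translate t h).1 y) ?_
    (K := (fun q : ℝ × (ℝ × S) => shift q.1 q.2) '' (Icc (t₀ - 1) (t₀ + 1) ×ˢ tsupport h.1))
    ((isCompact_Icc.prod h.2.2).image hc) ?_
  · refine h.continuous.comp (hc.comp (f := fun q : ℝ × (ℝ × S) => (-q.1, q.2)) ?_)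
    fun_prop
  · filter_upwards [Icc_mem_nhds (sub_one_lt t₀) (lt_add_one t₀)] with t ht y hy
    rw [Test.translate_apply]
    by_contra h0
    refine hy ⟨(t, shift (-t) y), ⟨ht, subset_tsupport _ h0⟩, ?_⟩
    simp [shift_shift_neg]

end Admissible

end FieldData

end Seminorm

/-! ### The spectral condition for the two-point function -/

section TwoPoint

open FourierTransform

/-- The convolution of Schwartz functions. -/
def schwartzConv (f g : 𝓢(ℝ, ℂ)) : 𝓢(ℝ, ℂ) :=
  SchwartzMap.convolution (ContinuousLinearMap.mul ℂ ℂ) f g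

theorem schwartzConv_apply (f g : 𝓢(ℝ, ℂ)) (x : ℝ) :
    schwartzConv f g x = ∫ t, f t * g (x - t) := by
  rw [schwartzConv, SchwartzMap.convolution_apply]; rfl

theorem fourier_schwartzConv (f g : 𝓢(ℝ, ℂ)) (ξ : ℝ) :
    𝓕 (schwartzConv f g) ξ = 𝓕 f ξ * 𝓕 g ξ := by
  rw [schwartzConv, SchwartzMap.fourier_convolution]; rfl

theorem hasCompactSupport_schwartzConv {f g : 𝓢(ℝ, ℂ)} (hf : HasCompactSupport f)
    (hg : HasCompactSupport g) : HasCompactSupport (schwartzConv f g) := by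
  have h : ⇑(schwartzConv f g) =
      MeasureTheory.convolution f g (ContinuousLinearMap.mul ℂ ℂ) volume := by
    funext x; exact SchwartzMap.convolution_apply _ f g x
  rw [h]
  exact HasCompactSupport.convolution (L := ContinuousLinearMap.mul ℂ ℂ) hf hg

/-- Every Schwartz function is a Fourier transform, with control of the support. -/
theorem exists_eq_fourier {w : 𝓢(ℝ, ℂ)} {c : ℝ} (hw : ∀ ξ < -c, 𝓕 w ξ = 0) :
    ∃ k : 𝓢(ℝ, ℂ), (∀ E, w E = fourier k E) ∧ tsupport k ⊆ Iic (2 * Real.pi * c) := by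
  have hpi : (2 * Real.pi) ≠ 0 := by positivity
  have ha : -(2 * Real.pi)⁻¹ ≠ 0 := neg_ne_zero.2 (inv_ne_zero hpi)
  -- Fourier inversion in the convention with `(2π)^{-1/2}`: `k t = (2π)^{-1/2} 𝓕 w (-t / 2π)`. The
  -- sign turns the lower bound for the support of `𝓕 w` into an upper bound for that of `k`.
  let k : 𝓢(ℝ, ℂ) := (((Real.sqrt (2 * Real.pi))⁻¹ : ℝ) : ℂ) •
    SchwartzMap.compCLMOfContinuousLinearEquiv ℂ
      (ContinuousLinearEquiv.unitsEquivAut ℝ (Units.mk0 _ ha)) (𝓕 w)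
  have hk : ∀ t, k t = (((Real.sqrt (2 * Real.pi))⁻¹ : ℝ) : ℂ) *
      𝓕 w (t * -(2 * Real.pi)⁻¹) := fun t => by
    simp only [k, smul_apply, smul_eq_mul]
    rfl
  refine ⟨k, fun E => ?_, ?_⟩
  · set Ψ : ℝ → ℂ := fun x => Complex.exp (2 * Real.pi * x * E * Complex.I) * 𝓕 w x
    have h1 : w E = ∫ x, Ψ x := by
      have h2 := fourier_fourier w (-E)
      rw [neg_neg] at h2
      rw [← h2, SchwartzMap.fourier_coe, Real.fourier_real_eq_integral_exp_smul]
      refine integral_congr_ae (ae_of_all _ fun x => ?_)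
      simp only [Ψ, smul_eq_mul]
      congr 2
      push_cast
      ring
    have h3 : ∀ t : ℝ, Complex.exp (-(Complex.I * t * E)) * k t =
        (((Real.sqrt (2 * Real.pi))⁻¹ : ℝ) : ℂ) * Ψ (t * -(2 * Real.pi)⁻¹) := by
      intro t
      rw [hk]
      simp only [Ψ]
      have : (2 * Real.pi * ((t * -(2 * Real.pi)⁻¹ : ℝ) : ℂ) * E * Complex.I) =
          -(Complex.I * t * E) := by
        have : (Real.pi : ℂ) ≠ 0 := by exact_mod_cast Real.pi_ne_zero
        push_cast
        field_simp
      rw [this]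
      ring
    rw [fourier]
    simp only [h3]
    rw [integral_const_mul, Measure.integral_comp_mul_right, ← h1, ← mul_assoc,
      Complex.real_smul, ← mul_assoc]
    have h4 : (((Real.sqrt (2 * Real.pi))⁻¹ : ℝ) : ℂ) * ((Real.sqrt (2 * Real.pi))⁻¹ : ℝ) *
        (|(-(2 * Real.pi)⁻¹)⁻¹| : ℝ) = 1 := by
      rw [← Complex.ofReal_mul, ← Complex.ofReal_mul, ← mul_inv, Real.mul_self_sqrt (by positivity),
        inv_neg, abs_neg, inv_inv, abs_of_pos (by positivity), inv_mul_cancel₀ hpi,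
        Complex.ofReal_one]
    rw [h4, one_mul]
  · refine closure_minimal (fun t ht => ?_) isClosed_Iic
    by_contra hlt
    rw [mem_Iic, not_le] at hlt
    apply ht
    rw [hk, hw, mul_zero]
    rw [mul_neg, neg_lt_neg_iff, ← div_eq_mul_inv, lt_div_iff₀ (by positivity)]
    linarith

theorem integrable_prod_mul {X : Type*} [TopologicalSpace X] [T2Space X]
    [SecondCountableTopology X] [MeasurableSpace X] [BorelSpace X] {μ : Measure X} [SFinite μ]
    {F : X → ℂ} (hF : LocallyIntegrable F μ) {Φ : ℝ → X → ℂ}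
    (hΦ : Continuous (Function.uncurry Φ)) {J : Set ℝ} (hJ : IsCompact J) {K : Set X}
    (hK : IsCompact K) (h : ∀ s y, Φ s y ≠ 0 → s ∈ J ∧ y ∈ K) :
    Integrable (fun q : ℝ × X => F q.2 * Φ q.1 q.2) (volume.prod μ) := by
  obtain ⟨C, hC⟩ := (hJ.prod hK).exists_bound_of_continuousOn hΦ.continuousOn
  have h1 : Integrable (J.indicator fun _ : ℝ => (1 : ℝ)) :=
    (integrable_indicator_iff hJ.measurableSet).2 (integrableOn_const hJ.measure_lt_top.ne)
  have h2 : Integrable (K.indicator fun y => ‖F y‖ * C) μ :=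
    (integrable_indicator_iff hK.measurableSet).2 ((hF.integrableOn_isCompact hK).norm.mul_const C)
  refine (h1.mul_prod h2).mono' ?_ (Eventually.of_forall fun q => ?_)
  · exact (hF.aestronglyMeasurable.comp_snd).mul hΦ.aestronglyMeasurable
  · by_cases hq : Φ q.1 q.2 = 0
    · rw [hq, mul_zero, norm_zero]
      by_cases h3 : q.1 ∈ J ∧ q.2 ∈ K
      · rw [indicator_of_mem h3.1, indicator_of_mem h3.2, one_mul]
        exact mul_nonneg (norm_nonneg _) ((norm_nonneg _).trans (hC q h3))
      · rw [not_and_or] at h3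
        rcases h3 with h3 | h3 <;> simp [indicator_of_notMem h3]
    · obtain ⟨h3, h4⟩ := h _ _ hq
      rw [indicator_of_mem h3, indicator_of_mem h4, one_mul, norm_mul]
      exact mul_le_mul_of_nonneg_left (hC q ⟨h3, h4⟩) (norm_nonneg _)

theorem integral_integral_mul_swap {X : Type*} [TopologicalSpace X] [T2Space X]
    [SecondCountableTopology X] [MeasurableSpace X] [BorelSpace X] {μ : Measure X} [SFinite μ]
    {F : X → ℂ} (hF : LocallyIntegrable F μ) {Φ : ℝ → X → ℂ}
    (hΦ : Continuous (Function.uncurry Φ)) {J : Set ℝ} (hJ : IsCompact J) {K : Set X}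
    (hK : IsCompact K) (h : ∀ s y, Φ s y ≠ 0 → s ∈ J ∧ y ∈ K) :
    ∫ s, ∫ y, F y * Φ s y ∂μ = ∫ y, F y * (∫ s, Φ s y) ∂μ := by
  rw [integral_integral_swap (integrable_prod_mul hF hΦ hJ hK h)]
  simp only [integral_const_mul]

/-- Integration against `G` as a tempered distribution, so that it can be compared with the given
`T` on the dense subspace of compactly supported functions. -/
theorem exists_clm_integral {G : ℝ → ℂ} {C : ℝ} (hc : Continuous G) (hb : ∀ t, ‖G t‖ ≤ C) :
    ∃ Λ : 𝓢(ℝ, ℂ) →L[ℂ] ℂ, ∀ f, Λ f = ∫ t, G t * f t := by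
  have hG : MemLp G ⊤ :=
    memLp_top_of_bound hc.aestronglyMeasurable C (Eventually.of_forall hb)
  refine ⟨(ContinuousLinearMap.mul ℂ ℂ).lpPairing volume ⊤ 1 (hG.toLp G) ∘L
    SchwartzMap.toLpCLM ℂ ℂ 1 volume, fun f => ?_⟩
  rw [ContinuousLinearMap.comp_apply, ContinuousLinearMap.lpPairing_eq_integral]
  refine integral_congr_ae ?_
  filter_upwards [hG.coeFn_toLp, f.coeFn_toLp 1 volume] with t h1 h2
  rw [h1, SchwartzMap.toLpCLM_apply, h2]
  rfl

/-- `t ↦ exp(iηt) G(t)`. -/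
def twist (η : ℝ) (G : ℝ → ℂ) (t : ℝ) : ℂ := Complex.exp (η * t * Complex.I) * G t

/-- `NonnegSpectrum (twist η G)` expresses a spectral gap `η` of `G`: the admissible test functions
may have frequencies down to `-η / 2π`, the factor `2π` being due to the normalization of `𝓕`. -/
theorem nonnegSpectrum_twist {G : ℝ → ℂ} {η : ℝ}
    (h : ∀ f : 𝓢(ℝ, ℂ), (∀ ξ < -(η / (2 * Real.pi)), 𝓕 f ξ = 0) → ∫ t, G t * f (-t) = 0) :
    NonnegSpectrum (twist η G) := by
  intro f hf
  rw [← h (modulate (-(η / (2 * Real.pi))) f) fun ξ hξ => by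
    rw [fourier_modulate]; exact hf _ (by linarith)]
  refine integral_congr_ae (Eventually.of_forall fun t => ?_)
  simp only [twist, modulate_apply]
  have : (2 * Real.pi * ((-(η / (2 * Real.pi)) : ℝ) : ℂ) * ((-t : ℝ) : ℂ) * Complex.I) =
      η * t * Complex.I := by
    have : (Real.pi : ℂ) ≠ 0 := by exact_mod_cast Real.pi_ne_zero
    push_cast
    field_simp
  rw [this]
  ring

theorem norm_twist (η : ℝ) (G : ℝ → ℂ) (t : ℝ) : ‖twist η G t‖ = ‖G t‖ := by
  rw [twist, norm_mul]
  have : (η * t * Complex.I : ℂ) = ((η * t : ℝ) : ℂ) * Complex.I := by push_cast; rfl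
  rw [this, Complex.norm_exp_ofReal_mul_I, one_mul]

theorem continuous_twist {η : ℝ} {G : ℝ → ℂ} (hG : Continuous G) : Continuous (twist η G) := by
  unfold twist; fun_prop

theorem nonnegSpectrum_of_twist {G : ℝ → ℂ} {η : ℝ} (hη : 0 ≤ η)
    (h : NonnegSpectrum (twist η G)) : NonnegSpectrum G := by
  intro f hf
  have h1 := h (modulate (η / (2 * Real.pi)) f) fun ξ hξ => by
    rw [fourier_modulate]
    refine hf _ ?_
    have : 0 ≤ η / (2 * Real.pi) := by positivity
    linarith
  rw [← h1]
  refine integral_congr_ae (Eventually.of_forall fun t => ?_)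
  simp only [twist, modulate_apply]
  have : (2 * Real.pi * ((η / (2 * Real.pi) : ℝ) : ℂ) * ((-t : ℝ) : ℂ) * Complex.I) =
      -(η * t * Complex.I) := by
    have : (Real.pi : ℂ) ≠ 0 := by exact_mod_cast Real.pi_ne_zero
    push_cast
    field_simp
  rw [this, Complex.exp_neg]
  have := Complex.exp_ne_zero (η * t * Complex.I)
  field_simp

end TwoPoint

/-! ### The two-point function: from product test functions to all test functions -/

section TwoPointModel

open FourierTransform

variable {n : ℕ} {S : Type*} [TopologicalSpace S] [ChartedSpace (EuclideanSpace ℝ (Fin n)) S]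

theorem TimeTest.contDiff (a : TimeTest) : ContDiff ℝ ∞ a.1 := contMDiff_iff_contDiff.1 a.2.1

/-- A test function in time as a Schwartz function. -/
def TimeTest.toSchwartz (a : TimeTest) : 𝓢(ℝ, ℂ) := HasCompactSupport.toSchwartzMap a.2.2 a.contDiff

theorem TimeTest.toSchwartz_apply (a : TimeTest) (t : ℝ) : a.toSchwartz t = a.1 t := rfl

/-- A smooth compactly supported function on `ℝ` as a test function. -/
def TimeTest.mk {φ : ℝ → ℂ} (h : ContDiff ℝ ∞ φ) (hc : HasCompactSupport φ) : TimeTest :=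
  ⟨φ, h.contMDiff, hc⟩

/-- The restriction of a test function to a time slice. -/
def Test.slice [T2Space S] (v : Test n S) (s : ℝ) : SpaceTest n S :=
  ⟨fun x => v.1 (s, x), v.2.1.comp (contMDiff_const.prodMk contMDiff_id), by
    refine HasCompactSupport.intro (v.2.2.isCompact.image continuous_snd) fun x hx => ?_
    by_contra h0
    exact hx ⟨(s, x), subset_tsupport _ h0, rfl⟩⟩

/-- `φ(· - s) ⊗ v(s, ·)`. -/
def sliceTensor [T2Space S] {φ : ℝ → ℂ} (h : ContDiff ℝ ∞ φ) (hc : HasCompactSupport φ)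
    (v : Test n S) (s : ℝ) : Test n S :=
  tensor (TimeTest.mk (φ := fun t => φ (t - s)) (h.comp (contDiff_id.sub contDiff_const))
    (hc.comp_homeomorph (Homeomorph.subRight s))) (v.slice s)

theorem sliceTensor_apply [T2Space S] {φ : ℝ → ℂ} (h : ContDiff ℝ ∞ φ) (hc : HasCompactSupport φ)
    (v : Test n S) (s : ℝ) (p : ℝ × S) :
    (sliceTensor h hc v s).1 p = φ (p.1 - s) * v.1 (s, p.2) := rfl

theorem contMDiff_sliceTensor [T2Space S] {φ : ℝ → ℂ} (h : ContDiff ℝ ∞ φ)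
    (hc : HasCompactSupport φ) (v : Test n S) :
    ContMDiff (𝓘(ℝ, ℝ).prod (stModel n)) 𝓘(ℝ, ℂ) ∞
      fun q : ℝ × (ℝ × S) => (sliceTensor h hc v q.1).1 q.2 := by
  have h0 : ContMDiff (𝓘(ℝ, ℝ).prod (stModel n)) (stModel n) ∞
      (Prod.snd : ℝ × (ℝ × S) → ℝ × S) := contMDiff_snd
  have h01 : ContMDiff (𝓘(ℝ, ℝ).prod (stModel n)) 𝓘(ℝ, ℝ) ∞
      (Prod.fst : ℝ × (ℝ × S) → ℝ) := contMDiff_fst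
  have h1 : ContMDiff (𝓘(ℝ, ℝ).prod (stModel n)) 𝓘(ℝ, ℝ) ∞
      (fun q : ℝ × (ℝ × S) => q.2.1) := contMDiff_fst.comp h0
  have h2 : ContMDiff (𝓘(ℝ, ℝ).prod (stModel n)) 𝓘(ℝ, EuclideanSpace ℝ (Fin n)) ∞
      (fun q : ℝ × (ℝ × S) => q.2.2) := contMDiff_snd.comp h0
  have h3 : ContMDiff (𝓘(ℝ, ℝ).prod (stModel n)) 𝓘(ℝ, ℂ) ∞
      (fun q : ℝ × (ℝ × S) => φ (q.2.1 - q.1)) := h.contMDiff.comp (h1.sub h01)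
  have h4 : ContMDiff (𝓘(ℝ, ℝ).prod (stModel n)) 𝓘(ℝ, ℂ) ∞
      (fun q : ℝ × (ℝ × S) => v.1 (q.1, q.2.2)) := v.2.1.comp (h01.prodMk h2)
  exact (contDiff_mul (𝕜 := ℝ) (𝔸 := ℂ) (n := ∞)).contMDiff.comp (h3.prodMk_space h4)

theorem exists_compact_sliceTensor [T2Space S] {φ : ℝ → ℂ} (h : ContDiff ℝ ∞ φ)
    (hc : HasCompactSupport φ) (v : Test n S) (t : ℝ) :
    ∃ (J : Set ℝ) (K : Set (ℝ × S)), IsCompact J ∧ IsCompact K ∧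
      ∀ s y, (Test.translate t (sliceTensor h hc v s)).1 y ≠ 0 → s ∈ J ∧ y ∈ K := by
  refine ⟨Prod.fst '' tsupport v.1, (fun q : (ℝ × S) × ℝ => (q.1.1 + t + q.2, q.1.2)) ''
    (tsupport v.1 ×ˢ tsupport φ), v.2.2.isCompact.image continuous_fst,
    (v.2.2.isCompact.prod hc.isCompact).image (by fun_prop), fun s y hy => ?_⟩
  rw [Test.translate_apply, sliceTensor_apply] at hy
  have h1 := subset_tsupport _ (left_ne_zero_of_mul hy)
  have h2 := subset_tsupport _ (right_ne_zero_of_mul hy)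
  refine ⟨⟨_, h2, rfl⟩, ⟨(_, _), ⟨h2, h1⟩, ?_⟩⟩
  simp only [shift]
  exact Prod.ext (by simp only; ring) rfl

namespace FieldData

variable [IsManifold 𝓘(ℝ, EuclideanSpace ℝ (Fin n)) ∞ S] [MeasurableSpace S]

namespace Admissible

variable [T2Space S] [SecondCountableTopology S] [BorelSpace S] {A : FieldData n S}
  (hA : A.Admissible)
include hA

omit [T2Space S] in
theorem sigmaFinite : SigmaFinite A.vol := by
  have := hA.isLocallyFiniteMeasure
  have := sigmaCompactSpace_spaceTime n S
  infer_instance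

theorem integral_mul_Dplus_translate (g v : Test n S) {φ : ℝ → ℂ} (hφ : Continuous φ)
    (hc : HasCompactSupport φ) (t : ℝ) :
    ∫ s, φ s * A.Dplus g (Test.translate (t + s) v) =
      ∫ y, A.dplus g y * (∫ s, φ s * v.1 (shift (-(t + s)) y)) ∂A.vol := by
  have := hA.sigmaFinite
  have hcs : Continuous fun q : ℝ × (ℝ × S) => shift (t + q.1) q.2 := by
    unfold shift; fun_prop
  have hcs' : Continuous fun q : ℝ × (ℝ × S) => shift (-(t + q.1)) q.2 := by
    unfold shift; fun_prop
  rw [← integral_integral_mul_swap (hA.locallyIntegrable g)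
    (Φ := fun s y => φ s * v.1 (shift (-(t + s)) y)) ?_ hc.isCompact
    ((hc.isCompact.prod v.2.2.isCompact).image hcs) ?_]
  · refine integral_congr_ae (Eventually.of_forall fun s => ?_)
    simp only
    rw [hA.represents, ← integral_const_mul]
    refine integral_congr_ae (Eventually.of_forall fun y => ?_)
    simp only [Test.translate_apply]
    ring
  · exact (hφ.comp continuous_fst).mul (v.continuous.comp hcs')
  · intro s y hy
    have h1 := subset_tsupport _ (left_ne_zero_of_mul hy)
    have h2 := subset_tsupport _ (right_ne_zero_of_mul hy)
    exact ⟨h1, ⟨(s, _), ⟨h1, h2⟩, shift_shift_neg _ _⟩⟩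

/-- Averaging `v` in time with `φ` is a superposition over `s` of the product functions `φ(· - s) ⊗
v(s, ·)`. Mollification in time thus reduces arbitrary test functions to products, without a density
theorem for tensor products. -/
theorem integral_mul_Dplus_translate_eq (g v : Test n S) {φ : ℝ → ℂ} (h : ContDiff ℝ ∞ φ)
    (hc : HasCompactSupport φ) (t : ℝ) :
    ∫ s, φ s * A.Dplus g (Test.translate (t + s) v) =
      ∫ s, A.Dplus g (Test.translate t (sliceTensor h hc v s)) := by
  have := hA.sigmaFinite
  rw [hA.integral_mul_Dplus_translate g v h.continuous hc]
  simp only [hA.represents]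
  obtain ⟨J, K, hJ, hK, hJK⟩ := exists_compact_sliceTensor h hc v t
  rw [integral_integral_mul_swap (hA.locallyIntegrable g)
    (Φ := fun s y => (Test.translate t (sliceTensor h hc v s)).1 y) ?_ hJ hK hJK]
  · refine integral_congr_ae (Eventually.of_forall fun y => ?_)
    simp only [Test.translate_apply, sliceTensor_apply]
    congr 1
    rw [← integral_sub_left_eq_self _ volume (y.1 - t)]
    refine integral_congr_ae (Eventually.of_forall fun s => ?_)
    have e1 : y.1 + -t - s = y.1 - t - s := by ring
    have e2 : (y.1 + -(t + (y.1 - t - s)), y.2) = (s, y.2) := Prod.ext (by simp only; ring) rfl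
    simp only [shift, e1, e2]
  · have h1 := (contMDiff_sliceTensor h hc v).continuous
    refine h1.comp (f := fun q : ℝ × (ℝ × S) => (q.1, shift (-t) q.2)) ?_
    unfold shift; fun_prop

/-- The pairing with `f` and `T(a * (f * b̌))`, where `b̌(t) = b(-t)`, are both tempered in `f` and
agree for compactly supported `f`, hence always. Convolution does not enlarge the spectrum of `f`,
so the argument of `T` is a Fourier transform of a function supported below `ε`. -/
theorem integral_Dplus_tensor_eq_zero {ε : ℝ} (hinv : A.TimeInvariant)
    (hgap : A.SpectralGap ε) (a b : TimeTest) (h₁ h₂ : SpaceTest n S) {c : ℝ}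
    (hcε : 2 * Real.pi * c < ε) (f : 𝓢(ℝ, ℂ)) (hf : ∀ ξ < -c, 𝓕 f ξ = 0) :
    ∫ t, A.Dplus (tensor a h₁) (Test.translate t (tensor b h₂)) * f (-t) = 0 := by
  obtain ⟨T, hT, hT0⟩ := hgap h₁ h₂
  set g := tensor a h₁
  set v := tensor b h₂
  let sb := reflect b.toSchwartz
  have hbc : Continuous fun t => A.Dplus g (Test.translate t v) :=
    hA.continuous_Dplus_translate g v
  obtain ⟨Λ, hΛ⟩ := exists_clm_integral (hbc.comp continuous_neg)
    fun t => hA.norm_Dplus_translate_le hinv g v (-t)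
  let Λ' : 𝓢(ℝ, ℂ) →L[ℂ] ℂ := T ∘L
    (SchwartzMap.convolution (ContinuousLinearMap.mul ℂ ℂ) a.toSchwartz) ∘L
    (SchwartzMap.convolution (ContinuousLinearMap.mul ℂ ℂ).flip sb)
  have hΛ' : ∀ f, Λ' f = T (schwartzConv a.toSchwartz (schwartzConv f sb)) := fun f => rfl
  have heq : ∀ f, (Λ' - Λ) f = 0 := by
    refine schwartz_eq_zero_of_hasCompactSupport _ fun f hfc => ?_
    rw [sub_apply, sub_eq_zero, hΛ, hΛ']
    have hsb : HasCompactSupport sb := b.2.2.comp_homeomorph (Homeomorph.neg ℝ)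
    -- For compactly supported `f` the smeared time function is again a test function, so the
    -- defining property of `T` applies to it.
    let b' : TimeTest := TimeTest.mk (φ := fun t => schwartzConv f sb (-t))
      (((schwartzConv f sb).smooth ⊤).comp contDiff_neg)
      ((hasCompactSupport_schwartzConv hfc hsb).comp_homeomorph (Homeomorph.neg ℝ))
    rw [← hT a b' (schwartzConv a.toSchwartz (schwartzConv f sb)) fun r => by
      rw [schwartzConv_apply, ← integral_add_left_eq_self _ r]
      refine integral_congr_ae (Eventually.of_forall fun t => ?_)
      simp only [TimeTest.toSchwartz_apply, b', TimeTest.mk, sub_add_cancel_left]]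
    have h1 := hA.integral_mul_Dplus_translate g v (φ := fun s => f (-s))
      (f.continuous.comp continuous_neg) (hfc.comp_homeomorph (Homeomorph.neg ℝ)) 0
    have h2 : ∫ t, ((fun t => A.Dplus g (Test.translate t v)) ∘ fun t => -t) t * f t =
        ∫ s, f (-s) * A.Dplus g (Test.translate (0 + s) v) := by
      rw [← integral_neg_eq_self]
      refine integral_congr_ae (Eventually.of_forall fun t => ?_)
      simp only [Function.comp_apply, neg_neg, zero_add, mul_comm]
    rw [h2, h1, hA.represents]
    refine integral_congr_ae (Eventually.of_forall fun y => ?_)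
    simp only
    congr 1
    change schwartzConv f sb (-y.1) * h₂.1 y.2 = _
    rw [schwartzConv_apply, ← integral_mul_const, ← integral_neg_eq_self]
    refine integral_congr_ae (Eventually.of_forall fun s => ?_)
    simp only [sb, reflect_apply, TimeTest.toSchwartz_apply, v, tensor, shift]
    have e : -(-y.1 - -s) = y.1 + -(0 + s) := by ring
    rw [mul_assoc, e]
  have h3 := heq f
  rw [sub_apply, sub_eq_zero, hΛ, hΛ'] at h3
  have h4 : ∀ ξ < -c, 𝓕 (schwartzConv a.toSchwartz (schwartzConv f sb)) ξ = 0 := fun ξ hξ => by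
    rw [fourier_schwartzConv, fourier_schwartzConv, hf ξ hξ, zero_mul, mul_zero]
  obtain ⟨k, hk, hks⟩ := exists_eq_fourier h4
  rw [hT0 k _ hk (hks.trans fun x hx => lt_of_le_of_lt hx hcε)] at h3
  rw [h3, ← integral_neg_eq_self]
  simp only [Function.comp_apply, neg_neg]

/-- The mollified function is a superposition of the functions belonging to the products
`sliceTensor`, each of which satisfies the spectral condition by hypothesis. Fubini's theorem
applies because the seminorms of the family are uniformly bounded. -/
theorem nonnegSpectrum_of_tensor {η : ℝ} (hinv : A.TimeInvariant) (g : Test n S)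
    (h : ∀ (b : TimeTest) (h₂ : SpaceTest n S),
      NonnegSpectrum (twist η fun t => A.Dplus g (Test.translate t (tensor b h₂))))
    (v : Test n S) : NonnegSpectrum (twist η fun t => A.Dplus g (Test.translate t v)) := by
  refine nonnegSpectrum_of_mollified (continuous_twist (hA.continuous_Dplus_translate g v))
    (fun t => (norm_twist _ _ _).trans_le (hA.norm_Dplus_translate_le hinv g v t))
    fun φ hφ hφc => ?_
  -- The part of the phase at time `t + s` that depends on `s` is absorbed into the mollifier.
  set φ' : ℝ → ℂ := fun s => φ s * Complex.exp (η * s * Complex.I) with hφ'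
  have h1 : ContDiff ℝ ∞ φ' := hφ.mul (Complex.contDiff_exp.comp
    ((contDiff_const.mul Complex.ofRealCLM.contDiff).mul contDiff_const))
  have h1c : HasCompactSupport φ' := hφc.mul_right
  have h2 : ∀ t, ∫ s, φ s * twist η (fun t => A.Dplus g (Test.translate t v)) (t + s) =
      ∫ s, twist η (fun t => A.Dplus g (Test.translate t (sliceTensor h1 h1c v s))) t := by
    intro t
    have h3 : ∀ s, φ s * twist η (fun t => A.Dplus g (Test.translate t v)) (t + s) =
        Complex.exp (η * t * Complex.I) * (φ' s * A.Dplus g (Test.translate (t + s) v)) := by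
      intro s
      simp only [twist, hφ']
      push_cast
      rw [mul_add, add_mul, Complex.exp_add]
      ring
    simp only [h3]
    rw [integral_const_mul, hA.integral_mul_Dplus_translate_eq g v h1 h1c, ← integral_const_mul]
    rfl
  intro f hf
  simp only [h2]
  obtain ⟨J, K, hJ, hK, hJK⟩ := exists_compact_sliceTensor h1 h1c v 0
  have hJ0 : ∀ s ∉ J, sliceTensor h1 h1c v s = 0 := by
    intro s hs
    apply Subtype.ext
    funext y
    by_contra h0
    exact hs (hJK s y (by rwa [Test.translate_zero])).1
  have hWK : ∀ s ∈ J, tsupport (sliceTensor h1 h1c v s).1 ⊆ K := by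
    intro s _
    refine closure_minimal (fun y hy => ?_) hK.isClosed
    exact (hJK s y (by rwa [Test.translate_zero])).2
  obtain ⟨C, hC⟩ := hA.exists_bound_seminormPlus (contMDiff_sliceTensor h1 h1c v) hJ hK hWK
  set H : ℝ → ℝ → ℂ := fun t s =>
    twist η (fun t => A.Dplus g (Test.translate t (sliceTensor h1 h1c v s))) t with hH
  have hHc : Continuous (Function.uncurry H) := by
    have hc0 := (contMDiff_sliceTensor h1 h1c v).continuous
    have hcD : Continuous fun q : ℝ × ℝ =>
        A.Dplus g (Test.translate q.1 (sliceTensor h1 h1c v q.2)) := by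
      simp only [hA.represents]
      rw [continuous_iff_continuousAt]
      intro q₀
      have hcs : Continuous fun q : ℝ × (ℝ × S) => shift q.1 q.2 := by
        unfold shift; fun_prop
      refine continuousAt_integral_mul (hA.locallyIntegrable g)
        (Φ := fun (q : ℝ × ℝ) y => (Test.translate q.1 (sliceTensor h1 h1c v q.2)).1 y) ?_
        (K := (fun q : ℝ × (ℝ × S) => shift q.1 q.2) '' (Icc (q₀.1 - 1) (q₀.1 + 1) ×ˢ K))
        ((isCompact_Icc.prod hK).image hcs) ?_
      · refine hc0.comp (f := fun q : (ℝ × ℝ) × (ℝ × S) => (q.1.2, shift (-q.1.1) q.2)) ?_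
        unfold shift; fun_prop
      · have : ∀ᶠ q : ℝ × ℝ in 𝓝 q₀, q.1 ∈ Icc (q₀.1 - 1) (q₀.1 + 1) :=
          continuous_fst.continuousAt (Icc_mem_nhds (sub_one_lt q₀.1) (lt_add_one q₀.1))
        filter_upwards [this] with q hq y hy
        rw [Test.translate_apply]
        by_contra h0
        refine hy ⟨(q.1, shift (-q.1) y), ⟨hq, ?_⟩, shift_shift_neg _ _⟩
        exact (hJK q.2 _ (by rwa [Test.translate_zero])).2
    simp only [hH, twist]
    exact (by fun_prop : Continuous fun q : ℝ × ℝ => Complex.exp (η * q.1 * Complex.I)).mul hcD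
  have hHb : ∀ t s, ‖H t s‖ ≤ J.indicator (fun _ => A.seminormPlus (Test.conj g) * C) s := by
    intro t s
    by_cases hs : s ∈ J
    · rw [indicator_of_mem hs, hH]
      refine (norm_twist _ _ _).trans_le ((hA.norm_Dplus_translate_le hinv g _ t).trans ?_)
      exact mul_le_mul_of_nonneg_left (hC s hs) (Real.sqrt_nonneg _)
    · simp [hH, twist, hJ0 s hs, indicator_of_notMem hs]
  have hint : Integrable (Function.uncurry fun t s => H t s * f (-t))
      (volume.prod volume) := by
    have hI : Integrable (J.indicator fun _ : ℝ => A.seminormPlus (Test.conj g) * C) :=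
      (integrable_indicator_iff hJ.measurableSet).2 (integrableOn_const hJ.measure_lt_top.ne)
    have hfI : Integrable fun t => ‖f (-t)‖ := (reflect f).integrable.norm
    refine (hfI.mul_prod hI).mono' ?_ (Eventually.of_forall fun q => ?_)
    · exact (hHc.mul (f.continuous.comp (continuous_fst.neg))).aestronglyMeasurable
    · simp only [Function.uncurry, norm_mul]
      rw [mul_comm]
      exact mul_le_mul_of_nonneg_left (hHb _ _) (norm_nonneg _)
  have h5 : ∀ t, (∫ s, H t s) * f (-t) = ∫ s, H t s * f (-t) := fun t =>
    (integral_mul_const _ _).symm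
  have h6 : ∀ s, ∫ t, H t s * f (-t) = 0 := fun s => h _ _ f hf
  calc _ = ∫ t, ∫ s, H t s * f (-t) := integral_congr_ae (Eventually.of_forall h5)
    _ = ∫ s, ∫ t, H t s * f (-t) := integral_integral_swap hint
    _ = 0 := by simp only [h6, integral_zero]

/-- The one-particle spectral condition for arbitrary test functions. -/
theorem nonnegSpectrum_twist_Dplus {ε : ℝ} (hε : 0 < ε) (hinv : A.TimeInvariant)
    (hgap : A.SpectralGap ε) (g v : Test n S) :
    NonnegSpectrum (twist (ε / 2) fun t => A.Dplus g (Test.translate t v)) := by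
  -- Half of the gap is kept, since the support of the test function has to lie in the open half
  -- line below `ε`.
  have htensor : ∀ (a b : TimeTest) (h₁ h₂ : SpaceTest n S), NonnegSpectrum
      (twist (ε / 2) fun t => A.Dplus (tensor a h₁) (Test.translate t (tensor b h₂))) := by
    intro a b h₁ h₂
    refine nonnegSpectrum_twist fun f hf =>
      hA.integral_Dplus_tensor_eq_zero hinv hgap a b h₁ h₂ ?_ f hf
    have : 2 * Real.pi * (ε / 2 / (2 * Real.pi)) = ε / 2 := by
      have := Real.pi_ne_zero
      field_simp
    linarith
  -- The restriction to products is removed in one argument at a time; hermiticity and `conj_neg`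
  -- exchange the roles of the two arguments.
  refine hA.nonnegSpectrum_of_tensor hinv g (fun b h₂ => ?_) v
  let b' : TimeTest := ⟨fun t => conj (b.1 t),
    (Complex.conjCLE.contDiff (n := ∞)).contMDiff.comp b.2.1,
    b.2.2.comp_left (g := starRingEnd ℂ) (map_zero _)⟩
  let h' : SpaceTest n S := ⟨fun x => conj (h₂.1 x),
    (Complex.conjCLE.contDiff (n := ∞)).contMDiff.comp h₂.2.1,
    h₂.2.2.comp_left (g := starRingEnd ℂ) (map_zero _)⟩
  have h1 := (hA.nonnegSpectrum_of_tensor hinv (tensor b' h') (htensor b' · h' ·)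
    (Test.conj g)).conj_neg
  convert h1 using 1
  funext t
  simp only [twist]
  have h2 : Test.conj (tensor b' h') = tensor b h₂ := by
    apply Subtype.ext; funext p
    simp [Test.conj, tensor, b', h']
  have h3 := hA.hermitian (tensor b h₂) (Test.translate (-t) g)
  have h4 := hinv t (Test.translate (-t) g) (tensor b h₂)
  rw [Test.translate_translate, neg_add_cancel, Test.translate_zero] at h4
  rw [map_mul, ← Complex.exp_conj, h4, h3, ← h2, Test.conj_conj, Test.conj_translate]
  congr 2
  rw [map_mul, map_mul, Complex.conj_ofReal, Complex.conj_ofReal, Complex.conj_I]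
  push_cast
  ring

end Admissible

end FieldData

end TwoPointModel

/-! ### Integrals of products of translates -/

section Multilinear

open FourierTransform
open scoped ENNReal

variable {α : Type*} [MeasurableSpace α] {μ : Measure α}

theorem eLpNorm_prod_le {ι : Type*} {f : ι → α → ℂ} {p : ι → ℝ≥0∞} {s : Finset ι}
    (hf : ∀ i ∈ s, MemLp (f i) (p i) μ) :
    eLpNorm (∏ i ∈ s, f i) (∑ i ∈ s, (p i)⁻¹)⁻¹ μ ≤ ∏ i ∈ s, eLpNorm (f i) (p i) μ := by
  induction s using Finset.cons_induction with
  | empty =>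
    simp only [Finset.prod_empty, Finset.sum_empty, ENNReal.inv_zero, eLpNorm_exponent_top]
    by_cases hμ : μ = 0
    · simp [hμ]
    · have : (1 : α → ℂ) = fun _ => 1 := rfl
      rw [this, eLpNormEssSup_const _ hμ]; simp
  | cons i s hi ih =>
    rw [Finset.prod_cons, Finset.prod_cons]
    have h1 := Finset.forall_of_forall_cons hf
    refine (eLpNorm_smul_le_mul_eLpNorm (MemLp.prod h1).1 (hf i (Finset.mem_cons_self ..)).1
      (p := p i) (q := (∑ i ∈ s, (p i)⁻¹)⁻¹) (hpqr := ⟨by simp⟩)).trans ?_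
    gcongr
    exact ih h1

theorem sum_inv_natCast (N : ℕ) [NeZero N] : (∑ _i : Fin N, ((N : ℝ≥0∞))⁻¹)⁻¹ = 1 := by
  rw [Finset.sum_const, Finset.card_univ, Fintype.card_fin, nsmul_eq_mul,
    ENNReal.mul_inv_cancel (by exact_mod_cast NeZero.ne N) (ENNReal.natCast_ne_top N), inv_one]

theorem integrable_prod_of_memLp {N : ℕ} [NeZero N] {f : Fin N → α → ℂ}
    (hf : ∀ i, MemLp (f i) N μ) : Integrable (fun y => ∏ i, f i y) μ := by
  have h := MemLp.prod' (s := Finset.univ) (fun i _ => hf i)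
  rw [sum_inv_natCast] at h
  exact memLp_one_iff_integrable.1 h

theorem norm_integral_prod_le {N : ℕ} [NeZero N] {f : Fin N → α → ℂ}
    (hf : ∀ i, MemLp (f i) N μ) :
    ‖∫ y, ∏ i, f i y ∂μ‖ ≤ ∏ i, (eLpNorm (f i) N μ).toReal := by
  have h := eLpNorm_prod_le (s := Finset.univ) (fun i _ => hf i)
  rw [sum_inv_natCast] at h
  have hI := integrable_prod_of_memLp hf
  rw [← ENNReal.toReal_prod]
  refine (norm_integral_le_integral_norm _).trans ?_
  rw [integral_norm_eq_lintegral_enorm hI.1, ← eLpNorm_one_eq_lintegral_enorm]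
  have h2 : (fun y => ∏ i, f i y) = ∏ i, f i := by
    funext y; rw [Finset.prod_apply]
  rw [h2]
  exact ENNReal.toReal_mono (ENNReal.prod_ne_top fun i _ => (hf i).2.ne) h

instance fact_one_le_natCast (N : ℕ) [NeZero N] : Fact ((1 : ℝ≥0∞) ≤ N) :=
  ⟨by exact_mod_cast NeZero.one_le⟩

theorem prod_update_apply {N : ℕ} {E : Type*} (c : E → ℂ) (m : Fin N → E) (i : Fin N) (x : E) :
    ∏ l, c (Function.update m i x l) = c x * ∏ l ∈ Finset.univ.erase i, c (m l) := by
  rw [← Finset.mul_prod_erase _ _ (Finset.mem_univ i), Function.update_self]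
  congr 1
  refine Finset.prod_congr rfl fun l hl => ?_
  rw [Function.update_of_ne (Finset.ne_of_mem_erase hl)]

/-- `(u_i) ↦ ∫ ∏ u_i` as a multilinear map on `L^N`. -/
def prodIntegral (μ : Measure α) (N : ℕ) [NeZero N] :
    ContinuousMultilinearMap ℂ (fun _ : Fin N => Lp ℂ N μ) ℂ :=
  MultilinearMap.mkContinuous
    { toFun := fun u => ∫ y, ∏ i, u i y ∂μ
      map_update_add' := by
        intro hd m i x z
        have : hd = instDecidableEqFin N := Subsingleton.elim _ _
        subst this
        rw [← integral_add (integrable_prod_of_memLp fun l => Lp.memLp _)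
          (integrable_prod_of_memLp fun l => Lp.memLp _)]
        refine integral_congr_ae ?_
        filter_upwards [Lp.coeFn_add x z] with y hy
        rw [prod_update_apply (fun u : Lp ℂ N μ => u y),
          prod_update_apply (fun u : Lp ℂ N μ => u y),
          prod_update_apply (fun u : Lp ℂ N μ => u y), hy, Pi.add_apply, add_mul]
      map_update_smul' := by
        intro hd m i c x
        have : hd = instDecidableEqFin N := Subsingleton.elim _ _
        subst this
        rw [smul_eq_mul, ← integral_const_mul]
        refine integral_congr_ae ?_
        filter_upwards [Lp.coeFn_smul c x] with y hy
        rw [prod_update_apply (fun u : Lp ℂ N μ => u y),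
          prod_update_apply (fun u : Lp ℂ N μ => u y), hy, Pi.smul_apply, smul_eq_mul, mul_assoc] }
    1 fun m => by
      rw [one_mul]
      exact norm_integral_prod_le fun l => Lp.memLp _

theorem prodIntegral_apply (N : ℕ) [NeZero N] (u : Fin N → Lp ℂ N μ) :
    prodIntegral μ N u = ∫ y, ∏ i, u i y ∂μ := rfl

theorem prodIntegral_toLp {N : ℕ} [NeZero N] {f : Fin N → α → ℂ} (hf : ∀ i, MemLp (f i) N μ) :
    prodIntegral μ N (fun i => (hf i).toLp (f i)) = ∫ y, ∏ i, f i y ∂μ := by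
  rw [prodIntegral_apply]
  refine integral_congr_ae ?_
  have : ∀ᵐ y ∂μ, ∀ i, ((hf i).toLp (f i)) y = f i y := ae_all_iff.2 fun i => (hf i).coeFn_toLp
  filter_upwards [this] with y hy
  simp only [hy]

/-- The vector valued version of `NonnegSpectrum`. -/
def VectorNonnegSpectrum {E : Type*} [NormedAddCommGroup E] [NormedSpace ℂ E] (v : ℝ → E) : Prop :=
  ∀ f : 𝓢(ℝ, ℂ), (∀ ξ < 0, 𝓕 f ξ = 0) → ∫ t, f (-t) • v t = 0

theorem integrable_smul_of_bounded {E : Type*} [NormedAddCommGroup E] [NormedSpace ℂ E]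
    {v : ℝ → E} {C : ℝ} (hc : Continuous v) (hb : ∀ t, ‖v t‖ ≤ C) (f : 𝓢(ℝ, ℂ)) :
    Integrable fun t => f (-t) • v t := by
  have h := (reflect f).integrable (μ := volume)
  refine (h.norm.mul_const C).mono' ?_ (Eventually.of_forall fun t => ?_)
  · exact ((f.continuous.comp continuous_neg).smul hc).aestronglyMeasurable
  · rw [norm_smul]
    exact mul_le_mul_of_nonneg_left (hb t) (norm_nonneg _)

theorem vectorNonnegSpectrum_const {E : Type*} [NormedAddCommGroup E] [NormedSpace ℂ E]
    [CompleteSpace E] (e : E) : VectorNonnegSpectrum fun _ => e := by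
  intro f hf
  rw [integral_smul_const]
  have h := nonnegSpectrum_const 1 f hf
  simp only [one_mul] at h
  rw [h, zero_smul]

/-- Give each argument its own time. In each single time `M` is a continuous linear map and commutes
with the Bochner integral, so the condition holds separately in every variable and passes to the
diagonal. -/
theorem nonnegSpectrum_multilinear {N : ℕ} {E : Type*} [NormedAddCommGroup E] [NormedSpace ℂ E]
    [CompleteSpace E] (M : ContinuousMultilinearMap ℂ (fun _ : Fin N => E) ℂ)
    {v : Fin N → ℝ → E} {C : ℝ} (hc : ∀ l, Continuous (v l)) (hb : ∀ l t, ‖v l t‖ ≤ C)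
    (h : ∀ l, VectorNonnegSpectrum (v l)) : NonnegSpectrum fun t => M fun l => v l t := by
  refine nonnegSpectrum_diag_pi (H := fun τ => M fun l => v l (τ l)) (C := ‖M‖ * ∏ _l : Fin N, C)
    ?_ ?_ ?_
  · refine M.cont.comp (continuous_pi fun l => (hc l).comp (continuous_apply l))
  · intro τ
    refine (M.le_opNorm _).trans ?_
    gcongr
    exact hb _ _
  · intro i x f hf
    have h1 : ∀ t, (M fun l => v l (Function.update x i t l)) =
        M.toContinuousLinearMap (fun l => v l (x l)) i (v i t) := by
      intro t
      rw [ContinuousMultilinearMap.toContinuousLinearMap_apply]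
      congr 1
      funext l
      by_cases hl : l = i
      · subst hl; simp
      · simp [Function.update_of_ne hl]
    have h2 : ∀ t, (M fun l => v l (Function.update x i t l)) * f (-t) =
        M.toContinuousLinearMap (fun l => v l (x l)) i (f (-t) • v i t) := by
      intro t
      rw [h1, map_smul, smul_eq_mul, mul_comm]
    simp only [h2]
    rw [ContinuousLinearMap.integral_comp_comm _ (integrable_smul_of_bounded (hc i) (hb i) f),
      h i f hf, map_zero]

end Multilinear

/-! ### The translation flow on `L^N` -/

section Flow

open FourierTransform
open scoped ENNReal

variable {n : ℕ} {S : Type*} [TopologicalSpace S] [T2Space S] [SecondCountableTopology S]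
  [ChartedSpace (EuclideanSpace ℝ (Fin n)) S]
  [IsManifold 𝓘(ℝ, EuclideanSpace ℝ (Fin n)) ∞ S] [MeasurableSpace S] [BorelSpace S]

/-- The translates of an `L^N` function. -/
def lpFlow {μ : Measure (ℝ × S)} (hμ : ∀ s, MeasurePreserving (shift s) μ μ) {N : ℕ}
    {q : ℝ × S → ℂ} (hq : MemLp q N μ) (t : ℝ) : Lp ℂ N μ :=
  Lp.compMeasurePreserving (shift t) (hμ t) (hq.toLp q)

omit [TopologicalSpace S] [T2Space S] [SecondCountableTopology S] [BorelSpace S] in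
theorem lpFlow_eq_toLp {μ : Measure (ℝ × S)} (hμ : ∀ s, MeasurePreserving (shift s) μ μ) {N : ℕ}
    {q : ℝ × S → ℂ} (hq : MemLp q N μ) (t : ℝ) :
    lpFlow hμ hq t = (hq.comp_measurePreserving (hμ t)).toLp _ := rfl

omit [TopologicalSpace S] [T2Space S] [SecondCountableTopology S] [BorelSpace S] in
theorem norm_lpFlow {μ : Measure (ℝ × S)} (hμ : ∀ s, MeasurePreserving (shift s) μ μ) {N : ℕ}
    {q : ℝ × S → ℂ} (hq : MemLp q N μ) (t : ℝ) : ‖lpFlow hμ hq t‖ = ‖hq.toLp q‖ :=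
  Lp.norm_compMeasurePreserving _ _

omit [IsManifold 𝓘(ℝ, EuclideanSpace ℝ (Fin n)) ∞ S] in
variable (n) in
include n in
theorem continuous_lpFlow {μ : Measure (ℝ × S)} [IsLocallyFiniteMeasure μ]
    (hμ : ∀ s, MeasurePreserving (shift s) μ μ) {N : ℕ}
    [NeZero N] {q : ℝ × S → ℂ} (hq : MemLp q N μ) : Continuous (lpFlow hμ hq) := by
  have := metrizableSpace_spaceTime n S
  have := sigmaCompactSpace_spaceTime n S
  let F : C(ℝ, C(ℝ × S, ℝ × S)) :=
    ContinuousMap.curry ⟨fun q : ℝ × (ℝ × S) => shift q.1 q.2, by unfold shift; fun_prop⟩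
  exact Continuous.compMeasurePreservingLp (continuous_const (y := hq.toLp q)) F.continuous hμ
    (ENNReal.natCast_ne_top N)

theorem lp_eq_zero_of_integral_test {μ : Measure (ℝ × S)} [IsLocallyFiniteMeasure μ] {N : ℕ}
    [NeZero N] {u : Lp ℂ N μ} (h : ∀ h : Test n S, ∫ y, u y * h.1 y ∂μ = 0) : u = 0 := by
  rw [Lp.eq_zero_iff_ae_eq_zero]
  have := locallyCompactSpace_spaceTime n S
  exact ae_eq_zero_of_integral_test ((Lp.memLp u).locallyIntegrable Fact.out) h

/-- A criterion for the spectral condition of the translates of an `L^N` function. -/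
theorem vectorNonnegSpectrum_lpFlow {μ : Measure (ℝ × S)} [IsLocallyFiniteMeasure μ]
    (hμ : ∀ s, MeasurePreserving (shift s) μ μ) {N : ℕ} [NeZero N] {q : ℝ × S → ℂ}
    (hq : MemLp q N μ) (σ η : ℝ)
    (h : ∀ h : Test n S, NonnegSpectrum (twist η fun t => ∫ y, q (shift (σ * t) y) * h.1 y ∂μ)) :
    VectorNonnegSpectrum fun t => Complex.exp (η * t * Complex.I) • lpFlow hμ hq (σ * t) := by
  intro f hf
  have hcont : Continuous fun t : ℝ =>
      Complex.exp (η * t * Complex.I) • lpFlow hμ hq (σ * t) := by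
    exact (by fun_prop : Continuous fun t : ℝ => Complex.exp (η * t * Complex.I)).smul
      ((continuous_lpFlow n hμ hq).comp (by fun_prop : Continuous fun t : ℝ => σ * t))
  have hbd : ∀ t : ℝ, ‖Complex.exp (η * t * Complex.I) • lpFlow hμ hq (σ * t)‖ ≤
      ‖hq.toLp q‖ := by
    intro t
    have : (η * t * Complex.I : ℂ) = ((η * t : ℝ) : ℂ) * Complex.I := by push_cast; rfl
    rw [norm_smul, this, Complex.norm_exp_ofReal_mul_I, one_mul, norm_lpFlow]
  have hint := integrable_smul_of_bounded hcont hbd f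
  -- Test functions separate the points of `L^N`. Pairing with one of them is continuous, by Hölder
  -- with the conjugate exponent `r`, and can be taken inside the integral over `t`.
  refine lp_eq_zero_of_integral_test (n := n) fun k => ?_
  beta_reduce
  let r : ℝ≥0∞ := (1 - (N : ℝ≥0∞)⁻¹)⁻¹
  have hr : ENNReal.HolderConjugate (N : ℝ≥0∞) r :=
    ENNReal.HolderConjugate.inv_one_sub_inv' (Fact.out : (1 : ℝ≥0∞) ≤ N)
  have hr1 : Fact (1 ≤ r) := by simp [r, fact_iff]
  have hk : MemLp k.1 r μ := k.continuous.memLp_of_hasCompactSupport k.2.2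
  let Λ : Lp ℂ N μ →L[ℂ] ℂ :=
    ((ContinuousLinearMap.mul ℂ ℂ).lpPairing μ (N : ℝ≥0∞) r).flip (hk.toLp k.1)
  have hΛ : ∀ u : Lp ℂ N μ, Λ u = ∫ y, u y * k.1 y ∂μ := by
    intro u
    change (ContinuousLinearMap.mul ℂ ℂ).lpPairing μ (N : ℝ≥0∞) r u (hk.toLp k.1) = _
    rw [ContinuousLinearMap.lpPairing_eq_integral]
    refine integral_congr_ae ?_
    filter_upwards [hk.coeFn_toLp] with y hy
    rw [hy]; rfl
  rw [← hΛ]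
  refine (ContinuousLinearMap.integral_comp_comm Λ hint).symm.trans ?_
  rw [← h k f hf]
  refine integral_congr_ae (Eventually.of_forall fun t => ?_)
  beta_reduce
  rw [map_smul Λ, map_smul Λ, hΛ, smul_eq_mul, smul_eq_mul, twist]
  have : ∫ y, lpFlow hμ hq (σ * t) y * k.1 y ∂μ = ∫ y, q (shift (σ * t) y) * k.1 y ∂μ := by
    refine integral_congr_ae ?_
    filter_upwards [(hq.comp_measurePreserving (hμ (σ * t))).coeFn_toLp] with y hy
    rw [lpFlow_eq_toLp, hy]; rfl
  rw [this]
  ring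

-- The phases factor out of the multilinear map `prodIntegral`, so the gaps of the factors add. The
-- signs `σ` allow factors that move forward, backward or not at all.
omit [IsManifold 𝓘(ℝ, EuclideanSpace ℝ (Fin n)) ∞ S] in
variable (n) in
include n in
theorem nonnegSpectrum_integral_prod {μ : Measure (ℝ × S)} [IsLocallyFiniteMeasure μ]
    (hμ : ∀ s, MeasurePreserving (shift s) μ μ) {N : ℕ} [NeZero N] {q : Fin N → ℝ × S → ℂ}
    (hq : ∀ l, MemLp (q l) N μ) (σ η : Fin N → ℝ)
    (h : ∀ l, VectorNonnegSpectrum fun t : ℝ =>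
      Complex.exp (η l * t * Complex.I) • lpFlow hμ (hq l) (σ l * t)) :
    NonnegSpectrum (twist (∑ l, η l) fun t => ∫ y, ∏ l, q l (shift (σ l * t) y) ∂μ) := by
  have hcont : ∀ l, Continuous fun t : ℝ =>
      Complex.exp (η l * t * Complex.I) • lpFlow hμ (hq l) (σ l * t) := fun l =>
    (by fun_prop : Continuous fun t : ℝ => Complex.exp (η l * t * Complex.I)).smul
      ((continuous_lpFlow n hμ (hq l)).comp (by fun_prop : Continuous fun t : ℝ => σ l * t))
  have hbd : ∀ l, ∀ t : ℝ, ‖Complex.exp (η l * t * Complex.I) • lpFlow hμ (hq l) (σ l * t)‖ ≤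
      ∑ l, ‖(hq l).toLp (q l)‖ := by
    intro l t
    have : (η l * t * Complex.I : ℂ) = ((η l * t : ℝ) : ℂ) * Complex.I := by push_cast; rfl
    rw [norm_smul, this, Complex.norm_exp_ofReal_mul_I, one_mul, norm_lpFlow]
    exact Finset.single_le_sum (f := fun l => ‖(hq l).toLp (q l)‖)
      (fun _ _ => norm_nonneg _) (Finset.mem_univ l)
  have h1 := nonnegSpectrum_multilinear (prodIntegral μ N) hcont hbd h
  convert h1 using 1
  funext t
  rw [ContinuousMultilinearMap.map_smul_univ]
  simp only [lpFlow_eq_toLp]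
  rw [prodIntegral_toLp fun l => (hq l).comp_measurePreserving (hμ (σ l * t)), twist,
    ← Complex.exp_sum, smul_eq_mul]
  congr 2
  rw [Complex.ofReal_sum, Finset.sum_mul, Finset.sum_mul]

omit [IsManifold 𝓘(ℝ, EuclideanSpace ℝ (Fin n)) ∞ S] in
variable (n) in
include n in
theorem continuous_integral_prod {μ : Measure (ℝ × S)} [IsLocallyFiniteMeasure μ]
    (hμ : ∀ s, MeasurePreserving (shift s) μ μ) {N : ℕ} [NeZero N] {q : Fin N → ℝ × S → ℂ}
    (hq : ∀ l, MemLp (q l) N μ) (σ : Fin N → ℝ) :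
    Continuous fun t => ∫ y, ∏ l, q l (shift (σ l * t) y) ∂μ := by
  have h1 : ∀ t, ∫ y, ∏ l, q l (shift (σ l * t) y) ∂μ =
      prodIntegral μ N fun l => lpFlow hμ (hq l) (σ l * t) := fun t => by
    simp only [lpFlow_eq_toLp]
    rw [prodIntegral_toLp fun l => (hq l).comp_measurePreserving (hμ (σ l * t))]
    rfl
  simp only [h1]
  refine (prodIntegral μ N).cont.comp (continuous_pi fun l => ?_)
  exact (continuous_lpFlow n hμ (hq l)).comp (by fun_prop)

omit [TopologicalSpace S] [T2Space S] [SecondCountableTopology S] [BorelSpace S] in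
theorem norm_integral_prod_shift_le {μ : Measure (ℝ × S)}
    (hμ : ∀ s, MeasurePreserving (shift s) μ μ) {N : ℕ} [NeZero N] {q : Fin N → ℝ × S → ℂ}
    (hq : ∀ l, MemLp (q l) N μ) (σ : Fin N → ℝ) (t : ℝ) :
    ‖∫ y, ∏ l, q l (shift (σ l * t) y) ∂μ‖ ≤ ∏ l, (eLpNorm (q l) N μ).toReal := by
  refine (norm_integral_prod_le fun l =>
    (hq l).comp_measurePreserving (hμ (σ l * t))).trans_eq ?_
  refine Finset.prod_congr rfl fun l _ => ?_
  rw [eLpNorm_comp_measurePreserving (hq l).1 (hμ _)]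

end Flow

/-! ### The truncated vacuum expectation values -/

section Truncated

open FourierTransform
open scoped ENNReal

variable {n : ℕ} {S : Type*} [TopologicalSpace S]
  [ChartedSpace (EuclideanSpace ℝ (Fin n)) S]
  [IsManifold 𝓘(ℝ, EuclideanSpace ℝ (Fin n)) ∞ S] [MeasurableSpace S]

namespace FieldData

/-- The factor of a field in a vertex integral: `D⁺` to the left of the current, `D⁻` to the right
of it. -/
def factor (A : FieldData n S) (a : Label) : Ordering → Test n S → ℝ × S → ℂ
  | .lt, f, y => A.dplus f y
  | .eq, f, y => A.current a f y
  | .gt, f, y => A.dminus f y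

/-- The position of `l` relative to `k`. -/
def side {N : ℕ} (l k : Fin N) : Ordering := if l < k then .lt else if l = k then .eq else .gt

theorem truncated_add_three (A : FieldData n S) (N : ℕ) (a : Fin (N + 3) → Label)
    (f : Fin (N + 3) → Test n S) : A.truncated (N + 3) a f = (A.coupling (N + 3) : ℂ) *
      ∑ k, ∫ y, ∏ l, A.factor (a l) (side l k) (f l) y ∂A.vol := by
  rw [truncated]
  congr 1
  refine Finset.sum_congr rfl fun k _ => integral_congr_ae (Eventually.of_forall fun y =>
    Finset.prod_congr rfl fun l _ => ?_)
  simp only [side]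
  split_ifs <;> rfl

/-- The source of hermiticity: reversing the order of the fields interchanges `D⁺` and `D⁻`, while
the currents are real. -/
theorem factor_conj {A : FieldData n S} (hA : A.Admissible) (a : Label) (c : Ordering)
    (f : Test n S) (y : ℝ × S) :
    A.factor a c.swap (Test.conj f) y = conj (A.factor a c f y) := by
  cases c with
  | lt => exact A.dminus_conj f y
  | gt => exact A.dplus_conj f y
  | eq =>
    cases a with
    | inn => exact (map_zero _).symm
    | loc => exact hA.retarded.real f y
    | out => exact hA.commutator_conj f y

theorem side_rev {N : ℕ} (l k : Fin N) : side l.rev k.rev = (side l k).swap := by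
  simp only [side, Fin.rev_lt_rev, Fin.rev_inj]
  rcases lt_trichotomy l k with h | h | h
  · simp [h, h.ne, h.not_gt]
  · simp [h]
  · simp [h, h.ne', h.not_gt]

namespace Admissible

variable [T2Space S] [SecondCountableTopology S] [BorelSpace S]
  {A : FieldData n S} (hA : A.Admissible)
include hA

omit [T2Space S] [SecondCountableTopology S] [BorelSpace S] in
theorem memLp_dplus (hdisp : A.Dispersion) {N : ℕ} (hN : 3 ≤ N) (hc : A.coupling N ≠ 0)
    (f : Test n S) : MemLp (A.dplus f) N A.vol := by
  rw [← integrable_norm_rpow_iff (hA.measurable f).aestronglyMeasurable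
    (by exact_mod_cast (by omega : N ≠ 0)) (ENNReal.natCast_ne_top N)]
  simpa using hdisp N hN hc f

omit [T2Space S] [SecondCountableTopology S] [BorelSpace S] in
theorem memLp_dminus (hdisp : A.Dispersion) {N : ℕ} (hN : 3 ≤ N) (hc : A.coupling N ≠ 0)
    (f : Test n S) : MemLp (A.dminus f) N A.vol :=
  (hA.memLp_dplus hdisp hN hc (Test.conj f)).of_le (hA.measurable_dminus f).aestronglyMeasurable
    (Eventually.of_forall fun y => by simp [dminus])

theorem memLp_commutator (hdisp : A.Dispersion) {N : ℕ} (hN : 3 ≤ N) (hc : A.coupling N ≠ 0)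
    (f : Test n S) : MemLp (A.commutator f) N A.vol := by
  refine (((hA.memLp_dplus hdisp hN hc f).sub (hA.memLp_dminus hdisp hN hc f)).const_mul
    (2 * Complex.I)⁻¹).ae_eq ?_
  filter_upwards [hA.two_I_mul_commutator f] with y hy
  rw [Pi.sub_apply, ← hy, inv_mul_cancel_left₀ (mul_ne_zero two_ne_zero Complex.I_ne_zero)]

/-- On the compact set `J⁺ ∩ J⁻` of the support of `f` continuity bounds `G_r`. Elsewhere either
`G_r` vanishes or `G_a` does, and in the latter case `G_r = D`. -/
theorem memLp_Gr (hdisp : A.Dispersion) {N : ℕ} (hN : 3 ≤ N) (hc : A.coupling N ≠ 0)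
    (f : Test n S) : MemLp (A.Gr f) N A.vol := by
  have := hA.isLocallyFiniteMeasure
  have := locallyCompactSpace_spaceTime n S
  have hGr : Continuous (A.Gr f) := (hA.retarded.smooth f).continuous
  set K := A.g.future (tsupport f.1) ∩ A.g.past (tsupport f.1)
  have hK : IsCompact K := hA.globallyHyperbolic.compact_diamonds _ _ f.2.2 f.2.2
  have h1 : MemLp (K.indicator (A.Gr f)) N A.vol := by
    rw [memLp_indicator_iff_restrict hK.measurableSet]
    obtain ⟨C, hC⟩ := hK.exists_bound_of_continuousOn hGr.continuousOn
    have : IsFiniteMeasure (A.vol.restrict K) := ⟨by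
      rw [Measure.restrict_apply_univ]; exact hK.measure_lt_top⟩
    refine MemLp.of_bound hGr.aestronglyMeasurable C ?_
    filter_upwards [ae_restrict_mem hK.measurableSet] with y hy using hC y hy
  refine (h1.norm.add (hA.memLp_commutator hdisp hN hc f).norm).of_le hGr.aestronglyMeasurable
    (Eventually.of_forall fun y => ?_)
  rw [Pi.add_apply, Real.norm_of_nonneg (by positivity)]
  by_cases hy : y ∈ K
  · rw [indicator_of_mem hy]
    exact le_add_of_nonneg_right (norm_nonneg _)
  · rw [indicator_of_notMem hy, norm_zero, zero_add]
    have h0 : ∀ (J : Set (ℝ × S) → Set (ℝ × S)) (G : Test n S →ₗ[ℂ] (ℝ × S → ℂ)),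
        A.g.IsGreen A.m J G → y ∉ J (tsupport f.1) → G f y = 0 := fun J G hG hyJ =>
      image_eq_zero_of_notMem_tsupport fun h => hyJ (hG.support f h)
    by_cases hp : y ∈ A.g.past (tsupport f.1)
    · have hf : y ∉ A.g.future (tsupport f.1) := fun h => hy ⟨h, hp⟩
      rw [commutator, h0 _ _ hA.advanced hf, sub_zero]
    · rw [h0 _ _ hA.retarded hp, norm_zero]
      exact norm_nonneg _

theorem memLp_factor (hdisp : A.Dispersion) {N : ℕ} (hN : 3 ≤ N) (hc : A.coupling N ≠ 0)
    (a : Label) (c : Ordering) (f : Test n S) : MemLp (A.factor a c f) N A.vol := by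
  cases c with
  | lt => exact hA.memLp_dplus hdisp hN hc f
  | gt => exact hA.memLp_dminus hdisp hN hc f
  | eq =>
    cases a with
    | inn => exact MemLp.zero' (ε := ℂ)
    | loc => exact hA.memLp_Gr hdisp hN hc f
    | out => exact hA.memLp_commutator hdisp hN hc f

theorem integrable_prod_factor (hdisp : A.Dispersion) {N : ℕ} (hN : 3 ≤ N)
    (hc : A.coupling N ≠ 0) (a : Fin N → Label) (c : Fin N → Ordering) (f : Fin N → Test n S) :
    Integrable (fun y => ∏ l, A.factor (a l) (c l) (f l) y) A.vol := by
  have : NeZero N := ⟨by omega⟩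
  exact integrable_prod_of_memLp fun l => hA.memLp_factor hdisp hN hc _ _ _

theorem factor_add (a : Label) (c : Ordering) (f h : Test n S) :
    A.factor a c (f + h) =ᵐ[A.vol] A.factor a c f + A.factor a c h := by
  cases c with
  | lt => exact hA.dplus_add f h
  | gt => exact hA.dminus_add f h
  | eq =>
    refine Eventually.of_forall fun y => ?_
    cases a with
    | inn => simp [factor, current]
    | loc => simp [factor, current]
    | out => simp only [factor, current, commutator, map_add, Pi.add_apply]; ring

theorem factor_smul (a : Label) (c : Ordering) (r : ℂ) (f : Test n S) :
    A.factor a c (r • f) =ᵐ[A.vol] r • A.factor a c f := by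
  cases c with
  | lt => exact hA.dplus_smul r f
  | gt => exact hA.dminus_smul r f
  | eq =>
    refine Eventually.of_forall fun y => ?_
    cases a with
    | inn => simp [factor, current]
    | loc => simp [factor, current]
    | out => simp only [factor, current, commutator, map_smul, Pi.smul_apply, smul_eq_mul]; ring

theorem factor_translate (hinv : A.TimeInvariant) (hs : A.g.Stationary) (a : Label)
    (c : Ordering) (s : ℝ) (f : Test n S) :
    A.factor a c (Test.translate s f) =ᵐ[A.vol] fun y => A.factor a c f (shift (-s) y) := by
  cases c with
  | lt => exact hA.dplus_translate hinv hs s f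
  | gt => exact hA.dminus_translate hinv hs s f
  | eq =>
    refine Eventually.of_forall fun y => ?_
    cases a with
    | inn => rfl
    | loc => exact hA.Gr_translate hinv hs s f y
    | out => exact hA.commutator_translate hinv hs s f y

theorem factor_kleinGordon {a : Label} (ha : a ≠ .loc) (c : Ordering) {f f' : Test n S}
    (h : ∀ p, f'.1 p = A.g.kleinGordon A.m f.1 p) : A.factor a c f' =ᵐ[A.vol] 0 := by
  cases c with
  | lt => exact hA.dplus_kleinGordon h
  | gt => exact hA.dminus_kleinGordon h
  | eq =>
    refine Eventually.of_forall fun y => ?_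
    cases a with
    | inn => rfl
    | loc => exact absurd rfl ha
    | out => exact hA.commutator_kleinGordon h y

omit [T2Space S] [SecondCountableTopology S] [BorelSpace S] hA in
theorem _root_.QFT.FieldData.prod_factor_update (A : FieldData n S) {N : ℕ} (a : Fin N → Label)
    (c : Fin N → Ordering) (f : Fin N → Test n S) (i : Fin N) (x : Test n S) (y : ℝ × S) :
    ∏ l, A.factor (a l) (c l) (Function.update f i x l) y =
      A.factor (a i) (c i) x y *
        ∏ l ∈ Finset.univ.erase i, A.factor (a l) (c l) (f l) y := by
  rw [← Finset.mul_prod_erase _ _ (Finset.mem_univ i), Function.update_self]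
  congr 1
  refine Finset.prod_congr rfl fun l hl => ?_
  rw [Function.update_of_ne (Finset.ne_of_mem_erase hl)]

theorem truncated_update_add (hdisp : A.Dispersion) {N : ℕ} (a : Fin N → Label)
    (f : Fin N → Test n S) (i : Fin N) (x z : Test n S) :
    A.truncated N a (Function.update f i (x + z)) =
      A.truncated N a (Function.update f i x) + A.truncated N a (Function.update f i z) := by
  match N, a, f, i with
  | 0, _, _, i => exact i.elim0
  | 1, _, _, _ => simp [truncated]
  | 2, a, f, i =>
    fin_cases i
    · simp [truncated, mul_add]
    · simp [truncated, mul_add]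
  | N + 3, a, f, i =>
    simp only [truncated_add_three]
    -- For `b_N = 0` the dispersion condition gives no integrability, but the prefactor makes the
    -- claim trivial.
    by_cases hc : A.coupling (N + 3) = 0
    · simp [hc]
    rw [← mul_add, ← Finset.sum_add_distrib]
    congr 1
    refine Finset.sum_congr rfl fun k _ => ?_
    rw [← integral_add (hA.integrable_prod_factor hdisp (by omega) hc _ _ _)
      (hA.integrable_prod_factor hdisp (by omega) hc _ _ _)]
    refine integral_congr_ae ?_
    filter_upwards [hA.factor_add (a i) (side i k) x z] with y hy
    simp only [A.prod_factor_update a (fun l => side l k), hy, Pi.add_apply, add_mul]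

theorem truncated_update_smul {N : ℕ} (a : Fin N → Label)
    (f : Fin N → Test n S) (i : Fin N) (r : ℂ) (x : Test n S) :
    A.truncated N a (Function.update f i (r • x)) =
      r * A.truncated N a (Function.update f i x) := by
  match N, a, f, i with
  | 0, _, _, i => exact i.elim0
  | 1, _, _, _ => simp [truncated]
  | 2, a, f, i =>
    fin_cases i
    · simp [truncated, mul_left_comm]
    · simp [truncated, mul_left_comm]
  | N + 3, a, f, i =>
    simp only [truncated_add_three]
    rw [mul_left_comm r, Finset.mul_sum _ _ r]
    congr 1
    refine Finset.sum_congr rfl fun k _ => ?_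
    rw [← integral_const_mul]
    refine integral_congr_ae ?_
    filter_upwards [hA.factor_smul (a i) (side i k) r x] with y hy
    simp only [A.prod_factor_update a (fun l => side l k), hy, Pi.smul_apply, smul_eq_mul,
      mul_assoc]

theorem truncated_translate (hinv : A.TimeInvariant) (hs : A.g.Stationary) {N : ℕ}
    (a : Fin N → Label) (f : Fin N → Test n S) (s : ℝ) :
    A.truncated N a (fun l => Test.translate s (f l)) = A.truncated N a f := by
  match N, a, f with
  | 0, _, _ => rfl
  | 1, _, _ => rfl
  | 2, a, f => simp only [truncated]; rw [hinv]
  | N + 3, a, f =>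
    simp only [truncated_add_three]
    congr 1
    refine Finset.sum_congr rfl fun k _ => ?_
    rw [← (hA.measurePreserving_shift hs (-s)).integral_comp
      (shiftHomeo S (-s)).measurableEmbedding (fun y => ∏ l, A.factor (a l) (side l k) (f l) y)]
    refine integral_congr_ae ?_
    have : ∀ᵐ y ∂A.vol, ∀ l, A.factor (a l) (side l k) (Test.translate s (f l)) y =
        A.factor (a l) (side l k) (f l) (shift (-s) y) :=
      ae_all_iff.2 fun l => hA.factor_translate hinv hs _ _ _ _
    filter_upwards [this] with y hy
    exact Finset.prod_congr rfl fun l _ => hy l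

theorem truncated_kleinGordon {N : ℕ} (a : Fin N → Label) (f : Fin N → Test n S) (i : Fin N)
    (ha : a i ≠ .loc) {h : Test n S} (hf : ∀ p, (f i).1 p = A.g.kleinGordon A.m h.1 p) :
    A.truncated N a f = 0 := by
  match N, a, f, i with
  | 0, _, _, i => exact i.elim0
  | 1, _, _, _ => rfl
  | 2, a, f, i =>
    simp only [truncated]
    fin_cases i
    · rw [hA.kleinGordon_left h (f 0) _ hf, mul_zero]
    · rw [hA.kleinGordon_right h (f 1) _ hf, mul_zero]
  | N + 3, a, f, i =>
    rw [truncated_add_three]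
    refine mul_eq_zero_of_right _ (Finset.sum_eq_zero fun k _ => ?_)
    rw [← integral_zero (ℝ × S) ℂ (μ := A.vol)]
    refine integral_congr_ae ?_
    filter_upwards [hA.factor_kleinGordon ha (side i k) hf] with y hy
    exact Finset.prod_eq_zero (Finset.mem_univ i) hy

omit [T2Space S] [SecondCountableTopology S] [BorelSpace S] in
theorem truncated_conj_rev {N : ℕ} (a : Fin N → Label) (f : Fin N → Test n S) :
    A.truncated N (fun l => a l.rev) (fun l => Test.conj (f l.rev)) =
      conj (A.truncated N a f) := by
  match N, a, f with
  | 0, _, _ => simp [truncated]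
  | 1, _, _ => simp [truncated]
  | 2, a, f =>
    simp only [truncated, map_mul, Complex.conj_ofReal]
    have h := hA.hermitian (Test.conj (f 0)) (Test.conj (f 1))
    rw [Test.conj_conj, Test.conj_conj] at h
    rw [← h]
    rfl
  | N + 3, a, f =>
    simp only [truncated_add_three]
    rw [map_mul, Complex.conj_ofReal, map_sum, ← Equiv.sum_comp Fin.revPerm]
    congr 1
    refine Finset.sum_congr rfl fun k _ => ?_
    rw [← integral_conj]
    refine integral_congr_ae (Eventually.of_forall fun y => ?_)
    simp only
    rw [map_prod, ← Equiv.prod_comp Fin.revPerm]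
    refine Finset.prod_congr rfl fun l _ => ?_
    simp only [Fin.revPerm_apply, Fin.rev_rev]
    rw [side_rev, factor_conj hA]

omit [T2Space S] [SecondCountableTopology S] [BorelSpace S] hA in
theorem _root_.QFT.FieldData.truncated_inn (A : FieldData n S) {N : ℕ} (hN : 3 ≤ N)
    (f : Fin N → Test n S) : A.truncated N (fun _ => .inn) f = 0 := by
  match N, hN, f with
  | N + 3, _, f =>
    rw [truncated_add_three]
    refine mul_eq_zero_of_right _ (Finset.sum_eq_zero fun k _ => ?_)
    rw [← integral_zero (ℝ × S) ℂ (μ := A.vol)]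
    refine integral_congr_ae (Eventually.of_forall fun y => ?_)
    exact Finset.prod_eq_zero (Finset.mem_univ k) (by simp [side, factor, current])

end Admissible

end FieldData

end Truncated

/-! ### Spectral properties and symmetries of the truncated vacuum expectation values -/

section Tame

open FourierTransform

/-- Bounded continuous functions that satisfy the spectral condition. -/
structure Tame (G : ℝ → ℂ) : Prop where
  continuous : Continuous G
  bounded : ∃ C, ∀ t, ‖G t‖ ≤ C
  spectrum : NonnegSpectrum G

theorem tame_const (c : ℂ) : Tame fun _ => c :=
  ⟨continuous_const, ⟨‖c‖, fun _ => le_rfl⟩, nonnegSpectrum_const c⟩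

theorem Tame.mul {G H : ℝ → ℂ} (hG : Tame G) (hH : Tame H) : Tame fun t => G t * H t := by
  obtain ⟨C, hC⟩ := hG.bounded
  obtain ⟨D, hD⟩ := hH.bounded
  refine ⟨hG.continuous.mul hH.continuous, ⟨C * D, fun t => ?_⟩,
    hG.spectrum.mul hH.spectrum hG.continuous hC hH.continuous hD⟩
  rw [norm_mul]
  exact mul_le_mul (hC t) (hD t) (norm_nonneg _) ((norm_nonneg _).trans (hC t))

theorem Tame.add {G H : ℝ → ℂ} (hG : Tame G) (hH : Tame H) : Tame fun t => G t + H t := by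
  obtain ⟨C, hC⟩ := hG.bounded
  obtain ⟨D, hD⟩ := hH.bounded
  refine ⟨hG.continuous.add hH.continuous, ⟨C + D, fun t => ?_⟩,
    hG.spectrum.add hH.spectrum hG.continuous.aestronglyMeasurable hC
      hH.continuous.aestronglyMeasurable hD⟩
  exact (norm_add_le _ _).trans (add_le_add (hC t) (hD t))

theorem tame_sum {ι : Type*} (s : Finset ι) {G : ι → ℝ → ℂ} (h : ∀ i ∈ s, Tame (G i)) :
    Tame fun t => ∑ i ∈ s, G i t := by
  classical
  induction s using Finset.induction_on with
  | empty => simpa using tame_const 0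
  | insert i s hi ih =>
    simp only [Finset.sum_insert hi]
    exact (h i (Finset.mem_insert_self i s)).add
      (ih fun j hj => h j (Finset.mem_insert_of_mem hj))

theorem tame_prod {ι : Type*} (s : Finset ι) {G : ι → ℝ → ℂ} (h : ∀ i ∈ s, Tame (G i)) :
    Tame fun t => ∏ i ∈ s, G i t := by
  classical
  induction s using Finset.induction_on with
  | empty => simpa using tame_const 1
  | insert i s hi ih =>
    simp only [Finset.prod_insert hi]
    exact (h i (Finset.mem_insert_self i s)).mul
      (ih fun j hj => h j (Finset.mem_insert_of_mem hj))

/-- A constant has no energy, hence no gap: a test function whose Fourier transform is a bump at `η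
/ 2π`, supported in the positive half line, picks out exactly `c`. -/
theorem eq_zero_of_nonnegSpectrum_twist_const {η : ℝ} (hη : 0 < η) {c : ℂ}
    (h : NonnegSpectrum (twist η fun _ => c)) : c = 0 := by
  have hx : 0 < η / (2 * Real.pi) := by positivity
  set x := η / (2 * Real.pi) with hxdef
  let χ : ContDiffBump x := ⟨x / 4, x / 2, by positivity, by linarith⟩
  have hχs : ContDiff ℝ ∞ fun ξ => ((χ ξ : ℝ) : ℂ) := Complex.ofRealCLM.contDiff.comp χ.contDiff
  have hχc : HasCompactSupport fun ξ => ((χ ξ : ℝ) : ℂ) :=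
    χ.hasCompactSupport.comp_left (g := fun x : ℝ => (x : ℂ)) Complex.ofReal_zero
  let k : 𝓢(ℝ, ℂ) := hχc.toSchwartzMap hχs
  have hk : ∀ ξ, k ξ = ((χ ξ : ℝ) : ℂ) := fun ξ => rfl
  let f : 𝓢(ℝ, ℂ) := 𝓕⁻ k
  have hf : 𝓕 f = k := FourierTransform.fourier_fourierInv_eq k
  have h1 := h f fun ξ hξ => by
    rw [hf, hk, χ.zero_of_le_dist, Complex.ofReal_zero]
    rw [Real.dist_eq, abs_of_neg (by linarith)]
    simp only [χ]
    linarith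
  have h2 : ∀ t, twist η (fun _ => c) t * f (-t) =
      c * (Complex.exp (η * t * Complex.I) * f (-t)) := fun t => by
    rw [twist]; ring
  simp only [h2] at h1
  rw [integral_const_mul] at h1
  have h3 : ∫ t : ℝ, Complex.exp (η * t * Complex.I) * f (-t) = 𝓕 f x := by
    rw [SchwartzMap.fourier_coe, Real.fourier_real_eq_integral_exp_smul,
      ← integral_neg_eq_self]
    refine integral_congr_ae (Eventually.of_forall fun t => ?_)
    simp only [neg_neg, smul_eq_mul]
    congr 2
    have : (Real.pi : ℂ) ≠ 0 := by exact_mod_cast Real.pi_ne_zero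
    rw [hxdef]
    push_cast
    field_simp
  rw [h3, hf, hk, χ.one_of_mem_closedBall (Metric.mem_closedBall_self χ.rIn_pos.le)] at h1
  simpa using h1

end Tame

/-! ### Energy conservation and the spectral condition for truncated functions -/

section TruncatedSpectrum

open scoped ENNReal

variable {n : ℕ} {S : Type*} [TopologicalSpace S] [T2Space S] [SecondCountableTopology S]
  [ChartedSpace (EuclideanSpace ℝ (Fin n)) S]
  [IsManifold 𝓘(ℝ, EuclideanSpace ℝ (Fin n)) ∞ S] [MeasurableSpace S] [BorelSpace S]

omit [TopologicalSpace S] [T2Space S] [SecondCountableTopology S] [BorelSpace S] in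
theorem vectorNonnegSpectrum_lpFlow_zero {μ : Measure (ℝ × S)}
    (hμ : ∀ s, MeasurePreserving (shift s) μ μ) {N : ℕ} [NeZero N] {q : ℝ × S → ℂ}
    (hq : MemLp q N μ) :
    VectorNonnegSpectrum fun t : ℝ =>
      Complex.exp ((0 : ℝ) * t * Complex.I) • lpFlow hμ hq (0 * t) := by
  simp only [Complex.ofReal_zero, zero_mul, Complex.exp_zero, one_smul]
  exact vectorNonnegSpectrum_const _

namespace FieldData

namespace Admissible

variable {A : FieldData n S} (hA : A.Admissible)
include hA

/-- Tested with `h`, the translate of `D⁺(f, ·)` by `t` is `D⁺(f, h_t)`, so the two-point spectral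
condition applies, with or without its gap. -/
theorem vectorNonnegSpectrum_dplus {ε : ℝ} (hε : 0 < ε) (hinv : A.TimeInvariant)
    (hgap : A.SpectralGap ε) (hs : A.g.Stationary) {N : ℕ} [NeZero N] {f : Test n S}
    (hf : MemLp (A.dplus f) N A.vol) {η : ℝ} (hη : η = 0 ∨ η = ε / 2) :
    VectorNonnegSpectrum fun t : ℝ => Complex.exp (η * t * Complex.I) •
      lpFlow (hA.measurePreserving_shift hs) hf (1 * t) := by
  have := hA.isLocallyFiniteMeasure
  refine vectorNonnegSpectrum_lpFlow (n := n) _ hf 1 η fun h => ?_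
  have h1 : (fun t : ℝ => ∫ y, A.dplus f (shift (1 * t) y) * h.1 y ∂A.vol) =
      fun t => A.Dplus f (Test.translate t h) := by
    funext t
    rw [hA.represents, ← (hA.measurePreserving_shift hs t).integral_comp
      (shiftHomeo S t).measurableEmbedding (fun y => A.dplus f y * (Test.translate t h).1 y)]
    refine integral_congr_ae (Eventually.of_forall fun y => ?_)
    change A.dplus f (shift (1 * t) y) * h.1 y = A.dplus f (shift t y) * (Test.translate t h).1 (shift t y)
    simp only [Test.translate_apply, shift_neg_shift, one_mul]
  rw [h1]
  have h2 := hA.nonnegSpectrum_twist_Dplus hε hinv hgap f h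
  rcases hη with rfl | rfl
  · have h3 := nonnegSpectrum_of_twist (by positivity) h2
    have : (twist 0 fun t => A.Dplus f (Test.translate t h)) =
        fun t => A.Dplus f (Test.translate t h) := by
      funext t; simp [twist]
    rwa [this]
  · exact h2

/-- Tested with `h`, the translate of `D⁻(f, ·)` by `-t` is `D⁺(h, f_t)`. The opposite direction of
the shift is what gives `D⁻` non-negative spectrum. -/
theorem vectorNonnegSpectrum_dminus {ε : ℝ} (hε : 0 < ε) (hinv : A.TimeInvariant)
    (hgap : A.SpectralGap ε) (hs : A.g.Stationary) {N : ℕ} [NeZero N] {f : Test n S}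
    (hf : MemLp (A.dminus f) N A.vol) :
    VectorNonnegSpectrum fun t : ℝ => Complex.exp ((0 : ℝ) * t * Complex.I) •
      lpFlow (hA.measurePreserving_shift hs) hf ((-1) * t) := by
  have := hA.isLocallyFiniteMeasure
  refine vectorNonnegSpectrum_lpFlow (n := n) _ hf (-1) 0 fun h => ?_
  have h1 : (fun t : ℝ => ∫ y, A.dminus f (shift (-1 * t) y) * h.1 y ∂A.vol) =
      fun t => A.Dplus h (Test.translate t f) := by
    funext t
    have h2 := hinv t (Test.translate (-t) h) f
    rw [Test.translate_translate, neg_add_cancel, Test.translate_zero] at h2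
    rw [h2, ← hA.integral_dminus, ← (hA.measurePreserving_shift hs (-t)).integral_comp
      (shiftHomeo S (-t)).measurableEmbedding
      (fun y => A.dminus f y * (Test.translate (-t) h).1 y)]
    refine integral_congr_ae (Eventually.of_forall fun y => ?_)
    change A.dminus f (shift (-1 * t) y) * h.1 y = A.dminus f (shift (-t) y) * (Test.translate (-t) h).1 (shift (-t) y)
    simp only [Test.translate_apply, shift_shift, neg_neg, neg_mul, one_mul, neg_add_cancel,
      shift_zero]
  rw [h1]
  have h3 := nonnegSpectrum_of_twist (by positivity)
    (hA.nonnegSpectrum_twist_Dplus hε hinv hgap h f)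
  have : (twist 0 fun t => A.Dplus h (Test.translate t f)) =
      fun t => A.Dplus h (Test.translate t f) := by
    funext t; simp [twist]
  rwa [this]

/-- Energy conservation at the vertex: translating all factors does not change the integral, so as a
function of time it is constant, while its spectrum has the gap `N ε / 2`. -/
theorem integral_prod_dplus {ε : ℝ} (hε : 0 < ε) (hinv : A.TimeInvariant)
    (hgap : A.SpectralGap ε) (hs : A.g.Stationary) (hdisp : A.Dispersion) {N : ℕ} (hN : 3 ≤ N)
    (hc : A.coupling N ≠ 0) (f : Fin N → Test n S) : ∫ y, ∏ l, A.dplus (f l) y ∂A.vol = 0 := by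
  have := hA.isLocallyFiniteMeasure
  have : NeZero N := ⟨by omega⟩
  have h1 := nonnegSpectrum_integral_prod n (hA.measurePreserving_shift hs)
    (fun l => hA.memLp_dplus hdisp hN hc (f l)) (fun _ => 1) (fun _ => ε / 2)
    fun l => hA.vectorNonnegSpectrum_dplus hε hinv hgap hs _ (Or.inr rfl)
  have h2 : (fun t : ℝ => ∫ y, ∏ l, A.dplus (f l) (shift (1 * t) y) ∂A.vol) =
      fun _ => ∫ y, ∏ l, A.dplus (f l) y ∂A.vol := by
    funext t
    exact (hA.measurePreserving_shift hs (1 * t)).integral_comp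
      (shiftHomeo S (1 * t)).measurableEmbedding (fun y => ∏ l, A.dplus (f l) y)
  rw [h2] at h1
  refine eq_zero_of_nonnegSpectrum_twist_const ?_ h1
  rw [Finset.sum_const, Finset.card_univ, Fintype.card_fin, nsmul_eq_mul]
  have : (0 : ℝ) < N := by exact_mod_cast (by omega : 0 < N)
  positivity

/-- The translated fields form a right end segment. After a change of variables when `k` lies in it,
the current is at rest and only factors `D⁺` left of `k` move by `t`, or only factors `D⁻` right of
`k` move by `-t`. No spectral information on the currents is required. -/
theorem tame_truncated {ε : ℝ} (hε : 0 < ε) (hinv : A.TimeInvariant)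
    (hgap : A.SpectralGap ε) (hs : A.g.Stationary) (hdisp : A.Dispersion) {N : ℕ}
    (a : Fin N → Label) (f : Fin N → Test n S) (p : Fin N → Prop) [DecidablePred p]
    (hp : ∀ i j, i ≤ j → p i → p j) :
    Tame fun t => A.truncated N a fun l => if p l then Test.translate t (f l) else f l := by
  rcases N with _ | _ | _ | N
  · simpa only [truncated] using tame_const 0
  · simpa only [truncated] using tame_const 0
  · simp only [truncated]
    refine (tame_const _).mul ?_
    have h01 : p 0 → p 1 := hp 0 1 (by simp)
    by_cases h1 : p 1
    · by_cases h0 : p 0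
      · simp only [h0, h1, if_true, hinv _ (f 0) (f 1)]
        exact tame_const _
      · simp only [h0, h1, if_true, if_false]
        exact ⟨hA.continuous_Dplus_translate _ _, ⟨_, hA.norm_Dplus_translate_le hinv _ _⟩,
          nonnegSpectrum_of_twist (by positivity)
            (hA.nonnegSpectrum_twist_Dplus hε hinv hgap _ _)⟩
    · simp only [h1, mt h01 h1, if_false]
      exact tame_const _
  · simp only [truncated_add_three]
    by_cases hc : A.coupling (N + 3) = 0
    · simp only [hc, Complex.ofReal_zero, zero_mul]
      exact tame_const 0
    refine (tame_const _).mul (tame_sum _ fun k _ => ?_)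
    have hm := fun l => hA.memLp_factor hdisp (by omega : 3 ≤ N + 3) hc (a l) (side l k) (f l)
    have := hA.isLocallyFiniteMeasure
    have key : ∀ σ : Fin (N + 3) → ℝ,
        (∀ l, σ l = 0 ∨ (σ l = 1 ∧ l < k) ∨ (σ l = -1 ∧ k < l)) →
        Tame fun t => ∫ y, ∏ l, A.factor (a l) (side l k) (f l) (shift (σ l * t) y) ∂A.vol := by
      intro σ hσ
      refine ⟨continuous_integral_prod n (hA.measurePreserving_shift hs) hm σ,
        ⟨_, norm_integral_prod_shift_le (hA.measurePreserving_shift hs) hm σ⟩, ?_⟩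
      have h1 := nonnegSpectrum_integral_prod n (hA.measurePreserving_shift hs) hm σ
        (fun _ => 0) fun l => ?_
      · simp only [Finset.sum_const_zero] at h1
        convert h1 using 1
        funext t; simp [twist]
      · have hml := hm l
        rcases hσ l with h | ⟨h, hlk⟩ | ⟨h, hlk⟩
        · rw [h]
          exact vectorNonnegSpectrum_lpFlow_zero _ _
        · rw [h]
          have h2 : A.factor (a l) (side l k) (f l) = A.dplus (f l) := by
            simp only [side, hlk, if_true]; rfl
          have h3 : MemLp (A.dplus (f l)) ((N + 3 : ℕ) : ℝ≥0∞) A.vol := h2 ▸ hml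
          have h4 := hA.vectorNonnegSpectrum_dplus hε hinv hgap hs h3 (Or.inl rfl)
          convert h4 using 6
        · rw [h]
          have h2 : A.factor (a l) (side l k) (f l) = A.dminus (f l) := by
            simp only [side, hlk.not_gt, hlk.ne', if_false]; rfl
          have h3 : MemLp (A.dminus (f l)) ((N + 3 : ℕ) : ℝ≥0∞) A.vol := h2 ▸ hml
          have h4 := hA.vectorNonnegSpectrum_dminus hε hinv hgap hs h3
          convert h4 using 6
    have htr : ∀ t, ∀ᵐ y ∂A.vol, ∀ l, A.factor (a l) (side l k)
        (if p l then Test.translate t (f l) else f l) y =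
        A.factor (a l) (side l k) (f l) (shift ((if p l then -1 else 0) * t) y) := by
      intro t
      refine ae_all_iff.2 fun l => ?_
      by_cases hl : p l
      · simp only [hl, if_true, neg_mul, one_mul]
        exact hA.factor_translate hinv hs _ _ _ _
      · simp [hl]
    -- If the current is translated, so are all fields to its right; the shift of the integration
    -- point moves the remaining fields instead.
    by_cases hk : p k
    · have h5 := key (fun l => if p l then 0 else 1) fun l => by
        by_cases hl : p l
        · simp [hl]
        · refine Or.inr (Or.inl ⟨by simp [hl], ?_⟩)
          by_contra hlt
          exact hl (hp k l (not_lt.1 hlt) hk)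
      convert h5 using 1
      funext t
      rw [← (hA.measurePreserving_shift hs (-t)).integral_comp
        (shiftHomeo S (-t)).measurableEmbedding (fun y => ∏ l, A.factor (a l) (side l k) (f l)
          (shift ((if p l then 0 else 1) * t) y))]
      refine integral_congr_ae ?_
      filter_upwards [htr t] with y hy
      refine Finset.prod_congr rfl fun l _ => ?_
      rw [hy l, shift_shift]
      by_cases hl : p l <;> simp [hl]
    · have h5 := key (fun l => if p l then -1 else 0) fun l => by
        by_cases hl : p l
        · refine Or.inr (Or.inr ⟨by simp [hl], ?_⟩)
          by_contra hlt
          exact hk (hp l k (not_lt.1 hlt) hl)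
        · simp [hl]
      convert h5 using 1
      funext t
      refine integral_congr_ae ?_
      filter_upwards [htr t] with y hy
      exact Finset.prod_congr rfl fun l _ => hy l

end Admissible

end FieldData

end TruncatedSpectrum

/-! ### Truncated vacuum expectation values of words of fields -/

section Words

open scoped ENNReal

variable {n : ℕ} {S : Type*} [TopologicalSpace S]
  [ChartedSpace (EuclideanSpace ℝ (Fin n)) S]
  [IsManifold 𝓘(ℝ, EuclideanSpace ℝ (Fin n)) ∞ S] [MeasurableSpace S]

namespace FieldData

/-- The product of the functions `D⁺(f, ·)` over a word of fields. -/
def plusProd (A : FieldData n S) (l : List (Label × Test n S)) (y : ℝ × S) : ℂ :=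
  (l.map fun x => A.dplus x.2 y).prod

/-- The product of the functions `D⁻(f, ·)` over a word of fields. -/
def minusProd (A : FieldData n S) (l : List (Label × Test n S)) (y : ℝ × S) : ℂ :=
  (l.map fun x => A.dminus x.2 y).prod

/-- The integrand of the truncated vacuum expectation value of a word of fields. -/
def vertexDensity (A : FieldData n S) : List (Label × Test n S) → ℝ × S → ℂ
  | [], _ => 0
  | x :: l, y => A.current x.1 x.2 y * A.minusProd l y + A.dplus x.2 y * vertexDensity A l y

/-- The truncated vacuum expectation value of a word of fields. -/
def truncatedWord (A : FieldData n S) (l : List (Label × Test n S)) : ℂ :=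
  A.truncated l.length (fun i => (l.get i).1) (fun i => (l.get i).2)

variable (A : FieldData n S)

theorem plusProd_cons (x : Label × Test n S) (l : List (Label × Test n S)) (y : ℝ × S) :
    A.plusProd (x :: l) y = A.dplus x.2 y * A.plusProd l y := by
  simp [plusProd]

theorem minusProd_cons (x : Label × Test n S) (l : List (Label × Test n S)) (y : ℝ × S) :
    A.minusProd (x :: l) y = A.dminus x.2 y * A.minusProd l y := by
  simp [minusProd]

theorem plusProd_append (u v : List (Label × Test n S)) (y : ℝ × S) :
    A.plusProd (u ++ v) y = A.plusProd u y * A.plusProd v y := by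
  simp [plusProd]

theorem minusProd_append (u v : List (Label × Test n S)) (y : ℝ × S) :
    A.minusProd (u ++ v) y = A.minusProd u y * A.minusProd v y := by
  simp [minusProd]

/-- Leibniz rule: the current sits in `u` or in `v`, and the other word contributes factors `D⁻`
when it is on the right, `D⁺` when it is on the left. -/
theorem vertexDensity_append (u v : List (Label × Test n S)) (y : ℝ × S) :
    A.vertexDensity (u ++ v) y =
      A.vertexDensity u y * A.minusProd v y + A.plusProd u y * A.vertexDensity v y := by
  induction u with
  | nil => simp [vertexDensity, plusProd]
  | cons x u ih =>
    simp only [List.cons_append, vertexDensity, ih, minusProd_append, plusProd_cons]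
    ring

theorem vertexDensity_ofFn {N : ℕ} (x : Fin N → Label × Test n S) (y : ℝ × S) :
    A.vertexDensity (List.ofFn x) y =
      ∑ k, ∏ l, A.factor (x l).1 (side l k) (x l).2 y := by
  induction N with
  | zero => simp [vertexDensity]
  | succ N ih =>
    rw [List.ofFn_succ, vertexDensity, ih, Fin.sum_univ_succ]
    congr 1
    · rw [Fin.prod_univ_succ]
      have h0 : side (0 : Fin (N + 1)) 0 = .eq := by simp [side]
      have h1 : ∀ l : Fin N, side l.succ 0 = .gt := fun l => by
        simp [side]
      simp only [h0, h1, factor, minusProd, List.map_ofFn, List.prod_ofFn]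
      rfl
    · rw [Finset.mul_sum]
      refine Finset.sum_congr rfl fun k _ => ?_
      rw [Fin.prod_univ_succ]
      have h0 : side (0 : Fin (N + 1)) k.succ = .lt := by simp [side]
      have h1 : ∀ l : Fin N, side l.succ k.succ = side l k := fun l => by
        simp [side]
      simp only [h0, h1]
      rfl

theorem truncatedWord_ofFn {N : ℕ} (x : Fin N → Label × Test n S) :
    A.truncatedWord (List.ofFn x) = A.truncated N (fun i => (x i).1) (fun i => (x i).2) := by
  have key : ∀ (M : ℕ) (h : M = N) (z : Fin M → Label × Test n S), (∀ i, z i = x (Fin.cast h i)) →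
      A.truncated M (fun i => (z i).1) (fun i => (z i).2) =
        A.truncated N (fun i => (x i).1) (fun i => (x i).2) := by
    rintro M rfl z hz
    simp only [hz, Fin.cast_eq_self]
  exact key _ List.length_ofFn _ fun i => by simp [Fin.cast]

theorem truncatedWord_pair (x x' : Label × Test n S) :
    A.truncatedWord [x, x'] = ((A.b ^ 2 / A.m ^ 2 : ℝ) : ℂ) * A.Dplus x.2 x'.2 := rfl

theorem truncatedWord_singleton (x : Label × Test n S) : A.truncatedWord [x] = 0 := rfl

theorem _root_.QFT.wordOf_eq_ofFn {α ι : Type*} [LinearOrder ι] (x : ι → α) (B : Finset ι) {k : ℕ}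
    (h : B.card = k) : wordOf x B = List.ofFn fun i => x (B.orderEmbOfFin h i) := by
  rw [wordOf, ← Finset.listMap_orderEmbOfFin_finRange B h, List.map_map, List.ofFn_eq_map]
  rfl

theorem _root_.QFT.wordOf_univ_eq_ofFn {α : Type*} {N : ℕ} (x : Fin N → α) :
    wordOf x Finset.univ = List.ofFn x := by
  have h : (Finset.univ : Finset (Fin N)).orderEmbOfFin (Finset.card_fin _) =
      RelEmbedding.refl _ := by
    apply DFunLike.coe_injective
    symm
    exact Finset.orderEmbOfFin_unique _ (fun _ => Finset.mem_univ _) strictMono_id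
  rw [wordOf_eq_ofFn x _ (Finset.card_fin N), h]
  rfl

theorem vev_eq_partitionSum {N : ℕ} (a : Fin N → Label) (f : Fin N → Test n S) :
    A.vev a f = partitionSum (fun B => A.truncatedWord (wordOf (fun i => (a i, f i)) B))
      Finset.univ := by
  refine Finset.sum_congr rfl fun P _ => Finset.prod_congr rfl fun B _ => ?_
  change _ = A.truncatedWord (wordOf (fun i => (a i, f i)) B)
  rw [wordOf_eq_ofFn _ B rfl, truncatedWord_ofFn]
  rfl

theorem vev_eq_clustered {N : ℕ} (a : Fin N → Label) (f : Fin N → Test n S) :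
    A.vev a f = clustered A.truncatedWord (List.ofFn fun i => (a i, f i)) := by
  rw [vev_eq_partitionSum, partitionSum_wordOf, wordOf_univ_eq_ofFn]

end FieldData

end Words

/-! ### Vertex integrals of asymptotic fields -/

section VertexIntegrals

variable {n : ℕ} {S : Type*} [TopologicalSpace S] [T2Space S] [SecondCountableTopology S]
  [ChartedSpace (EuclideanSpace ℝ (Fin n)) S]
  [IsManifold 𝓘(ℝ, EuclideanSpace ℝ (Fin n)) ∞ S] [MeasurableSpace S] [BorelSpace S]

namespace FieldData

namespace Admissible

variable {A : FieldData n S} (hA : A.Admissible)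
include hA

theorem integrable_vertexDensity (hdisp : A.Dispersion) {l : List (Label × Test n S)}
    (hl : 3 ≤ l.length) (hc : A.coupling l.length ≠ 0) :
    Integrable (A.vertexDensity l) A.vol := by
  have h1 : A.vertexDensity l = fun y => ∑ k, ∏ i, A.factor (l.get i).1 (side i k) (l.get i).2 y := by
    funext y
    rw [← vertexDensity_ofFn, List.ofFn_get]
  rw [h1]
  exact integrable_finsetSum _ fun k _ => hA.integrable_prod_factor hdisp hl hc _ _ _

theorem truncatedWord_eq_integral (hdisp : A.Dispersion) {l : List (Label × Test n S)}
    (hl : 3 ≤ l.length) :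
    A.truncatedWord l = (A.coupling l.length : ℂ) * ∫ y, A.vertexDensity l y ∂A.vol := by
  obtain ⟨N, hN⟩ : ∃ N, l.length = N + 3 := ⟨l.length - 3, by omega⟩
  have h0 : ∀ y, A.vertexDensity l y =
      ∑ k, ∏ i, A.factor (l.get i).1 (side i k) (l.get i).2 y := fun y => by
    rw [← vertexDensity_ofFn, List.ofFn_get]
  rw [truncatedWord]
  simp only [h0]
  have key : ∀ (M : ℕ), M = N + 3 → ∀ x : Fin M → Label × Test n S,
      A.truncated M (fun i => (x i).1) (fun i => (x i).2) = (A.coupling M : ℂ) *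
        ∫ y, ∑ k, ∏ i, A.factor (x i).1 (side i k) (x i).2 y ∂A.vol := by
    rintro M rfl x
    rw [truncated_add_three]
    by_cases hc : A.coupling (N + 3) = 0
    · simp [hc]
    rw [integral_finsetSum _ fun k _ => hA.integrable_prod_factor hdisp (by omega) hc _ _ _]
  exact key _ hN _

theorem integrable_plusProd (hdisp : A.Dispersion) {l : List (Label × Test n S)}
    (hl : 3 ≤ l.length) (hc : A.coupling l.length ≠ 0) :
    Integrable (A.plusProd l) A.vol := by
  have h1 : A.plusProd l = fun y => ∏ i : Fin l.length, A.dplus (l.get i).2 y := by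
    funext y
    rw [← List.prod_ofFn, List.ofFn_eq_map, plusProd]
    conv_lhs => rw [← List.map_get_finRange l, List.map_map]
    rfl
  rw [h1]
  exact hA.integrable_prod_factor hdisp hl hc (fun _ => .inn) (fun _ => .lt) _

theorem integral_plusProd {ε : ℝ} (hε : 0 < ε) (hinv : A.TimeInvariant)
    (hgap : A.SpectralGap ε) (hs : A.g.Stationary) (hdisp : A.Dispersion)
    {l : List (Label × Test n S)} (hl : 3 ≤ l.length) (hc : A.coupling l.length ≠ 0) :
    ∫ y, A.plusProd l y ∂A.vol = 0 := by
  rw [← hA.integral_prod_dplus hε hinv hgap hs hdisp hl hc fun i => (l.get i).2]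
  refine integral_congr_ae (Eventually.of_forall fun y => ?_)
  simp only
  rw [← List.prod_ofFn, List.ofFn_eq_map, plusProd]
  conv_lhs => rw [← List.map_get_finRange l, List.map_map]
  rfl

theorem integral_minusProd {ε : ℝ} (hε : 0 < ε) (hinv : A.TimeInvariant)
    (hgap : A.SpectralGap ε) (hs : A.g.Stationary) (hdisp : A.Dispersion)
    {l : List (Label × Test n S)} (hl : 3 ≤ l.length) (hc : A.coupling l.length ≠ 0) :
    ∫ y, A.minusProd l y ∂A.vol = 0 := by
  have h1 : ∀ y, A.minusProd l y =
      conj (A.plusProd (l.map fun x => (x.1, Test.conj x.2)) y) := fun y => by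
    rw [plusProd, minusProd, map_list_prod, List.map_map, List.map_map]
    rfl
  simp only [h1]
  rw [integral_conj, hA.integral_plusProd hε hinv hgap hs hdisp (by simpa using hl)
    (by simpa using hc), map_zero]

/-- A word of out-fields contributes to a vertex through `(∏ D⁺ - ∏ D⁻) / 2i`. -/
theorem vertexDensity_out (w : List (Test n S)) :
    ∀ᵐ y ∂A.vol, 2 * Complex.I * A.vertexDensity (w.map (Prod.mk Label.out)) y =
      A.plusProd (w.map (Prod.mk Label.out)) y - A.minusProd (w.map (Prod.mk Label.out)) y := by
  induction w with
  | nil => exact ae_of_all _ fun y => by simp [vertexDensity, plusProd, minusProd]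
  -- One step of the telescoping sum: `D⁺ ∏ D⁺ - D⁻ ∏ D⁻` is `(D⁺ - D⁻) ∏ D⁻` plus `D⁺ (∏ D⁺ - ∏
  -- D⁻)`.
  | cons f w ih =>
    filter_upwards [ih, hA.two_I_mul_commutator f] with y h1 h2
    simp only [List.map_cons, vertexDensity, plusProd_cons, minusProd_cons, current]
    linear_combination A.minusProd (w.map (Prod.mk Label.out)) y * h2 + A.dplus f y * h1

omit hA [T2Space S] [SecondCountableTopology S] [BorelSpace S] in
theorem _root_.QFT.FieldData.vertexDensity_inn (w : List (Test n S)) (y : ℝ × S) :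
    A.vertexDensity (w.map (Prod.mk Label.inn)) y = 0 := by
  induction w with
  | nil => rfl
  | cons f w ih => simp [vertexDensity, current, ih]

/-- After telescoping, the integrand consists of `∏ D⁺` and `∏ D⁻`, whose integrals vanish
separately by energy conservation. -/
theorem truncatedWord_out {ε : ℝ} (hε : 0 < ε) (hinv : A.TimeInvariant)
    (hgap : A.SpectralGap ε) (hs : A.g.Stationary) (hdisp : A.Dispersion)
    {w : List (Test n S)} (hw : 3 ≤ w.length) :
    A.truncatedWord (w.map (Prod.mk Label.out)) = 0 := by
  have hl : 3 ≤ (w.map (Prod.mk Label.out)).length := by simpa using hw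
  rw [hA.truncatedWord_eq_integral hdisp hl]
  by_cases hc : A.coupling (w.map (Prod.mk Label.out)).length = 0
  · rw [hc, Complex.ofReal_zero, zero_mul]
  have h1 : 2 * Complex.I * ∫ y, A.vertexDensity (w.map (Prod.mk Label.out)) y ∂A.vol = 0 := by
    rw [← integral_const_mul, integral_congr_ae (hA.vertexDensity_out w)]
    have hint := hA.integrable_plusProd hdisp hl hc
    -- Integrability of `∏ D⁻` comes from the telescoping identity, whose other two terms are
    -- integrable.
    have hint' : Integrable (A.minusProd (w.map (Prod.mk Label.out))) A.vol := by
      refine (hint.sub ((hA.integrable_vertexDensity hdisp hl hc).const_mul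
        (2 * Complex.I))).congr ?_
      filter_upwards [hA.vertexDensity_out w] with y hy
      simp only [Pi.sub_apply, hy, sub_sub_cancel]
    rw [integral_sub hint hint', hA.integral_plusProd hε hinv hgap hs hdisp hl hc,
      hA.integral_minusProd hε hinv hgap hs hdisp hl hc, sub_zero]
  have h2 : (2 * Complex.I : ℂ) ≠ 0 := by simp
  rw [(mul_eq_zero.1 h1).resolve_left h2, mul_zero]

theorem truncatedWord_inn (hdisp : A.Dispersion) {w : List (Test n S)} (hw : 3 ≤ w.length) :
    A.truncatedWord (w.map (Prod.mk Label.inn)) = 0 := by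
  rw [hA.truncatedWord_eq_integral hdisp (by simpa using hw)]
  simp [vertexDensity_inn]

/-- The telescoped form is visibly symmetric in the letters; for in-fields both sides are zero. -/
theorem vertexDensity_swap {a : Label} (ha : a ≠ .loc) (f h : Test n S) :
    A.vertexDensity [(a, f), (a, h)] =ᵐ[A.vol] A.vertexDensity [(a, h), (a, f)] := by
  cases a with
  | inn => exact ae_of_all _ fun y => by simp [vertexDensity, current]
  | loc => exact absurd rfl ha
  | out =>
    filter_upwards [hA.vertexDensity_out [f, h], hA.vertexDensity_out [h, f]] with y h1 h2
    have h3 : (2 * Complex.I : ℂ) ≠ 0 := by simp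
    refine mul_left_cancel₀ h3 ?_
    simp only [List.map_cons, List.map_nil] at h1 h2
    rw [h1, h2]
    simp [plusProd, minusProd, mul_comm]

/-- The truncated vacuum expectation values of more than two fields are symmetric in neighbouring
asymptotic fields. -/
theorem truncatedWord_swap (hdisp : A.Dispersion) {a : Label} (ha : a ≠ .loc) (f h : Test n S)
    {u v : List (Label × Test n S)} (huv : u ++ v ≠ []) :
    A.truncatedWord (u ++ (a, f) :: (a, h) :: v) = A.truncatedWord (u ++ (a, h) :: (a, f) :: v) := by
  have hlen : 1 ≤ u.length + v.length := by
    rw [← List.length_append]; exact List.length_pos_iff.2 huv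
  rw [hA.truncatedWord_eq_integral hdisp (by simp; omega),
    hA.truncatedWord_eq_integral hdisp (by simp; omega)]
  have e : ∀ f h : Test n S, u ++ (a, f) :: (a, h) :: v = u ++ ([(a, f), (a, h)] ++ v) :=
    fun _ _ => rfl
  rw [e, e]
  congr 1
  · simp
  refine integral_congr_ae ?_
  filter_upwards [hA.vertexDensity_swap ha f h] with y hy
  simp only [vertexDensity_append, minusProd_append, hy]
  simp only [plusProd, minusProd, List.map_cons, List.map_nil, List.prod_cons, List.prod_nil]
  ring

/-- A word of asymptotic fields at the right end enters a vertex through `∏ D⁻`. -/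
theorem exists_kernel {ε : ℝ} (hε : 0 < ε) (hinv : A.TimeInvariant)
    (hgap : A.SpectralGap ε) (hs : A.g.Stationary) (hdisp : A.Dispersion) {a : Label}
    (ha : a ≠ .loc) (l : List (Label × Test n S)) :
    ∃ R : ℝ × S → ℂ, ∀ w : List (Test n S), 3 ≤ l.length + w.length →
      A.coupling (l.length + w.length) ≠ 0 →
      Integrable (fun y => R y * (w.map fun h => A.dminus h y).prod) A.vol ∧
      ∫ y, A.vertexDensity (l ++ w.map (Prod.mk a)) y ∂A.vol =
        ∫ y, R y * (w.map fun h => A.dminus h y).prod ∂A.vol := by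
  have hM : ∀ (a : Label) (w : List (Test n S)) (y : ℝ × S),
      A.minusProd (w.map (Prod.mk a)) y = (w.map fun h => A.dminus h y).prod := fun a w y => by
    rw [minusProd, List.map_map]; rfl
  have hinn : ∀ w : List (Test n S), 3 ≤ l.length + w.length →
      A.coupling (l.length + w.length) ≠ 0 →
      Integrable (fun y => A.vertexDensity l y * (w.map fun h => A.dminus h y).prod) A.vol := by
    intro w hw hc
    refine (hA.integrable_vertexDensity hdisp (l := l ++ w.map (Prod.mk Label.inn))
      (by simpa using hw) (by simpa using hc)).congr (ae_of_all _ fun y => ?_)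
    simp only [vertexDensity_append, vertexDensity_inn, hM, mul_zero, add_zero]
  cases a with
  | inn =>
    refine ⟨A.vertexDensity l, fun w hw hc => ⟨hinn w hw hc, ?_⟩⟩
    refine integral_congr_ae (ae_of_all _ fun y => ?_)
    simp only [vertexDensity_append, vertexDensity_inn, hM, mul_zero, add_zero]
  | loc => exact absurd rfl ha
  | out =>
    -- By the Leibniz rule and telescoping, the density of `l ++ w` is `R ∏_w D⁻` plus `(2i)⁻¹ ∏ D⁺`
    -- over the whole word; the last term has integral zero.
    refine ⟨fun y => A.vertexDensity l y - (2 * Complex.I)⁻¹ * A.plusProd l y,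
      fun w hw hc => ?_⟩
    have hlw : 3 ≤ (l ++ w.map (Prod.mk Label.out)).length := by simpa using hw
    have hclw : A.coupling (l ++ w.map (Prod.mk Label.out)).length ≠ 0 := by simpa using hc
    have hP := hA.integrable_plusProd hdisp hlw hclw
    have hK := hA.integrable_vertexDensity hdisp hlw hclw
    have h3 : (2 * Complex.I : ℂ) ≠ 0 := by simp
    have hae : ∀ᵐ y ∂A.vol,
        (A.vertexDensity l y - (2 * Complex.I)⁻¹ * A.plusProd l y) *
          (w.map fun h => A.dminus h y).prod =
        A.vertexDensity (l ++ w.map (Prod.mk Label.out)) y -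
          (2 * Complex.I)⁻¹ * A.plusProd (l ++ w.map (Prod.mk Label.out)) y := by
      filter_upwards [hA.vertexDensity_out w] with y hy
      have hy' : A.vertexDensity (w.map (Prod.mk Label.out)) y = (2 * Complex.I)⁻¹ *
          (A.plusProd (w.map (Prod.mk Label.out)) y -
            A.minusProd (w.map (Prod.mk Label.out)) y) := by
        rw [← hy, inv_mul_cancel_left₀ h3]
      simp only [vertexDensity_append, plusProd_append, hy', ← hM Label.out w y]
      ring
    refine ⟨(hK.sub (hP.const_mul _)).congr (by filter_upwards [hae] with y hy; exact hy.symm), ?_⟩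
    rw [integral_congr_ae hae, integral_sub hK (hP.const_mul _), integral_const_mul,
      hA.integral_plusProd hε hinv hgap hs hdisp hlw hclw, mul_zero, sub_zero]

end Admissible

end FieldData

end VertexIntegrals

/-! ### The functional of the mixed vacuum expectation values -/

instance : Fintype Label := ⟨{.inn, .loc, .out}, fun a => by cases a <;> simp⟩

section Functional

variable {n : ℕ} {S : Type*} [TopologicalSpace S] [T2Space S] [SecondCountableTopology S]
  [ChartedSpace (EuclideanSpace ℝ (Fin n)) S]
  [IsManifold 𝓘(ℝ, EuclideanSpace ℝ (Fin n)) ∞ S] [MeasurableSpace S] [BorelSpace S]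

namespace FieldData

omit [T2Space S] [SecondCountableTopology S] [BorelSpace S] in
/-- Summation over the block of the `i`-th field. -/
theorem vev_eq_sum_block (A : FieldData n S) {N : ℕ} (a : Fin N → Label) (f : Fin N → Test n S)
    (i : Fin N) : A.vev a f = ∑ B : Finset (Fin N) with i ∈ B,
      A.truncated B.card (a ∘ B.orderEmbOfFin rfl) (f ∘ B.orderEmbOfFin rfl) *
      partitionSum (fun C => A.truncated C.card (a ∘ C.orderEmbOfFin rfl)
        (f ∘ C.orderEmbOfFin rfl)) (Finset.univ \ B) := by
  have h : A.vev a f = partitionSum (fun C => A.truncated C.card (a ∘ C.orderEmbOfFin rfl)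
        (f ∘ C.orderEmbOfFin rfl)) Finset.univ := rfl
  rw [h, partitionSum_eq_sum_block _ (Finset.mem_univ i), Finset.powerset_univ]

omit [T2Space S] [SecondCountableTopology S] [BorelSpace S] in
theorem vev_update_eq_sum_block (A : FieldData n S) {N : ℕ} (a : Fin N → Label)
    (f : Fin N → Test n S) (i : Fin N) (x : Test n S) :
    A.vev a (Function.update f i x) = ∑ B : Finset (Fin N) with i ∈ B,
      A.truncated B.card (a ∘ B.orderEmbOfFin rfl)
        (Function.update f i x ∘ B.orderEmbOfFin rfl) *
      partitionSum (fun C => A.truncated C.card (a ∘ C.orderEmbOfFin rfl)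
        (f ∘ C.orderEmbOfFin rfl)) (Finset.univ \ B) := by
  rw [vev_eq_sum_block A a _ i]
  refine Finset.sum_congr rfl fun B hB => ?_
  congr 1
  refine partitionSum_congr fun C hC => ?_
  rw [Function.update_comp_eq_of_forall_ne]
  intro j hj
  have h1 : i ∈ C := hj ▸ C.orderEmbOfFin_mem rfl j
  exact (Finset.mem_sdiff.1 (hC h1)).2 (Finset.mem_filter.1 hB).2

theorem exists_update_comp_orderEmbOfFin {α : Type*} {N : ℕ} {B : Finset (Fin N)} {i : Fin N}
    (hi : i ∈ B) : ∃ j, B.orderEmbOfFin rfl j = i ∧ ∀ (f : Fin N → α) (x : α),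
      Function.update f i x ∘ B.orderEmbOfFin rfl =
        Function.update (f ∘ B.orderEmbOfFin rfl) j x := by
  have h1 : i ∈ Set.range (B.orderEmbOfFin rfl) := by rw [Finset.range_orderEmbOfFin]; exact hi
  obtain ⟨j, rfl⟩ := h1
  exact ⟨j, rfl, fun f x =>
    Function.update_comp_eq_of_injective f (B.orderEmbOfFin rfl).injective j x⟩

namespace Admissible

variable {A : FieldData n S} (hA : A.Admissible)
include hA

theorem vev_update_add (hdisp : A.Dispersion) {N : ℕ} (a : Fin N → Label) (f : Fin N → Test n S)
    (i : Fin N) (x z : Test n S) : A.vev a (Function.update f i (x + z)) =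
      A.vev a (Function.update f i x) + A.vev a (Function.update f i z) := by
  simp only [vev_update_eq_sum_block, ← Finset.sum_add_distrib]
  refine Finset.sum_congr rfl fun B hB => ?_
  obtain ⟨j, -, hj⟩ := exists_update_comp_orderEmbOfFin (α := Test n S) (Finset.mem_filter.1 hB).2
  rw [hj, hj, hj, hA.truncated_update_add hdisp, add_mul]

theorem vev_update_smul {N : ℕ} (a : Fin N → Label) (f : Fin N → Test n S)
    (i : Fin N) (c : ℂ) (x : Test n S) : A.vev a (Function.update f i (c • x)) =
      c * A.vev a (Function.update f i x) := by
  simp only [vev_update_eq_sum_block, Finset.mul_sum]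
  refine Finset.sum_congr rfl fun B hB => ?_
  obtain ⟨j, -, hj⟩ := exists_update_comp_orderEmbOfFin (α := Test n S) (Finset.mem_filter.1 hB).2
  rw [hj, hj, hA.truncated_update_smul, mul_assoc]

theorem vev_kleinGordon {N : ℕ} (a : Fin N → Label) (f : Fin N → Test n S) (i : Fin N)
    (ha : a i ≠ .loc) {h : Test n S} (hf : ∀ p, (f i).1 p = A.g.kleinGordon A.m h.1 p) :
    A.vev a f = 0 := by
  rw [vev_eq_sum_block A a f i]
  refine Finset.sum_eq_zero fun B hB => mul_eq_zero_of_left ?_ _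
  obtain ⟨j, rfl, -⟩ := exists_update_comp_orderEmbOfFin (α := Test n S) (Finset.mem_filter.1 hB).2
  exact hA.truncated_kleinGordon _ _ j ha hf

theorem vev_translate (hinv : A.TimeInvariant) (hs : A.g.Stationary) {N : ℕ}
    (a : Fin N → Label) (f : Fin N → Test n S) (s : ℝ) :
    A.vev a (fun l => Test.translate s (f l)) = A.vev a f :=
  Finset.sum_congr rfl fun _ _ => Finset.prod_congr rfl fun B _ =>
    hA.truncated_translate hinv hs _ (f ∘ B.orderEmbOfFin rfl) s

omit [T2Space S] [SecondCountableTopology S] [BorelSpace S] in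
theorem vev_conj_rev {N : ℕ} (a : Fin N → Label) (f : Fin N → Test n S) :
    A.vev (fun l => a l.rev) (fun l => Test.conj (f l.rev)) = conj (A.vev a f) := by
  have hu : (Finset.univ : Finset (Fin N)) = Finset.univ.map Fin.revPerm.toEmbedding := by simp
  rw [vev_eq_partitionSum, vev_eq_partitionSum]
  conv_lhs => rw [hu]
  rw [partitionSum_map, partitionSum, partitionSum, map_sum]
  refine Finset.sum_congr rfl fun P _ => ?_
  rw [map_prod]
  refine Finset.prod_congr rfl fun B _ => ?_
  have hc : (B.map Fin.revPerm.toEmbedding).card = B.card := Finset.card_map _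
  -- Reversing both the positions and the values makes the enumeration of the reflected block
  -- increasing again.
  have he : (fun i => (B.orderEmbOfFin rfl i.rev).rev) =
      (B.map Fin.revPerm.toEmbedding).orderEmbOfFin hc := by
    refine Finset.orderEmbOfFin_unique hc (fun i => ?_) fun i j hij => ?_
    · exact Finset.mem_map_of_mem Fin.revPerm.toEmbedding (B.orderEmbOfFin_mem rfl i.rev)
    · rw [Fin.rev_lt_rev]
      exact (B.orderEmbOfFin rfl).strictMono (Fin.rev_lt_rev.2 hij)
  rw [wordOf_eq_ofFn _ _ hc, wordOf_eq_ofFn _ B rfl, truncatedWord_ofFn, truncatedWord_ofFn,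
    ← truncated_conj_rev hA, ← he]
  simp only [Fin.rev_rev]

/-- The vacuum expectation values as multilinear maps. -/
def vevMultilinear (hdisp : A.Dispersion) {N : ℕ} (a : Fin N → Label) :
    MultilinearMap ℂ (fun _ : Fin N => Test n S) ℂ where
  toFun := A.vev a
  map_update_add' f i x z := by
    convert hA.vev_update_add hdisp a f i x z
  map_update_smul' f i c x := by
    rw [smul_eq_mul]
    convert hA.vev_update_smul a f i c x

/-- The functional of the mixed vacuum expectation values. -/
def formFactor (hdisp : A.Dispersion) : Borchers n S →ₗ[ℂ] ℂ :=
  (DirectSum.toModule ℂ ℕ ℂ fun N => PiTensorProduct.lift (∑ a : Fin N → Label,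
    (hA.vevMultilinear hdisp a).compLinearMap fun i => LinearMap.proj (a i))) ∘ₗ
  TensorAlgebra.toDirectSum.toLinearMap

/-- `formFactor` sums over all assignments of labels to the arguments. On a tensor of functions with
a single component only one assignment survives. -/
theorem isFormFactor_formFactor (hdisp : A.Dispersion) :
    A.IsFormFactor (hA.formFactor hdisp) := by
  intro N a f
  have h1 : (List.ofFn fun i => gen (a i) (f i)).prod =
      TensorAlgebra.tprod ℂ (ExtTest n S) N fun i => Pi.single (a i) (f i) := by
    rw [TensorAlgebra.tprod_apply]; rfl
  rw [h1, formFactor, LinearMap.comp_apply, AlgHom.toLinearMap_apply,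
    TensorAlgebra.toDirectSum_tensorPower_tprod]
  change DirectSum.toModule ℂ ℕ ℂ _ (DirectSum.lof ℂ ℕ _ N _) = _
  rw [DirectSum.toModule_lof, PiTensorProduct.lift.tprod, sum_apply,
    Finset.sum_eq_single a]
  · simp only [MultilinearMap.compLinearMap_apply, LinearMap.proj_apply, Pi.single_eq_same]
    rfl
  · intro a' _ ha'
    obtain ⟨i, hi⟩ := Function.ne_iff.1 ha'
    rw [MultilinearMap.compLinearMap_apply]
    refine MultilinearMap.map_coord_zero _ i ?_
    rw [LinearMap.proj_apply, Pi.single_eq_of_ne hi]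
  · simp

end Admissible

end FieldData

end Functional

/-! ### Words of generators -/

section Generators

variable {n : ℕ} {S : Type*} [TopologicalSpace S] [ChartedSpace (EuclideanSpace ℝ (Fin n)) S]

/-- The product of the generators given by a word of fields. -/
def fieldWord (l : List (Label × Test n S)) : Borchers n S := (l.map fun x => gen x.1 x.2).prod

theorem fieldWord_append (u v : List (Label × Test n S)) :
    fieldWord (u ++ v) = fieldWord u * fieldWord v := by
  simp [fieldWord]

theorem fieldWord_cons (x : Label × Test n S) (v : List (Label × Test n S)) :
    fieldWord (x :: v) = gen x.1 x.2 * fieldWord v := by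
  simp [fieldWord]

theorem fieldWord_ofFn {N : ℕ} (x : Fin N → Label × Test n S) :
    fieldWord (List.ofFn x) = (List.ofFn fun i => gen (x i).1 (x i).2).prod := by
  rw [fieldWord, List.map_ofFn]; rfl

theorem span_fieldWord :
    Submodule.span ℂ (Set.range (fieldWord (n := n) (S := S))) = ⊤ := by
  refine Submodule.eq_top_iff'.2 fun x => ?_
  induction x using TensorAlgebra.induction with
  | algebraMap r =>
    rw [Algebra.algebraMap_eq_smul_one]
    exact Submodule.smul_mem _ _ (Submodule.subset_span ⟨[], rfl⟩)
  | ι f =>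
    have hf : f = Pi.single .inn (f .inn) + Pi.single .loc (f .loc) + Pi.single .out (f .out) := by
      funext a
      cases a <;> simp
    rw [hf, map_add, map_add]
    refine add_mem (add_mem ?_ ?_) ?_
    · exact Submodule.subset_span ⟨[(.inn, f .inn)], by simp [fieldWord, gen]⟩
    · exact Submodule.subset_span ⟨[(.loc, f .loc)], by simp [fieldWord, gen]⟩
    · exact Submodule.subset_span ⟨[(.out, f .out)], by simp [fieldWord, gen]⟩
  | mul x y hx hy =>
    refine Submodule.span_induction₂ (p := fun x y _ _ => x * y ∈
      Submodule.span ℂ (Set.range (fieldWord (n := n) (S := S)))) ?_ ?_ ?_ ?_ ?_ ?_ ?_ hx hy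
    · rintro _ _ ⟨u, rfl⟩ ⟨v, rfl⟩
      exact Submodule.subset_span ⟨u ++ v, fieldWord_append u v⟩
    · intro y _; simp
    · intro x _; simp
    · intro x y z _ _ _ hx hy
      rw [add_mul]; exact add_mem hx hy
    · intro x y z _ _ _ hx hy
      rw [mul_add]; exact add_mem hx hy
    · intro c x y _ _ h
      rw [smul_mul_assoc]; exact Submodule.smul_mem _ _ h
    · intro c x y _ _ h
      rw [mul_smul_comm]; exact Submodule.smul_mem _ _ h
  | add x y hx hy => exact add_mem hx hy

theorem borchers_induction {p : Borchers n S → Prop} (word : ∀ l, p (fieldWord l))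
    (add : ∀ x y, p x → p y → p (x + y)) (smul : ∀ (c : ℂ) x, p x → p (c • x)) (x : Borchers n S) :
    p x := by
  have hx : x ∈ Submodule.span ℂ (Set.range (fieldWord (n := n) (S := S))) := by
    rw [span_fieldWord]; trivial
  refine Submodule.span_induction ?_ ?_ ?_ ?_ hx
  · rintro _ ⟨l, rfl⟩; exact word l
  · simpa using smul 0 _ (word [])
  · exact fun x y _ _ => add x y
  · exact fun c x _ => smul c x

theorem translation_fieldWord (s : ℝ) (l : List (Label × Test n S)) :
    translation s (fieldWord l) = fieldWord (l.map fun x => (x.1, Test.translate s x.2)) := by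
  rw [fieldWord, map_list_prod, fieldWord, List.map_map, List.map_map]
  congr 2
  funext x
  simp only [Function.comp_apply, gen, translation, TensorAlgebra.lift_ι_apply,
    LinearMap.comp_apply]
  congr 1
  funext a
  rw [LinearMap.compLeft_apply, Function.comp_apply]
  exact Pi.apply_single (fun _ => Test.translate s) (fun _ => map_zero _) x.1 x.2 a

theorem involution_fieldWord (l : List (Label × Test n S)) :
    involution (fieldWord l) = fieldWord (l.map fun x => (x.1, Test.conj x.2)).reverse := by
  induction l with
  | nil => exact involution_one
  | cons x l ih =>
    rw [fieldWord_cons, involution_mul, ih, List.map_cons, List.reverse_cons, fieldWord_append]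
    congr 1
    rw [gen, involution_ι]
    simp only [fieldWord, List.map_cons, List.map_nil, List.prod_cons, List.prod_nil, mul_one, gen]
    congr 1
    funext a
    rw [ExtTest.conj]
    refine Pi.apply_single (fun _ => Test.conj) (fun _ => ?_) x.1 x.2 a
    apply Subtype.ext; funext p; simp [Test.conj]

end Generators

/-! ### Symmetries, spectral condition and commutation relations -/

section Theory

open FourierTransform

variable {n : ℕ} {S : Type*} [TopologicalSpace S] [T2Space S] [SecondCountableTopology S]
  [ChartedSpace (EuclideanSpace ℝ (Fin n)) S]
  [IsManifold 𝓘(ℝ, EuclideanSpace ℝ (Fin n)) ∞ S] [MeasurableSpace S] [BorelSpace S]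

theorem exists_eq_ofFn {α : Type*} (l : List α) : ∃ (N : ℕ) (x : Fin N → α), l = List.ofFn x :=
  ⟨l.length, l.get, (List.ofFn_get l).symm⟩

omit [TopologicalSpace S] [T2Space S] [SecondCountableTopology S] [MeasurableSpace S] in
theorem reverse_ofFn {α : Type*} {N : ℕ} (x : Fin N → α) :
    (List.ofFn x).reverse = List.ofFn fun i => x i.rev := by
  refine List.ext_getElem (by simp) fun i h1 h2 => ?_
  simp only [List.length_ofFn] at h2
  simp only [List.getElem_reverse, List.getElem_ofFn, List.length_ofFn]
  congr 1
  apply Fin.ext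
  simp only [Fin.val_rev]
  omega

namespace FieldData

variable {A : FieldData n S} {F : Borchers n S →ₗ[ℂ] ℂ}

omit [T2Space S] [SecondCountableTopology S] [BorelSpace S] in
theorem IsFormFactor.apply_ofFn (hF : A.IsFormFactor F) {N : ℕ} (x : Fin N → Label × Test n S) :
    F (fieldWord (List.ofFn x)) = A.vev (fun i => (x i).1) (fun i => (x i).2) := by
  rw [fieldWord_ofFn, hF]

omit [T2Space S] [SecondCountableTopology S] [BorelSpace S] in
theorem IsFormFactor.apply_fieldWord (hF : A.IsFormFactor F) (l : List (Label × Test n S)) :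
    F (fieldWord l) = clustered A.truncatedWord l := by
  obtain ⟨N, x, rfl⟩ := exists_eq_ofFn l
  rw [hF.apply_ofFn, vev_eq_clustered]

omit [T2Space S] [SecondCountableTopology S] [BorelSpace S] in
theorem IsFormFactor.hermitean (hF : A.IsFormFactor F) (hA : A.Admissible) : Hermitean F := by
  intro x
  induction x using borchers_induction with
  | word l =>
    obtain ⟨N, x, rfl⟩ := exists_eq_ofFn l
    rw [involution_fieldWord, List.map_ofFn, reverse_ofFn, hF.apply_ofFn, hF.apply_ofFn]
    exact hA.vev_conj_rev (fun i => (x i).1) fun i => (x i).2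
  | add x y hx hy => simp only [map_add, hx, hy]
  | smul c x hx => rw [LinearMap.map_smulₛₗ, map_smul, map_smul, hx, smul_eq_mul, smul_eq_mul,
      map_mul]

theorem IsFormFactor.invariant (hF : A.IsFormFactor F) (hA : A.Admissible)
    (hinv : A.TimeInvariant) (hs : A.g.Stationary) : Invariant F := by
  intro s x
  induction x using borchers_induction with
  | word l =>
    obtain ⟨N, x, rfl⟩ := exists_eq_ofFn l
    rw [translation_fieldWord, List.map_ofFn, hF.apply_ofFn, hF.apply_ofFn]
    exact hA.vev_translate hinv hs (fun i => (x i).1) (fun i => (x i).2) s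
  | add x y hx hy => simp only [map_add, hx, hy]
  | smul c x hx => simp only [map_smul, hx]

theorem Admissible.tame_vev (hA : A.Admissible) {ε : ℝ} (hε : 0 < ε) (hinv : A.TimeInvariant)
    (hgap : A.SpectralGap ε) (hs : A.g.Stationary) (hdisp : A.Dispersion) {N : ℕ}
    (a : Fin N → Label) (f : Fin N → Test n S) (p : Fin N → Prop) [DecidablePred p]
    (hp : ∀ i j, i ≤ j → p i → p j) :
    Tame fun t => A.vev a fun l => if p l then Test.translate t (f l) else f l :=
  tame_sum _ fun _ _ => tame_prod _ fun B _ =>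
    hA.tame_truncated hε hinv hgap hs hdisp (a ∘ B.orderEmbOfFin rfl) (f ∘ B.orderEmbOfFin rfl)
      (fun l => p (B.orderEmbOfFin rfl l))
      fun _ _ hij => hp _ _ ((B.orderEmbOfFin rfl).monotone hij)

theorem IsFormFactor.tame (hF : A.IsFormFactor F) (hA : A.Admissible) {ε : ℝ} (hε : 0 < ε)
    (hinv : A.TimeInvariant) (hgap : A.SpectralGap ε) (hs : A.g.Stationary)
    (hdisp : A.Dispersion) (x y : Borchers n S) : Tame fun t => F (x * translation t y) := by
  induction x using borchers_induction with
  | word u =>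
    induction y using borchers_induction with
    | word v =>
      obtain ⟨M, u, rfl⟩ := exists_eq_ofFn u
      obtain ⟨N, v, rfl⟩ := exists_eq_ofFn v
      -- The translated fields are those of `v`, that is, the positions from `M` on in the
      -- concatenated word.
      have h := hA.tame_vev hε hinv hgap hs hdisp (fun i => (Fin.append u v i).1)
        (fun i => (Fin.append u v i).2) (fun i => M ≤ i.1) fun i j hij hi => hi.trans hij
      convert h using 1
      funext t
      rw [translation_fieldWord, ← fieldWord_append, List.map_ofFn, ← List.ofFn_fin_append,
        hF.apply_ofFn]
      congr 1
      · funext i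
        refine Fin.addCases (fun i => ?_) (fun i => ?_) i <;> simp
      · funext i
        refine Fin.addCases (fun i => ?_) (fun i => ?_) i <;> simp
    | add y z hy hz => simpa only [map_add, mul_add] using hy.add hz
    | smul c y hy => simpa only [map_smul, mul_smul_comm, smul_eq_mul] using (tame_const c).mul hy
  | add x z hx hz => simpa only [map_add, add_mul] using hx.add hz
  | smul c x hx => simpa only [map_smul, smul_mul_assoc, smul_eq_mul] using (tame_const c).mul hx

theorem IsFormFactor.spectralCondition (hF : A.IsFormFactor F) (hA : A.Admissible) {ε : ℝ}
    (hε : 0 < ε) (hinv : A.TimeInvariant) (hgap : A.SpectralGap ε) (hs : A.g.Stationary)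
    (hdisp : A.Dispersion) (hH : Hermitean F) (hI : Invariant F) : SpectralCondition F hH hI := by
  intro Ψ Φ f hf
  obtain ⟨x, rfl⟩ := (kernelIdeal F).mkQ_surjective Ψ
  obtain ⟨y, rfl⟩ := (kernelIdeal F).mkQ_surjective Φ
  have h := hF.tame hA hε hinv hgap hs hdisp (involution x) y
  obtain ⟨C, hC⟩ := h.bounded
  refine ⟨integrable_mul_schwartz h.continuous.aestronglyMeasurable hC f, h.spectrum f ?_⟩
  intro ξ hξ
  have hpi := Real.pi_pos
  have h1 := (fourier_eq_zero_iff f (2 * Real.pi * ξ)).1 (hf _ (by nlinarith))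
  rwa [mul_div_cancel_left₀ _ (by positivity : (2 * Real.pi) ≠ 0)] at h1

/-- Both relations are checked on words and extended by linearity. For the field equation, the block
containing `f'` vanishes; for the commutator, the order of neighbouring fields is felt only by the
truncated two-point function, and `clustered_swap` applies. -/
theorem IsFormFactor.isCCRField (hF : A.IsFormFactor F) (hA : A.Admissible)
    (hdisp : A.Dispersion) {a : Label} (ha : a ≠ .loc) : A.IsCCRField F a := by
  constructor
  · intro f f' hf
    refine LinearMap.ext fun Φ => ?_
    obtain ⟨x, rfl⟩ := (kernelIdeal F).mkQ_surjective Φ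
    change (kernelIdeal F).mkQ (gen a f' * x) = 0
    rw [Submodule.mkQ_apply, Submodule.Quotient.mk_eq_zero]
    intro y
    induction y using borchers_induction with
    | word u =>
      induction x using borchers_induction with
      | word v =>
        have h1 : fieldWord u * (gen a f' * fieldWord v) = fieldWord (u ++ (a, f') :: v) := by
          rw [fieldWord_append, fieldWord_cons]
        rw [h1, ← List.ofFn_get (u ++ (a, f') :: v), hF.apply_ofFn]
        have hi : u.length < (u ++ (a, f') :: v).length := by simp
        have hget : (u ++ (a, f') :: v).get ⟨u.length, hi⟩ = (a, f') := by simp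
        refine hA.vev_kleinGordon _ _ ⟨u.length, hi⟩ ?_ (h := f) ?_
        · rw [hget]; exact ha
        · rw [hget]; exact hf
      | add x z hx hz => simp only [mul_add, map_add, hx, hz, add_zero]
      | smul c x hx => simp only [mul_smul_comm, map_smul, hx, smul_zero]
    | add y z hy hz => simp only [add_mul, map_add, hy, hz, add_zero]
    | smul c y hy => simp only [smul_mul_assoc, map_smul, hy, smul_zero]
  · intro f h
    refine LinearMap.ext fun Φ => ?_
    obtain ⟨x, rfl⟩ := (kernelIdeal F).mkQ_surjective Φ
    set c : ℂ := 2 * Complex.I * ((A.b ^ 2 / A.m ^ 2 : ℝ) : ℂ) * A.D f h with hcdef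
    change (kernelIdeal F).mkQ (gen a f * (gen a h * x)) -
      (kernelIdeal F).mkQ (gen a h * (gen a f * x)) = c • (kernelIdeal F).mkQ x
    rw [← map_sub, ← map_smul, Submodule.mkQ_apply, Submodule.mkQ_apply, Submodule.Quotient.eq]
    intro y
    have hc : A.truncatedWord [(a, f), (a, h)] - A.truncatedWord [(a, h), (a, f)] = c := by
      rw [truncatedWord_pair, truncatedWord_pair, ← mul_sub, ← hA.two_I_mul_D, hcdef]
      ring
    induction y using borchers_induction with
    | word u =>
      induction x using borchers_induction with
      | word v =>
        have h1 : ∀ f h : Test n S, fieldWord u * (gen a f * (gen a h * fieldWord v)) =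
            fieldWord (u ++ (a, f) :: (a, h) :: v) := fun f h => by
          rw [fieldWord_append, fieldWord_cons, fieldWord_cons]
        rw [mul_sub, mul_sub, h1, h1, mul_smul_comm, ← fieldWord_append, map_sub, map_sub, map_smul,
          hF.apply_fieldWord, hF.apply_fieldWord, hF.apply_fieldWord, clustered_swap _ _ _ c hc
            fun u v huv => hA.truncatedWord_swap hdisp ha f h huv, smul_eq_mul, sub_self]
      | add x z hx hz =>
        simp only [mul_add, smul_add, mul_sub, map_add, map_sub] at hx hz ⊢
        linear_combination hx + hz
      | smul r x hx =>
        simp only [mul_smul_comm, mul_sub, map_sub, map_smul, smul_comm c r, ← smul_sub] at hx ⊢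
        rw [hx, smul_zero]
    | add y z hy hz => simp only [add_mul, map_add, hy, hz, add_zero]
    | smul r y hy => simp only [smul_mul_assoc, map_smul, hy, smul_zero]

end FieldData

end Theory

/-! ### Null vectors of quasi-free functionals on words -/

section NullVectors

variable {α : Type*}

/-- `∏ d(h)` over the letters of a word of length `r`, and zero for words of other lengths. -/
def letterWeight (d : α → ℂ) (r : ℕ) (u : List α) : ℂ := if u.length = r then (u.map d).prod else 0

theorem letterWeight_zero (d : α → ℂ) :
    letterWeight d 0 = fun u => if u = [] then 1 else 0 := by
  funext u
  cases u <;> simp [letterWeight]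

theorem letterWeight_cons (d : α → ℂ) (r : ℕ) (h : α) (u : List α) :
    letterWeight d (r + 1) (h :: u) = d h * letterWeight d r u := by
  simp [letterWeight]

/-- The functions `letterWeight d r` are the divided powers of `letterWeight d 1` for the product
`conv`, so contractions of any order reduce to single ones. -/
theorem conv_letterWeight (d : α → ℂ) (r : ℕ) (w : List α) :
    conv (letterWeight d 1) (letterWeight d r) w = (r + 1) * letterWeight d (r + 1) w := by
  induction w generalizing r with
  | nil => simp [conv, letterWeight]
  | cons h w ih =>
    have h1 : conv (fun u => letterWeight d 1 (h :: u)) (letterWeight d r) w =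
        d h * letterWeight d r w := by
      simp only [letterWeight_cons d 0, conv_smul_left, letterWeight_zero, conv_unit, one_mul]
    simp only [conv, h1, letterWeight_cons d r]
    cases r with
    | zero =>
      have h2 : (fun u => letterWeight d 0 (h :: u)) = fun _ => 0 * 0 := by
        funext u; simp [letterWeight]
      rw [h2, conv_comm, conv_smul_left]
      simp
    | succ r =>
      simp only [letterWeight_cons d r]
      rw [conv_comm, conv_smul_left, conv_comm, ih]
      push_cast
      ring

/-- The sum of the words that result from a word by the removal of one letter `h`, with the
weights `d(h)`. -/
def removal (d : α → ℂ) : List α → List α →₀ ℂ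
  | [] => 0
  | h :: w => d h • Finsupp.single w 1 + Finsupp.mapDomain (List.cons h) (removal d w)

/-- `removal d` is the transpose of the contraction `conv (letterWeight d 1)`, in the manner of an
annihilation operator acting on words. -/
theorem linearCombination_removal (d : α → ℂ) (ψ : List α → ℂ) (w : List α) :
    Finsupp.linearCombination ℂ ψ (removal d w) = conv (letterWeight d 1) ψ w := by
  induction w generalizing ψ with
  | nil => simp [removal, conv, letterWeight]
  | cons h w ih =>
    rw [removal, map_add, map_smul, Finsupp.linearCombination_single,
      Finsupp.linearCombination_mapDomain]
    simp only [conv, letterWeight_cons d 0, conv_smul_left, letterWeight_zero, conv_unit, one_mul,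
      smul_eq_mul]
    congr 1
    exact ih _

theorem linearCombination_removal_comp (d : α → ℂ) (ψ : List α → ℂ) (x : List α →₀ ℂ) :
    Finsupp.linearCombination ℂ ψ (Finsupp.linearCombination ℂ (removal d) x) =
      Finsupp.linearCombination ℂ (conv (letterWeight d 1) ψ) x := by
  induction x using Finsupp.induction_linear with
  | zero => simp
  | add x y hx hy => simp only [map_add, hx, hy]
  | single w c => simp [linearCombination_removal]

/-- The left ideal of the null vectors of a functional on words. -/
def nullVectors (G : List α → ℂ) : Submodule ℂ (List α →₀ ℂ) :=
  ⨅ z : List α, LinearMap.ker (Finsupp.linearCombination ℂ fun w => G (z ++ w))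

theorem mem_nullVectors {G : List α → ℂ} {x : List α →₀ ℂ} :
    x ∈ nullVectors G ↔ ∀ z, Finsupp.linearCombination ℂ (fun w => G (z ++ w)) x = 0 := by
  simp [nullVectors, Submodule.mem_iInf]

/-- `ψ` vanishes on the null vectors of `G`. -/
def Annihilates (G ψ : List α → ℂ) : Prop :=
  ∀ x ∈ nullVectors G, Finsupp.linearCombination ℂ ψ x = 0

theorem linearCombination_fun_add (ψ ψ' : List α → ℂ) (x : List α →₀ ℂ) :
    Finsupp.linearCombination ℂ (fun w => ψ w + ψ' w) x =
      Finsupp.linearCombination ℂ ψ x + Finsupp.linearCombination ℂ ψ' x := by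
  simp only [Finsupp.linearCombination_apply, Finsupp.sum, smul_eq_mul, mul_add,
    Finset.sum_add_distrib]

theorem linearCombination_fun_mul (c : ℂ) (ψ : List α → ℂ) (x : List α →₀ ℂ) :
    Finsupp.linearCombination ℂ (fun w => c * ψ w) x =
      c * Finsupp.linearCombination ℂ ψ x := by
  simp only [Finsupp.linearCombination_apply, Finsupp.sum, smul_eq_mul, Finset.mul_sum,
    mul_left_comm]

theorem annihilates_prefix (G : List α → ℂ) (z : List α) : Annihilates G fun w => G (z ++ w) :=
  fun _ hx => mem_nullVectors.1 hx z

theorem Annihilates.add {G ψ ψ' : List α → ℂ} (h : Annihilates G ψ) (h' : Annihilates G ψ') :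
    Annihilates G fun w => ψ w + ψ' w := fun x hx => by
  rw [linearCombination_fun_add, h x hx, h' x hx, add_zero]

theorem Annihilates.const_mul {G ψ : List α → ℂ} (h : Annihilates G ψ) (c : ℂ) :
    Annihilates G fun w => c * ψ w := fun x hx => by
  rw [linearCombination_fun_mul, h x hx, mul_zero]

/-- Contracting the whole word `z ++ w` differs from contracting `w` alone by the terms that remove
a letter of `z`; these are multiples of functionals with shorter prefixes, covered by `h2`. -/
theorem annihilates_conv_prefix {G₀ : List α → ℂ} (d : α → ℂ) (z : List α) (G : List α → ℂ)
    (h1 : ∀ z', Annihilates G₀ fun w => conv (letterWeight d 1) G (z' ++ w))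
    (h2 : ∀ z', Annihilates G₀ fun w => G (z' ++ w)) :
    Annihilates G₀ (conv (letterWeight d 1) fun v => G (z ++ v)) := by
  induction z generalizing G with
  | nil => exact h1 []
  | cons h z ih =>
    refine ih (fun v => G (h :: v)) (fun z' => ?_) fun z' => h2 (h :: z')
    have e : (fun w => conv (letterWeight d 1) (fun v => G (h :: v)) (z' ++ w)) =
        fun w => conv (letterWeight d 1) G ((h :: z') ++ w) + -d h * G (z' ++ w) := by
      funext w
      simp only [List.cons_append, conv, letterWeight_cons d 0, conv_smul_left, letterWeight_zero,
        conv_unit, one_mul]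
      ring
    rw [e]
    exact (h1 (h :: z')).add ((h2 z').const_mul _)

/-- Functionals that annihilate the null vectors of a quasi-free functional are stable under
contractions. -/
theorem Annihilates.conv_letterWeight {G : List α → ℂ} {κ : ℂ} (hκ : κ ≠ 0) {B : α → α → ℂ}
    (hG : ∀ g w, G (g :: w) = κ * conv (letterWeight (B g) 1) G w) (g : α) {ψ : List α → ℂ}
    (hψ : Annihilates G ψ) (r : ℕ) : Annihilates G (conv (letterWeight (B g) r) ψ) := by
  have h1 : ∀ ψ, Annihilates G ψ → Annihilates G (conv (letterWeight (B g) 1) ψ) := by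
    intro ψ hψ x hx
    rw [← linearCombination_removal_comp]
    -- The claim reduces to `removal (B g)` preserving null vectors. By `hG`, contraction of `G`
    -- with `B g` is `κ⁻¹` times prefixing `g`, and prefixing is harmless for a left ideal.
    refine hψ _ (mem_nullVectors.2 fun z => ?_)
    rw [linearCombination_removal_comp]
    refine annihilates_conv_prefix (B g) z G (fun z' => ?_) (annihilates_prefix G) x hx
    have e : (fun w => conv (letterWeight (B g) 1) G (z' ++ w)) =
        fun w => κ⁻¹ * G ((g :: z') ++ w) := by
      funext w
      rw [List.cons_append, hG, inv_mul_cancel_left₀ hκ]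
    rw [e]
    exact (annihilates_prefix G (g :: z')).const_mul _
  induction r with
  | zero =>
    have e : conv (letterWeight (B g) 0) ψ = ψ := by
      funext w
      rw [letterWeight_zero, conv_unit, one_mul]
    rwa [e]
  | succ r ih =>
    have e : conv (letterWeight (B g) (r + 1)) ψ =
        fun w => ((r : ℂ) + 1)⁻¹ *
          conv (letterWeight (B g) 1) (conv (letterWeight (B g) r) ψ) w := by
      funext w
      have hr : (r : ℂ) + 1 ≠ 0 := Nat.cast_add_one_ne_zero r
      rw [conv_assoc, conv_congr (fun u _ => QFT.conv_letterWeight (B g) r u) fun _ _ => rfl,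
        conv_smul_left, inv_mul_cancel_left₀ hr]
    rw [e]
    exact (h1 _ ih).const_mul _

theorem conv_congr_letters {φ φ' ψ : List α → ℂ} {s : Set α}
    (hφ : ∀ u : List α, (∀ h ∈ u, h ∈ s) → φ u = φ' u) {w : List α} (hw : ∀ h ∈ w, h ∈ s) :
    conv φ ψ w = conv φ' ψ w := by
  induction w generalizing φ φ' ψ with
  | nil => simp [conv, hφ [] (by simp)]
  | cons h w ih =>
    simp only [List.mem_cons, forall_eq_or_imp] at hw
    simp only [conv]
    rw [ih (fun u hu => hφ (h :: u) (by simpa [hw.1] using hu)) hw.2, ih hφ hw.2]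

theorem conv_integral {X : Type*} [MeasurableSpace X] {μ : Measure X} {φ : List α → X → ℂ}
    (hφ : ∀ u, Integrable (φ u) μ) (ψ : List α → ℂ) (w : List α) :
    Integrable (fun y => conv (fun u => φ u y) ψ w) μ ∧
      conv (fun u => ∫ y, φ u y ∂μ) ψ w = ∫ y, conv (fun u => φ u y) ψ w ∂μ := by
  induction w generalizing φ ψ with
  | nil => exact ⟨(hφ []).mul_const _, (integral_mul_const _ _).symm⟩
  | cons h w ih =>
    have h1 := ih (fun u => hφ (h :: u)) ψ
    have h2 := ih hφ fun u => ψ (h :: u)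
    refine ⟨h1.1.add h2.1, ?_⟩
    simp only [conv]
    rw [h1.2, h2.2, ← integral_add h1.1 h2.1]

/-- Superpositions of contractions with functions that locally are of the form `B g`. -/
theorem Annihilates.conv_integral {G : List α → ℂ} {κ : ℂ} (hκ : κ ≠ 0) {B : α → α → ℂ}
    (hG : ∀ g w, G (g :: w) = κ * conv (letterWeight (B g) 1) G w)
    {X : Type*} [MeasurableSpace X] {μ : Measure X} {d : α → X → ℂ}
    (hd : ∀ s : Finset α, ∀ᵐ y ∂μ, ∃ g, ∀ h ∈ s, d h y = B g h) {R : X → ℂ} {r : ℕ}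
    (hR : ∀ u : List α, u.length = r → Integrable (fun y => R y * (u.map fun h => d h y).prod) μ)
    {ψ : List α → ℂ} (hψ : Annihilates G ψ) :
    Annihilates G (conv (fun u => if u.length = r then
      ∫ y, R y * (u.map fun h => d h y).prod ∂μ else 0) ψ) := by
  classical
  intro x hx
  let φ : List α → X → ℂ := fun u y => R y * letterWeight (fun h => d h y) r u
  have hφ : ∀ u, Integrable (φ u) μ := by
    intro u
    by_cases hu : u.length = r
    · simpa only [φ, letterWeight, hu, if_true] using hR u hu
    · simp [φ, letterWeight, hu]
  have hφ' : (fun u : List α => if u.length = r then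
      ∫ y, R y * (u.map fun h => d h y).prod ∂μ else 0) = fun u => ∫ y, φ u y ∂μ := by
    funext u
    by_cases hu : u.length = r <;> simp [φ, letterWeight, hu]
  rw [hφ', Finsupp.linearCombination_apply, Finsupp.sum]
  have h1 := fun w => QFT.conv_integral hφ ψ w
  simp only [h1, smul_eq_mul]
  simp only [← integral_const_mul]
  rw [← integral_finsetSum _ fun w _ => (h1 w).1.const_mul _]
  rw [← integral_zero X ℂ (μ := μ)]
  refine integral_congr_ae ?_
  -- Only finitely many letters occur in `x`, so at almost every `y` a single `g` serves for all of
  -- them, and the integrand vanishes pointwise.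
  filter_upwards [hd (x.support.biUnion List.toFinset)] with y hy
  obtain ⟨g, hg⟩ := hy
  have h2 := hψ.conv_letterWeight hκ hG g r x hx
  rw [Finsupp.linearCombination_apply, Finsupp.sum] at h2
  have h3 : ∀ w ∈ x.support, conv (fun u => φ u y) ψ w =
      R y * conv (letterWeight (B g) r) ψ w := by
    intro w hw
    rw [conv_smul_left]
    congr 1
    refine conv_congr_letters (s := {h | h ∈ w}) (fun u hu => ?_) fun h hh => hh
    simp only [letterWeight]
    congr 2
    refine List.map_congr_left fun h hh => hg h ?_
    exact Finset.mem_biUnion.2 ⟨w, hw, List.mem_toFinset.2 (hu h hh)⟩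
  calc ∑ w ∈ x.support, x w * conv (fun u => φ u y) ψ w
      = R y * ∑ w ∈ x.support, x w • conv (letterWeight (B g) r) ψ w := by
        rw [Finset.mul_sum]
        refine Finset.sum_congr rfl fun w hw => ?_
        rw [h3 w hw, smul_eq_mul]; ring
    _ = 0 := by rw [h2, mul_zero]

theorem annihilates_conv_zero (G ψ : List α → ℂ) : Annihilates G (conv (fun _ => 0) ψ) := by
  intro x _
  have e : conv (fun _ => (0 : ℂ)) ψ = fun _ => 0 := by
    funext w
    simpa using conv_smul_left 0 (fun _ => (0 : ℂ)) ψ w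
  rw [e]
  simp [Finsupp.linearCombination_apply]

/-- It suffices to consider the components of a kernel of fixed length. -/
theorem annihilates_conv_of_length {G ψ φ : List α → ℂ}
    (h : ∀ r : ℕ, Annihilates G (conv (fun u => if u.length = r then φ u else 0) ψ)) :
    Annihilates G (conv φ ψ) := by
  intro x hx
  have key : ∀ N : ℕ, conv (fun u => if u.length < N then φ u else 0) ψ =
      fun w => ∑ r ∈ Finset.range N, conv (fun u => if u.length = r then φ u else 0) ψ w := by
    intro N
    induction N with
    | zero =>
      funext w
      simpa using conv_smul_left 0 (fun _ => (0 : ℂ)) ψ w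
    | succ N ih =>
      funext w
      rw [Finset.sum_range_succ, ← congrFun ih w, ← conv_add_left]
      refine conv_congr (fun u _ => ?_) fun _ _ => rfl
      rcases lt_trichotomy u.length N with h | h | h
      · simp [h, h.ne, h.trans (Nat.lt_succ_self N)]
      · simp [h]
      · simp [h.ne', h.not_gt, show ¬ u.length < N + 1 by omega]
  have h0 : ∀ N : ℕ, Annihilates G (conv (fun u => if u.length < N then φ u else 0) ψ) := by
    intro N y hy
    rw [key, Finsupp.linearCombination_apply, Finsupp.sum]
    simp only [smul_eq_mul, Finset.mul_sum]
    rw [Finset.sum_comm]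
    refine Finset.sum_eq_zero fun r _ => ?_
    have := h r y hy
    rwa [Finsupp.linearCombination_apply, Finsupp.sum] at this
  -- Truncation beyond the longest word in the support of `x` has no effect.
  rw [← h0 (x.support.sup List.length + 1) x hx, Finsupp.linearCombination_apply,
    Finsupp.linearCombination_apply]
  refine Finset.sum_congr rfl fun w hw => ?_
  simp only
  congr 1
  refine conv_congr (fun u hu => ?_) fun _ _ => rfl
  have : w.length ≤ x.support.sup List.length := Finset.le_sup (f := List.length) hw
  rw [if_pos (by omega)]

theorem clustered_map {β : Type*} (g : β → α) (T : List α → ℂ) (w : List β) :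
    clustered T (w.map g) = clustered (fun u => T (u.map g)) w := by
  obtain ⟨N, x, rfl⟩ := exists_eq_ofFn w
  rw [List.map_ofFn, ← wordOf_univ_eq_ofFn, ← wordOf_univ_eq_ofFn, ← partitionSum_wordOf,
    ← partitionSum_wordOf]
  refine partitionSum_congr fun B _ => ?_
  simp only [wordOf, List.map_map]

end NullVectors

/-! ### Unitary equivalence of the incoming and outgoing fields -/

section Unitary

variable {n : ℕ} {S : Type*} [TopologicalSpace S] [T2Space S] [SecondCountableTopology S]
  [ChartedSpace (EuclideanSpace ℝ (Fin n)) S]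
  [IsManifold 𝓘(ℝ, EuclideanSpace ℝ (Fin n)) ∞ S] [MeasurableSpace S] [BorelSpace S]

namespace FieldData

/-- The vacuum expectation values of words of incoming fields. -/
def innVev (A : FieldData n S) : List (Test n S) → ℂ :=
  clustered fun u => A.truncatedWord (u.map (Prod.mk Label.inn))

variable {A : FieldData n S}

namespace Admissible

variable (hA : A.Admissible)
include hA

omit [T2Space S] [SecondCountableTopology S] [BorelSpace S] in
theorem coupling_ne_zero : ((A.b ^ 2 / A.m ^ 2 : ℝ) : ℂ) ≠ 0 := by
  have h1 := hA.b_pos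
  have h2 := hA.mass_pos
  exact Complex.ofReal_ne_zero.2 (by positivity)

/-- Wick's theorem in recursive form: in-fields have only two-point truncated functions, so the
first letter is contracted with one other letter. -/
theorem innVev_cons (hdisp : A.Dispersion) (g : Test n S) (w : List (Test n S)) :
    A.innVev (g :: w) = ((A.b ^ 2 / A.m ^ 2 : ℝ) : ℂ) *
      conv (letterWeight (fun h => A.Dplus g h) 1) A.innVev w := by
  rw [innVev, clustered_cons, ← conv_smul_left]
  refine conv_congr (fun u _ => ?_) fun _ _ => rfl
  match u with
  | [] => simp [letterWeight, truncatedWord_singleton]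
  | [h] => simp [letterWeight, truncatedWord_pair]
  | h :: k :: u =>
    rw [hA.truncatedWord_inn hdisp (by simp)]
    simp [letterWeight]

theorem dminus_sum {ι : Type*} (s : Finset ι) (c : ι → ℂ) (f : ι → Test n S) :
    ∀ᵐ y ∂A.vol, A.dminus (∑ i ∈ s, c i • f i) y = ∑ i ∈ s, c i * A.dminus (f i) y := by
  classical
  induction s using Finset.induction_on with
  | empty =>
    filter_upwards [hA.dminus_smul 0 0] with y hy
    simpa using hy
  | insert i s hi ih =>
    filter_upwards [ih, hA.dminus_smul (c i) (f i),
      hA.dminus_add (c i • f i) (∑ i ∈ s, c i • f i)] with y h1 h2 h3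
    rw [Finset.sum_insert hi, Finset.sum_insert hi, h3, Pi.add_apply, h1, h2]
    rfl

/-- At almost all points, the functions `D⁻(h, ·)` have the values of `D⁺(g, h)` for some test
function `g`, for finitely many `h`. -/
theorem exists_Dplus_eq_dminus (s : Finset (Test n S)) :
    ∀ᵐ y ∂A.vol, ∃ g, ∀ h ∈ s, A.dminus h y = A.Dplus g h := by
  classical
  let L : Test n S →ₗ[ℂ] (s → ℂ) := LinearMap.pi fun h => A.Dplus.flip h.1
  -- Finite-dimensional duality: `V` is cut out by the functionals `lam j`. Each of them is a
  -- combination `f` of the letters with `D⁺(·, f) = 0`, whence `D⁻(f, ·) = 0` almost everywhere, so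
  -- the vector `(D⁻(h, y))_h` lies in `V`.
  let V := LinearMap.range L
  let e := Module.finBasis ℂ ((s → ℂ) ⧸ V)
  let lam : Fin (Module.finrank ℂ ((s → ℂ) ⧸ V)) → (s → ℂ) →ₗ[ℂ] ℂ := fun j =>
    e.coord j ∘ₗ V.mkQ
  have hlam : ∀ j v, lam j v = ∑ h, lam j (Pi.single h 1) * v h := fun j v => by
    conv_lhs => rw [LinearMap.pi_apply_eq_sum_univ (lam j) v]
    refine Finset.sum_congr rfl fun h _ => ?_
    rw [smul_eq_mul, mul_comm]
    congr 2
    funext k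
    simp [Pi.single_apply, eq_comm]
  have hV : ∀ v, (∀ j, lam j v = 0) → v ∈ V := fun v hv => by
    rw [← Submodule.Quotient.mk_eq_zero V]
    exact e.ext_elem fun j => by simpa [lam] using hv j
  have h1 : ∀ j, ∀ᵐ y ∂A.vol, lam j (fun h => A.dminus h.1 y) = 0 := by
    intro j
    let f : Test n S := ∑ h : s, lam j (Pi.single h 1) • h.1
    have h2 : ∀ g, A.Dplus g f = 0 := fun g => by
      have h3 : lam j (L g) = 0 := by
        have : V.mkQ (L g) = 0 := (Submodule.Quotient.mk_eq_zero V).2 ⟨g, rfl⟩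
        simp only [lam, LinearMap.comp_apply, this, map_zero]
      rw [hlam] at h3
      rw [← h3, map_sum]
      exact Finset.sum_congr rfl fun h _ => by rw [map_smul, smul_eq_mul]; rfl
    have h4 : ∀ᵐ y ∂A.vol, A.dminus f y = 0 :=
      ae_eq_zero_of_integral_test (hA.locallyIntegrable_dminus f) fun g => by
        rw [hA.integral_dminus, h2]
    filter_upwards [h4, hA.dminus_sum Finset.univ (fun h : s => lam j (Pi.single h 1))
      fun h => h.1] with y h5 h6
    rw [hlam, ← h6]
    exact h5
  filter_upwards [ae_all_iff.2 h1] with y hy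
  obtain ⟨g, hg⟩ := hV _ hy
  exact ⟨g, fun h hh => (congrFun hg ⟨h, hh⟩).symm⟩

/-- A block that joins `l` to `r` letters of the asymptotic word is either a superposition of
`r`-fold contractions, given by the kernel of `exists_kernel`, or for fewer than three fields in
total a constant or a single contraction. All of these preserve annihilators of the free null
vectors. -/
theorem annihilates_truncated {ε : ℝ} (hε : 0 < ε) (hinv : A.TimeInvariant)
    (hgap : A.SpectralGap ε) (hs : A.g.Stationary) (hdisp : A.Dispersion) {a : Label}
    (ha : a ≠ .loc) {l : List (Label × Test n S)} (hl : l ≠ []) {ψ : List (Test n S) → ℂ}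
    (hψ : Annihilates A.innVev ψ) :
    Annihilates A.innVev
      (conv (fun u => A.truncatedWord (l ++ u.map (Prod.mk a))) ψ) := by
  have hpos := List.length_pos_iff.2 hl
  refine annihilates_conv_of_length fun r => ?_
  by_cases h3 : 3 ≤ l.length + r
  · by_cases hc : A.coupling (l.length + r) = 0
    · have e : (fun u : List (Test n S) => if u.length = r then
          A.truncatedWord (l ++ u.map (Prod.mk a)) else 0) = fun _ => 0 := by
        funext u
        by_cases hu : u.length = r
        · rw [if_pos hu, hA.truncatedWord_eq_integral hdisp (by simpa [hu] using h3)]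
          simp [hu, hc]
        · rw [if_neg hu]
      rw [e]
      exact annihilates_conv_zero _ _
    · obtain ⟨R, hR⟩ := hA.exists_kernel hε hinv hgap hs hdisp ha l
      have e : (conv (fun u : List (Test n S) => if u.length = r then
          A.truncatedWord (l ++ u.map (Prod.mk a)) else 0) ψ) =
          fun w => (A.coupling (l.length + r) : ℂ) * conv (fun u => if u.length = r then
            ∫ y, R y * (u.map fun h => A.dminus h y).prod ∂A.vol else 0) ψ w := by
        funext w
        rw [← conv_smul_left]
        congr 1
        funext u
        by_cases hu : u.length = r
        · rw [if_pos hu, if_pos hu, hA.truncatedWord_eq_integral hdisp (by simpa [hu] using h3),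
            (hR u (by simpa [hu] using h3) (by simpa [hu] using hc)).2]
          simp [hu]
        · rw [if_neg hu, if_neg hu, mul_zero]
      rw [e]
      refine Annihilates.const_mul ?_ _
      exact hψ.conv_integral hA.coupling_ne_zero (hA.innVev_cons hdisp)
        hA.exists_Dplus_eq_dminus
        fun u hu => (hR u (by simpa [hu] using h3) (by simpa [hu] using hc)).1
  -- Since `l` is not empty and the block has at most two fields, either `r = 0`, or `r = 1` and `l`
  -- is a single letter.
  · rcases Nat.eq_zero_or_pos r with rfl | hr
    · have e : (conv (fun u : List (Test n S) => if u.length = 0 then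
          A.truncatedWord (l ++ u.map (Prod.mk a)) else 0) ψ) =
          fun w => A.truncatedWord l * ψ w := by
        funext w
        rw [← conv_unit]
        congr 1
        funext u
        cases u <;> simp
      rw [e]
      exact hψ.const_mul _
    · have hr1 : r = 1 := by omega
      obtain ⟨x, rfl⟩ := List.length_eq_one_iff.1 (by omega : l.length = 1)
      subst hr1
      have e : (conv (fun u : List (Test n S) => if u.length = 1 then
          A.truncatedWord ([x] ++ u.map (Prod.mk a)) else 0) ψ) =
          fun w => ((A.b ^ 2 / A.m ^ 2 : ℝ) : ℂ) *
            conv (letterWeight (fun h => A.Dplus x.2 h) 1) ψ w := by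
        funext w
        rw [← conv_smul_left]
        congr 1
        funext u
        match u with
        | [] => simp [letterWeight]
        | [h] => simp [letterWeight, truncatedWord_pair]
        | h :: k :: u => simp [letterWeight]
      rw [e]
      exact (hψ.conv_letterWeight hA.coupling_ne_zero (hA.innVev_cons hdisp) x.2 1).const_mul _

theorem clustered_map_eq_innVev {ε : ℝ} (hε : 0 < ε) (hinv : A.TimeInvariant)
    (hgap : A.SpectralGap ε) (hs : A.g.Stationary) (hdisp : A.Dispersion) {a : Label}
    (ha : a ≠ .loc) (w : List (Test n S)) :
    clustered A.truncatedWord (w.map (Prod.mk a)) = A.innVev w := by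
  rw [clustered_map, innVev]
  congr 1
  funext u
  cases a with
  | inn => rfl
  | loc => exact absurd rfl ha
  | out =>
    by_cases hu : 3 ≤ u.length
    · rw [hA.truncatedWord_out hε hinv hgap hs hdisp hu, hA.truncatedWord_inn hdisp hu]
    · match u with
      | [] => rfl
      | [_] => rfl
      | [_, _] => rfl
      | _ :: _ :: _ :: _ => simp at hu

/-- The null vectors of the free theory are null vectors of the mixed theory. -/
theorem annihilates_clustered {ε : ℝ} (hε : 0 < ε) (hinv : A.TimeInvariant)
    (hgap : A.SpectralGap ε) (hs : A.g.Stationary) (hdisp : A.Dispersion) {a : Label}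
    (ha : a ≠ .loc) (l : List (Label × Test n S)) :
    Annihilates A.innVev fun w => clustered A.truncatedWord (l ++ w.map (Prod.mk a)) := by
  have main : ∀ (N : ℕ) (l : List (Label × Test n S)), l.length = N →
      Annihilates A.innVev fun w => clustered A.truncatedWord (l ++ w.map (Prod.mk a)) := by
    intro N
    induction N using Nat.strong_induction_on with
    | _ N ih =>
    intro l hl
    cases l with
    | nil =>
      simp only [List.nil_append, hA.clustered_map_eq_innVev hε hinv hgap hs hdisp ha]
      exact annihilates_prefix A.innVev []
    | cons x l =>
      simp only [List.cons_append, clustered_cons]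
      -- Here `u` collects the letters in the block of `x` and `v` the others, while `l` is still to
      -- be distributed. As `x` belongs to `u`, the final `v` is shorter than the original word and
      -- the induction hypothesis applies to it.
      have split : ∀ l u v : List (Label × Test n S), u ≠ [] → v.length + l.length < N →
          Annihilates A.innVev fun w => conv (fun z => A.truncatedWord (u ++ z))
            (fun z => clustered A.truncatedWord (v ++ z)) (l ++ w.map (Prod.mk a)) := by
        intro l
        induction l with
        | nil =>
          intro u v hu hv
          simp only [List.nil_append, conv_map]
          exact hA.annihilates_truncated hε hinv hgap hs hdisp ha hu
            (ih v.length (by simpa using hv) v rfl)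
        | cons k l ihl =>
          intro u v hu hv
          simp only [List.length_cons] at hv
          simp only [List.cons_append, conv]
          have h1 := ihl (u ++ [k]) v (by simp) (by omega)
          have h2 := ihl u (v ++ [k]) hu (by simp; omega)
          simp only [List.append_assoc, List.singleton_append] at h1 h2
          exact h1.add h2
      exact split l [x] [] (by simp) (by simp at hl ⊢; omega)
  exact main _ l rfl

end Admissible

end FieldData

theorem exists_equiv_of_ker_eq {P V : Type*} [AddCommGroup P] [Module ℂ P] [AddCommGroup V]
    [Module ℂ V] {f g : P →ₗ[ℂ] V} {p q : Submodule ℂ V} (hp : LinearMap.range f = p)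
    (hq : LinearMap.range g = q) (hk : LinearMap.ker f = LinearMap.ker g) :
    ∃ W : p ≃ₗ[ℂ] q, ∀ (x : P) (h : f x ∈ p), (W ⟨f x, h⟩ : V) = g x := by
  subst hp hq
  refine ⟨f.quotKerEquivRange.symm ≪≫ₗ Submodule.quotEquivOfEq _ _ hk ≪≫ₗ g.quotKerEquivRange,
    fun x h => ?_⟩
  have h1 : f.quotKerEquivRange.symm ⟨f x, h⟩ = (LinearMap.ker f).mkQ x :=
    f.quotKerEquivRange_symm_apply_image x h
  rw [LinearEquiv.trans_apply, LinearEquiv.trans_apply, h1]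
  rfl

namespace FieldData

variable {A : FieldData n S} {F : Borchers n S →ₗ[ℂ] ℂ}

/-- The vectors generated from the vacuum by words of fields `φ^a`. -/
def wordVector (F : Borchers n S →ₗ[ℂ] ℂ) (a : Label) :
    (List (Test n S) →₀ ℂ) →ₗ[ℂ] StateSpace F :=
  Finsupp.linearCombination ℂ fun w => (kernelIdeal F).mkQ (fieldWord (w.map (Prod.mk a)))

omit [T2Space S] [SecondCountableTopology S] [IsManifold 𝓘(ℝ, EuclideanSpace ℝ (Fin n)) ∞ S]
  [MeasurableSpace S] [BorelSpace S] in
theorem foldr_field (F : Borchers n S →ₗ[ℂ] ℂ) (a : Label) (l : List (Test n S)) :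
    l.foldr (fun f Ψ => field F a f Ψ) (vacuum F) =
      (kernelIdeal F).mkQ (fieldWord (l.map (Prod.mk a))) := by
  induction l with
  | nil => rfl
  | cons f l ih => rw [List.foldr_cons, ih, List.map_cons, fieldWord_cons]; rfl

omit [T2Space S] [SecondCountableTopology S] [IsManifold 𝓘(ℝ, EuclideanSpace ℝ (Fin n)) ∞ S]
  [MeasurableSpace S] [BorelSpace S] in
theorem range_wordVector (F : Borchers n S →ₗ[ℂ] ℂ) (a : Label) :
    LinearMap.range (wordVector F a) = fieldSpace F a := by
  rw [wordVector, Finsupp.range_linearCombination, fieldSpace]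
  simp only [foldr_field]

omit [T2Space S] [SecondCountableTopology S] [IsManifold 𝓘(ℝ, EuclideanSpace ℝ (Fin n)) ∞ S]
  [MeasurableSpace S] [BorelSpace S] in
theorem field_wordVector (F : Borchers n S →ₗ[ℂ] ℂ) (a : Label) (f : Test n S)
    (x : List (Test n S) →₀ ℂ) :
    field F a f (wordVector F a x) = wordVector F a (Finsupp.mapDomain (List.cons f) x) := by
  induction x using Finsupp.induction_linear with
  | zero => simp
  | add x y hx hy => rw [map_add, map_add, hx, hy, Finsupp.mapDomain_add, map_add]
  | single w c =>
    rw [Finsupp.mapDomain_single, wordVector, Finsupp.linearCombination_single,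
      Finsupp.linearCombination_single, map_smul, List.map_cons, fieldWord_cons]
    rfl

/-- Since the inner product is indefinite, equality of the forms on words of `φ^a` does not
determine this kernel: a vector orthogonal to `𝓥^a` could be nonzero in `𝓥`. That it is not is the
content of `annihilates_clustered`. The kernel is the same for both asymptotic labels, which makes
`W` well defined. -/
theorem IsFormFactor.ker_wordVector (hF : A.IsFormFactor F) (hA : A.Admissible) {ε : ℝ}
    (hε : 0 < ε) (hinv : A.TimeInvariant) (hgap : A.SpectralGap ε) (hs : A.g.Stationary)
    (hdisp : A.Dispersion) {a : Label} (ha : a ≠ .loc) :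
    LinearMap.ker (wordVector F a) = nullVectors A.innVev := by
  have key : ∀ (l : List (Label × Test n S)) (x : List (Test n S) →₀ ℂ),
      F (fieldWord l * Finsupp.linearCombination ℂ
        (fun w : List (Test n S) => fieldWord (w.map (Prod.mk a))) x) =
      Finsupp.linearCombination ℂ
        (fun w => clustered A.truncatedWord (l ++ w.map (Prod.mk a))) x := by
    intro l x
    induction x using Finsupp.induction_linear with
    | zero => simp
    | add x y hx hy => simp only [map_add, mul_add, hx, hy]
    | single w c =>
      rw [Finsupp.linearCombination_single, Finsupp.linearCombination_single, mul_smul_comm,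
        map_smul, ← fieldWord_append, hF.apply_fieldWord]
  have hmk : ∀ x, wordVector F a x = (kernelIdeal F).mkQ (Finsupp.linearCombination ℂ
      (fun w : List (Test n S) => fieldWord (w.map (Prod.mk a))) x) := fun x => by
    induction x using Finsupp.induction_linear with
    | zero => simp
    | add x y hx hy => simp only [map_add, hx, hy]
    | single w c =>
      rw [wordVector, Finsupp.linearCombination_single, Finsupp.linearCombination_single, map_smul]
  ext x
  rw [LinearMap.mem_ker, hmk, Submodule.mkQ_apply, Submodule.Quotient.mk_eq_zero]
  constructor
  · intro h
    refine mem_nullVectors.2 fun z => ?_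
    have h1 := h (fieldWord (z.map (Prod.mk a)))
    rw [key] at h1
    simpa only [← List.map_append, hA.clustered_map_eq_innVev hε hinv hgap hs hdisp ha] using h1
  · intro h y
    induction y using borchers_induction with
    | word l =>
      rw [key]
      exact hA.annihilates_clustered hε hinv hgap hs hdisp ha l x h
    | add y z hy hz => rw [add_mul, map_add, hy, hz, add_zero]
    | smul c y hy => rw [smul_mul_assoc, map_smul, hy, smul_zero]

theorem IsFormFactor.form_wordVector (hF : A.IsFormFactor F) (hA : A.Admissible) {ε : ℝ}
    (hε : 0 < ε) (hinv : A.TimeInvariant) (hgap : A.SpectralGap ε) (hs : A.g.Stationary)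
    (hdisp : A.Dispersion) (hH : Hermitean F) {a a' : Label} (ha : a ≠ .loc) (ha' : a' ≠ .loc)
    (x y : List (Test n S) →₀ ℂ) :
    form F hH (wordVector F a x) (wordVector F a y) =
      form F hH (wordVector F a' x) (wordVector F a' y) := by
  have key : ∀ {a : Label}, a ≠ .loc → ∀ u v : List (Test n S),
      form F hH ((kernelIdeal F).mkQ (fieldWord (u.map (Prod.mk a))))
        ((kernelIdeal F).mkQ (fieldWord (v.map (Prod.mk a)))) =
      A.innVev ((u.map Test.conj).reverse ++ v) := by
    intro a ha u v
    rw [form_mk, involution_fieldWord, ← fieldWord_append, hF.apply_fieldWord,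
      ← hA.clustered_map_eq_innVev hε hinv hgap hs hdisp ha]
    congr 1
    rw [List.map_append, List.map_reverse, List.map_map, List.map_map]
    rfl
  induction x using Finsupp.induction_linear with
  | zero => simp
  | add x z hx hz => simp only [map_add, LinearMap.add_apply, hx, hz]
  | single u c =>
    induction y using Finsupp.induction_linear with
    | zero => simp
    | add y z hy hz => simp only [map_add, hy, hz]
    | single v d =>
      simp only [wordVector, Finsupp.linearCombination_single, LinearMap.map_smulₛₗ,
        LinearMap.smul_apply, map_smul, key ha, key ha']

theorem IsFormFactor.unitarilyEquivalent (hF : A.IsFormFactor F) (hA : A.Admissible) {ε : ℝ}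
    (hε : 0 < ε) (hinv : A.TimeInvariant) (hgap : A.SpectralGap ε) (hs : A.g.Stationary)
    (hdisp : A.Dispersion) (hH : Hermitean F) {a a' : Label} (ha : a ≠ .loc) (ha' : a' ≠ .loc) :
    UnitarilyEquivalent F hH a a' := by
  obtain ⟨W, hW⟩ := exists_equiv_of_ker_eq (range_wordVector F a) (range_wordVector F a')
    ((hF.ker_wordVector hA hε hinv hgap hs hdisp ha).trans
      (hF.ker_wordVector hA hε hinv hgap hs hdisp ha').symm)
  have hex : ∀ (a : Label) (Ψ : fieldSpace F a), ∃ x, wordVector F a x = Ψ := fun a Ψ =>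
    (range_wordVector F a).symm.le Ψ.2
  refine ⟨W, fun Ψ Φ => ?_, ?_, fun f Ψ => ?_⟩
  · obtain ⟨Ψ, hΨ⟩ := Ψ
    obtain ⟨Φ, hΦ⟩ := Φ
    obtain ⟨x, rfl⟩ := hex a ⟨Ψ, hΨ⟩
    obtain ⟨y, rfl⟩ := hex a ⟨Φ, hΦ⟩
    rw [hW, hW, hF.form_wordVector hA hε hinv hgap hs hdisp hH ha' ha]
  · apply Subtype.ext
    have h1 : ∀ a, vacuum F = wordVector F a (Finsupp.single [] 1) := fun a => by
      rw [wordVector, Finsupp.linearCombination_single, one_smul]; rfl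
    have h2 := hW (Finsupp.single [] 1) (h1 a ▸ vacuum_mem F a)
    simp only [← h1] at h2
    exact h2
  · obtain ⟨x, hx⟩ := hex a (W.symm Ψ)
    have h1 : (Ψ : StateSpace F) = wordVector F a' x := by
      rw [← hW x (hx ▸ (W.symm Ψ).2)]
      have : (⟨wordVector F a x, hx ▸ (W.symm Ψ).2⟩ : fieldSpace F a) = W.symm Ψ :=
        Subtype.ext hx
      rw [this, LinearEquiv.apply_symm_apply]
    apply Subtype.ext
    simp only [h1, ← hx, field_wordVector]
    exact hW _ _

end FieldData

end Unitary

end QFT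

end

/-! ### Assembly of the theorem -/

theorem theorem6p1 {n : ℕ} {S : Type*} [TopologicalSpace S] [T2Space S]
    [SecondCountableTopology S] [ChartedSpace (EuclideanSpace ℝ (Fin n)) S]
    [IsManifold 𝓘(ℝ, EuclideanSpace ℝ (Fin n)) ∞ S] [MeasurableSpace S] [BorelSpace S]
    (A : QFT.FieldData n S) (hA : A.Admissible) (hinv : A.TimeInvariant) (hdisp : A.Dispersion)
    (hstat : A.g.Stationary) (ε : ℝ) (hε : 0 < ε) (hgap : A.SpectralGap ε) :
    ∃ (F : QFT.Borchers n S →ₗ[ℂ] ℂ) (hH : QFT.Hermitean F) (hI : QFT.Invariant F),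
      A.IsFormFactor F ∧
      QFT.SpectralCondition F hH hI ∧
      A.IsCCRField F QFT.Label.inn ∧ A.IsCCRField F QFT.Label.out ∧
      (∀ (N : ℕ) (f : Fin N → QFT.Test n S), 3 ≤ N →
        A.truncated N (fun _ => QFT.Label.out) f = 0 ∧
        A.truncated N (fun _ => QFT.Label.inn) f = 0) ∧
      QFT.UnitarilyEquivalent F hH QFT.Label.inn QFT.Label.out := by
  have hF := hA.isFormFactor_formFactor hdisp
  have hH := hF.hermitean hA
  have hI := hF.invariant hA hinv hstat
  have hin : QFT.Label.inn ≠ .loc := by decide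
  have hout : QFT.Label.out ≠ .loc := by decide
  refine ⟨_, hH, hI, hF, hF.spectralCondition hA hε hinv hgap hstat hdisp hH hI,
    hF.isCCRField hA hdisp hin, hF.isCCRField hA hdisp hout, fun N f hN => ⟨?_, ?_⟩,
    hF.unitarilyEquivalent hA hε hinv hgap hstat hdisp hH hin hout⟩
  · have h := hA.truncatedWord_out hε hinv hgap hstat hdisp (w := List.ofFn f) (by simpa using hN)
    rwa [List.map_ofFn, A.truncatedWord_ofFn] at h
  · exact A.truncated_inn hN f
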